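/- Let $N\ge 3$, $\alpha\in[1,2)$, $m_1,\dots,m_N>0$, $M=\sum_k m_k$, and let $c_1,\dots,c_N\in\mathbb{R}^2=\mathbb{C}$ be distinct points with $\sum_k m_kc_k=0$. For $\varepsilon>0$ let $c_k'=\varepsilon c_k/\max_j|c_j|$, so that $\max_k|c'_k|=\varepsilon$, and for $\nu'\in\mathbb{R}$ put $$\Phi_{\nu',\varepsilon}(y)=\frac{(\nu')^2}{2}|y|^2+\sum_{k=1}^N\frac{m_k}{\alpha|y-c'_k|^\alpha},\qquad R=\Big(\frac{(2-\alpha)M}{2\alpha}\Big)^{1/\alpha}.$$ On $H^1$ paths $u$ on $[0,1]$ with values in $\{\Phi_{\nu',\varepsilon}\ge 1\}$ (where $\Phi_{\nu',\varepsilon}=+\infty$ at the centres $c'_k$) let $$M_{-1,\nu'}(u)=\sqrt2\Big(\int_0^1|\dot u|^2\Big)^{1/2}\Big(\int_0^1(\Phi_{\nu',\varepsilon}(u)-1)\Big)^{1/2}+\nu'\int_0^1\langle iu,\dot u\rangle\in(-\infty,+\infty].$$ *Classes of paths.* Let $p_1,p_2\in\partial B_R(0)$. A winding vector is an $l\in\mathbb{Z}_2^N$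 whose entries are not all equal. For a winding vector $l$ let $\widehat H_l^{p_1p_2}([a,b])$ be the set of $u\in H^1([a,b],\mathbb{R}^2)$ with $u(a)=p_1$, $u(b)=p_2$, $u(t)\ne c'_j$ for all $t$ and $j$, such that the closed path consisting of $u$ and the counterclockwise arc of $\partial B_R(0)$ from $p_2$ to $p_1$ (no arc if $p_1=p_2$) has winding number $\equiv l_j$ mod $2$ around $c'_j$, for every $j$. Let $H_l^{p_1p_2}([a,b])$ be the set of the limits of sequences in $\widehat H_l^{p_1p_2}([a,b])$ that converge weakly in $H^1$, and let $K_l^{p_1p_2}([a,b])$ be the set of the $u\in H_l^{p_1p_2}([a,b])$ with $|u|\le R$. For a partition $P$ of the centres in two non-empty sets let $K_P^{p_1p_2}([a,b])$ be the union of the $K_l^{p_1p_2}([a,b])$ over the winding vectors $l$ that induce $P$, i.e. $P=\{\{c_k:l_k=0\},\{c_k:l_k=1\}\}$. *Weak solutions.* Consider the inner problem $$\ddot y+2\nu' i\dot y=\nabla\Phi_{\nu',\varepsilon}(y),\qquad \tfrac12|\dot y|^2-\Phi_{\nu',\varepsilon}(y)=-1,\qquad |y(t)|<R\ \ (0<t<T),\qquad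 y(0)=p_1,\ y(T)=p_2,\tag{1}$$ where $T>0$ is not prescribed. Let $K$ be one of the classes $K_l^{p_1p_2}([0,1])$, $K_P^{p_1p_2}([0,1])$. A weak solution of (1) associated with $K$ is a continuous path $y$ on $[0,T]$ of the form $y(t)=u(\omega t)$, $T=1/\omega$, where $u$ is a local minimizer (in the $H^1$ norm) of $M_{-1,\nu'}$ in $K$, both integrals $\int_0^1|\dot u|^2$ and $\int_0^1(\Phi_{\nu',\varepsilon}(u)-1)$ are positive and finite, and $\omega>0$ is given by $$\omega^2=\frac{\int_0^1(\Phi_{\nu',\varepsilon}(u)-1)}{\frac12\int_0^1|\dot u|^2};$$ moreover $y(0)=p_1$, $y(T)=p_2$, $|y(t)|<R$ for all $t\in(0,T)$, $y$ meets the centres $c'_k$ at only finitely many times, and at all other times in $(0,T)$ it is of class $C^2$ and satisfies the first two equations of (1). **Statement.** There exist $\varepsilon_4>0$ and $\nu_2'>0$ (depending only on $\alpha$, the $m_k$ and the $c_k$) such that for all $p_1,p_2\in\partial B_R(0)$, $\varepsilon\in(0,\varepsilon_4)$ and $\nu'\in(-\nu'_2,\nu'_2)$: 1. for every winding vector $l$,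 problem (1) has a weak solution $y\in K_l^{p_1p_2}([0,T])$ (for some $T>0$) associated with $K_l^{p_1p_2}([0,1])$, hence a reparametrization of a local minimizer of $M_{-1,\nu'}$ in that class; 2. for every partition $P$ of the centres in two non-empty sets, problem (1) has a weak solution $y\in K_P^{p_1p_2}([0,T])$ (for some $T>0$) associated with $K_P^{p_1p_2}([0,1])$. -/

import Mathlib

open MeasureTheory Filter Topology

noncomputable section

namespace RotatingCentres

/-! The plane is identified with `ℂ`, so that `i` acts by multiplication with `Complex.I`.
A path on `[a, b]` is a function `ℝ → ℂ` of which only the values on `[a, b]` matter. -/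

/-! ### The potential -/

/-- The centres `c'_k`: the configuration `c` rescaled so that `max_k |c'_k| = ε`. -/
def scaledCentres {N : ℕ} (c : Fin N → ℂ) (ε : ℝ) : Fin N → ℂ :=
  fun k => ((ε / ⨆ j, ‖c j‖ : ℝ) : ℂ) * c k

/-- The radius of the circular orbit of energy `-1` of the `α`-Kepler problem of mass `∑ m_k`. -/
def circularRadius {N : ℕ} (α : ℝ) (m : Fin N → ℝ) : ℝ :=
  ((2 - α) * (∑ k, m k) / (2 * α)) ^ (1 / α)

/-- `Φ_ν(y) = ν² |y|² / 2 + ∑_k m_k / (α |y - c_k|^α)`, meaningful away from the centres. -/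
def effectivePotential {N : ℕ} (α : ℝ) (m : Fin N → ℝ) (c : Fin N → ℂ) (ν : ℝ) (y : ℂ) : ℝ :=
  ν ^ 2 / 2 * ‖y‖ ^ 2 + ∑ k, m k / (α * ‖y - c k‖ ^ α)

open Classical in
/-- `Φ_ν + h` with its value `+∞` at the centres. Where `Φ_ν + h < 0`, that is, outside of the
Hill region, it is cut off at `0`. -/
def extendedPotential {N : ℕ} (α : ℝ) (m : Fin N → ℝ) (c : Fin N → ℂ) (h ν : ℝ) (y : ℂ) :
    ENNReal :=
  if ∃ k, y = c k then ⊤ else ENNReal.ofReal (effectivePotential α m c ν y + h)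

/-! ### Sobolev paths -/

/-- `u` is (the continuous representative of) an element of `H¹([a, b], ℝ²)`: it is the integral
of its almost everywhere defined derivative, and this derivative is square integrable. -/
def MemH1 (a b : ℝ) (u : ℝ → ℂ) : Prop :=
  MemLp (deriv u) 2 (volume.restrict (Set.Icc a b)) ∧
    ∀ t ∈ Set.Icc a b, u t = u a + ∫ s in a..t, deriv u s

/-- The squared distance of `u` and `v` in `H¹([a, b], ℝ²)`. -/
def h1DistSq (a b : ℝ) (u v : ℝ → ℂ) : ℝ :=
  (∫ t in a..b, ‖u t - v t‖ ^ 2) + ∫ t in a..b, ‖deriv u t - deriv v t‖ ^ 2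

/-- Weak convergence in `H¹([a, b], ℝ²)` of a sequence of paths: the continuous linear
functionals on `H¹` are the maps `u ↦ ∫ ⟨φ, u⟩ + ∫ ⟨ψ, u'⟩` with `φ, ψ ∈ L²`. -/
def TendstoWeaklyH1 (a b : ℝ) (w : ℕ → ℝ → ℂ) (u : ℝ → ℂ) : Prop :=
  ∀ φ ψ : ℝ → ℂ, MemLp φ 2 (volume.restrict (Set.Icc a b)) →
    MemLp ψ 2 (volume.restrict (Set.Icc a b)) →
    Tendsto
      (fun n => (∫ t in a..b, inner ℝ (φ t) (w n t)) + ∫ t in a..b, inner ℝ (ψ t) (deriv (w n) t))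
      atTop
      (𝓝 ((∫ t in a..b, inner ℝ (φ t) (u t)) + ∫ t in a..b, inner ℝ (ψ t) (deriv u t)))

/-! ### Winding numbers -/

/-- The winding number of the closed path `γ : [a, b] → ℂ` around `z` is `n`. -/
def HasWindingNumber (a b : ℝ) (γ : ℝ → ℂ) (z : ℂ) (n : ℤ) : Prop :=
  ∃ θ : ℝ → ℝ, ContinuousOn θ (Set.Icc a b) ∧
    (∀ t ∈ Set.Icc a b, γ t ≠ z ∧ γ t - z = ‖γ t - z‖ * Complex.exp (θ t * Complex.I)) ∧
    θ b - θ a = 2 * Real.pi * n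

/-- The angle in `[0, 2π)` that is swept when one goes counterclockwise from `p₂` to `p₁` on a
circle around the origin. It is `0` if `p₁ = p₂`. -/
def closingAngle (p₁ p₂ : ℂ) : ℝ :=
  toIcoMod Real.two_pi_pos 0 (Complex.arg p₁ - Complex.arg p₂)

/-- The path `u : [a, b] → ℂ`, with both ends on a circle around the origin, followed by the
counterclockwise arc of this circle from `u b` to `u a`. It is parametrized by
`[a, b + closingAngle (u a) (u b)]`. -/
def closedUp (b : ℝ) (u : ℝ → ℂ) : ℝ → ℂ :=
  fun t => if t ≤ b then u t
    else ‖u b‖ * Complex.exp ((t - b + Complex.arg (u b) : ℝ) * Complex.I)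

/-! ### Classes of paths -/

/-- Winding vectors: the parities are not all the same. -/
def IsWindingVector {N : ℕ} (l : Fin N → ZMod 2) : Prop :=
  ∃ j k, j ≠ k ∧ l j ≠ l k

/-- The collision-free `H¹` paths on `[a, b]` from `p₁` to `p₂` whose winding numbers
with respect to the centres have the parities `l`. -/
def freeClass {N : ℕ} (c : Fin N → ℂ) (p₁ p₂ : ℂ) (l : Fin N → ZMod 2) (a b : ℝ) :
    Set (ℝ → ℂ) :=
  {u | MemH1 a b u ∧ u a = p₁ ∧ u b = p₂ ∧ (∀ t ∈ Set.Icc a b, ∀ j, u t ≠ c j) ∧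
    ∀ j, ∃ n : ℤ, HasWindingNumber a (b + closingAngle (u a) (u b)) (closedUp b u) (c j) n ∧
      (n : ZMod 2) = l j}

/-- `H_l`: the limits of the weakly convergent sequences in `freeClass`. -/
def weakClass {N : ℕ} (c : Fin N → ℂ) (p₁ p₂ : ℂ) (l : Fin N → ZMod 2) (a b : ℝ) :
    Set (ℝ → ℂ) :=
  {u | MemH1 a b u ∧ u a = p₁ ∧ u b = p₂ ∧
    ∃ w : ℕ → ℝ → ℂ, (∀ n, w n ∈ freeClass c p₁ p₂ l a b) ∧ TendstoWeaklyH1 a b w u}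

/-- `K_l`: the paths in `H_l` that stay in the closed ball of radius `R`. -/
def ballClass {N : ℕ} (c : Fin N → ℂ) (R : ℝ) (p₁ p₂ : ℂ) (l : Fin N → ZMod 2) (a b : ℝ) :
    Set (ℝ → ℂ) :=
  {u | u ∈ weakClass c p₁ p₂ l a b ∧ ∀ t ∈ Set.Icc a b, ‖u t‖ ≤ R}

/-- The partition of the (indices of the) centres that is induced by `l` is `P`. -/
def Induces {N : ℕ} (l : Fin N → ZMod 2) (P : Finpartition (Finset.univ : Finset (Fin N))) :
    Prop :=
  P.parts = {Finset.univ.filter (fun k => l k = 0), Finset.univ.filter (fun k => l k = 1)}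

/-- `K_P`: the union of the classes `K_l` over the winding vectors `l` that induce `P`. -/
def partitionClass {N : ℕ} (c : Fin N → ℂ) (R : ℝ) (p₁ p₂ : ℂ)
    (P : Finpartition (Finset.univ : Finset (Fin N))) (a b : ℝ) : Set (ℝ → ℂ) :=
  {u | ∃ l : Fin N → ZMod 2, IsWindingVector l ∧ Induces l P ∧ u ∈ ballClass c R p₁ p₂ l a b}

/-! ### The Maupertuis-type functional -/

/-- `∫_a^b |u'|²`. -/
def kineticIntegral (a b : ℝ) (u : ℝ → ℂ) : ENNReal :=
  ∫⁻ t in Set.Icc a b, ENNReal.ofReal (‖deriv u t‖ ^ 2)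

/-- `∫_a^b (Φ_ν(u) + h)`. -/
def potentialIntegral {N : ℕ} (α : ℝ) (m : Fin N → ℝ) (c : Fin N → ℂ) (h ν a b : ℝ)
    (u : ℝ → ℂ) : ENNReal :=
  ∫⁻ t in Set.Icc a b, extendedPotential α m c h ν (u t)

/-- `M_{h,ν}(u) = √2 (∫ |u'|²)^{1/2} (∫ (Φ_ν(u) + h))^{1/2} + ν ∫ ⟨i u, u'⟩`. -/
def maupertuis {N : ℕ} (α : ℝ) (m : Fin N → ℝ) (c : Fin N → ℂ) (h ν a b : ℝ)
    (u : ℝ → ℂ) : EReal :=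
  ((ENNReal.ofReal (Real.sqrt 2) * kineticIntegral a b u ^ (1 / 2 : ℝ) *
      potentialIntegral α m c h ν a b u ^ (1 / 2 : ℝ) : ENNReal) : EReal) +
    ((ν * ∫ t in a..b, inner ℝ (Complex.I * u t) (deriv u t) : ℝ) : EReal)

/-- `u` is a local minimizer of `F` in the set `K` of paths on `[a, b]`, with respect to the
`H¹` distance. -/
def IsLocalMinimizer (a b : ℝ) (F : (ℝ → ℂ) → EReal) (K : Set (ℝ → ℂ)) (u : ℝ → ℂ) : Prop :=
  u ∈ K ∧ ∃ δ > 0, ∀ v ∈ K, h1DistSq a b u v < δ → F u ≤ F v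

/-- `ω > 0` with `ω² = ∫ (Φ_ν(u) + h) / (½ ∫ |u'|²)`, the integrals being over `[0, 1]`. -/
def frequency {N : ℕ} (α : ℝ) (m : Fin N → ℝ) (c : Fin N → ℂ) (h ν : ℝ) (u : ℝ → ℂ) : ℝ :=
  Real.sqrt ((potentialIntegral α m c h ν 0 1 u).toReal / (1 / 2 * (kineticIntegral 0 1 u).toReal))

/-! ### Inner solutions -/

/-- `y` is, away from finitely many collisions, a classical solution on `[0, T]` of
`y'' + 2 ν i y' = ∇Φ_ν(y)` with Jacobi constant `h` that runs from `p₁` to `p₂` and lies in the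
open ball of radius `R` at all times in `(0, T)`. -/
structure SolvesInnerProblem {N : ℕ} (α : ℝ) (m : Fin N → ℝ) (c : Fin N → ℂ) (h ν R : ℝ)
    (p₁ p₂ : ℂ) (T : ℝ) (y : ℝ → ℂ) : Prop where
  start : y 0 = p₁
  finish : y T = p₂
  inside : ∀ t ∈ Set.Ioo 0 T, ‖y t‖ < R
  continuous : ContinuousOn y (Set.Icc 0 T)
  collisions : {t ∈ Set.Icc 0 T | ∃ k, y t = c k}.Finite
  smooth : ∀ t ∈ Set.Ioo 0 T, (∀ k, y t ≠ c k) → ContDiffAt ℝ 2 y t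
  motion : ∀ t ∈ Set.Ioo 0 T, (∀ k, y t ≠ c k) →
    deriv (deriv y) t + 2 * ν * Complex.I * deriv y t = gradient (effectivePotential α m c ν) (y t)
  jacobi : ∀ t ∈ Set.Ioo 0 T, (∀ k, y t ≠ c k) →
    1 / 2 * ‖deriv y t‖ ^ 2 - effectivePotential α m c ν (y t) = h

/-- `y` is a weak solution on `[0, T]` of the inner problem with Jacobi constant `h`, obtained
from the path `u` on `[0, 1]`: `u` is a local minimizer of `M_{h,ν}` in the class `K` of paths on
`[0, 1]`, both integrals in `M_{h,ν}(u)` are positive and finite, and `y(t) = u(ω t)`,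
`T = 1 / ω`; and `y` solves the inner problem away from its finitely many collisions. -/
structure IsWeakSolutionFrom {N : ℕ} (α : ℝ) (m : Fin N → ℝ) (c : Fin N → ℂ) (h ν R : ℝ)
    (p₁ p₂ : ℂ) (K : Set (ℝ → ℂ)) (u : ℝ → ℂ) (T : ℝ) (y : ℝ → ℂ) : Prop where
  minimizer : IsLocalMinimizer 0 1 (maupertuis α m c h ν 0 1) K u
  kinetic_pos : 0 < kineticIntegral 0 1 u
  kinetic_finite : kineticIntegral 0 1 u < ⊤
  potential_pos : 0 < potentialIntegral α m c h ν 0 1 u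
  potential_finite : potentialIntegral α m c h ν 0 1 u < ⊤
  time_pos : 0 < T
  time : T = 1 / frequency α m c h ν u
  reparam : ∀ t ∈ Set.Icc 0 T, y t = u (frequency α m c h ν u * t)
  solves : SolvesInnerProblem α m c h ν R p₁ p₂ T y

end RotatingCentres

end

noncomputable section

namespace RotatingCentres

section

/-! ### Sobolev paths: basic facts -/

/-! The solutions come from the direct method, applied to a relaxed class of paths. The class
`ballClass` is defined by weak limits and is awkward to minimize in, so it is replaced by a
topological condition, `topClass`: a path meets a centre or winds around it with the prescribed
parity. This condition survives uniform limits, hence weak `H¹` limits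
(`mem_topClass_of_tendstoUniformlyOn`), and so it contains the original class. Conversely, a path in
`topClass` with finitely many collisions is a strong `H¹` limit of collision-free paths of the right
parities. Indeed each collision can be bypassed by two cheap detours that differ by one full turn,
and one of them has the right parity (`mem_weakClass_of_finite_collisions`). It is therefore enough
to minimize in `topBall` and to show that minimizers have finitely many collisions.

Existence (`exists_minimizer`): on the ball `Φ - 1 ≥ 1/2`, so for small `ν` the area term is
dominated by the product term and the kinetic integral is controlled by the action. Since two
entries of `l` differ, the path must come close to the centres: far from them all winding numbers
would agree. This bounds the kinetic integral below, and hence the potential integral above. Weak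
compactness, Cauchy–Schwarz and Fatou's lemma do the rest.

At the frequency `ω` of a minimizer `u`, the arithmetic–geometric mean inequality shows that `u`
also minimizes a Lagrangian action that is linear in the three integrals (`lagrangian_le`).
Piecewise affine changes of time give conservation of energy almost everywhere (`energy`).
Contracting an arc towards a point `z`, with a tent function as weight, gives `tent_inequality`, an
integrated form of the Lagrange–Jacobi inequality for `|y - z|² / 2`. It needs no regularity, and a
contraction towards a point of the ball never leaves the ball. It is used twice.

For `z` a centre, the Lagrange–Jacobi quantity is positive nearby because `α < 2`. So the distance
to the centre has no interior maximum on a short excursion, and collisions cannot accumulate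
(`finite_collisions`).

For `z = 0`, the number `R` is the radius at which this quantity vanishes for the Kepler problem at
energy `-1`. For small `ε` and `ν` it is at least `-κ` on the annulus `R/2 ≤ |y| ≤ R`
(`exists_virial_ge`). A path that touches the outer circle at an interior time and also reaches
radius `R/2` then violates the inequality, provided that `κ` is small compared with `ω²`
(`norm_lt`). A lower bound for `ω` independent of `ε`, `ν`, `l` and the endpoints follows from a
competitor of bounded cost through all centres (`exists_competitor`). It is made of curves with
radius of order `t^γ`, where `1/2 < γ < 1/α`, and of a rescaling under which the costs do not grow.

Once the minimizer is inside the open ball, variations of both signs are allowed, and the lemma of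
du Bois-Reymond gives the equation of motion away from the centres (`regular`). For a partition, the
best of the minimizers over the finitely many `l` that induce it is taken. -/

theorem _root_.AbsolutelyContinuousOnInterval.congr_Icc {f g : ℝ → ℂ} {a b : ℝ}
    (hf : AbsolutelyContinuousOnInterval f a b) (h : ∀ t ∈ Set.uIcc a b, g t = f t) :
    AbsolutelyContinuousOnInterval g a b := by
  rw [absolutelyContinuousOnInterval_iff] at hf ⊢
  intro ε hε
  obtain ⟨δ, hδ, H⟩ := hf ε hε
  refine ⟨δ, hδ, fun E hE hlen => ?_⟩
  refine lt_of_eq_of_lt (Finset.sum_congr rfl fun i hi => ?_) (H E hE hlen)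
  rw [h _ (hE.1 i hi).1, h _ (hE.1 i hi).2]

theorem _root_.AbsolutelyContinuousOnInterval.ofReal {f : ℝ → ℝ} {a b : ℝ}
    (hf : AbsolutelyContinuousOnInterval f a b) :
    AbsolutelyContinuousOnInterval (fun t => (f t : ℂ)) a b := by
  rw [absolutelyContinuousOnInterval_iff] at hf ⊢
  simpa only [Complex.isometry_ofReal.dist_eq] using hf

theorem absolutelyContinuousOnInterval_integral {g : ℝ → ℂ} {a b : ℝ}
    (hg : IntervalIntegrable g volume a b) :
    AbsolutelyContinuousOnInterval (fun x => ∫ t in a..x, g t) a b := by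
  have hre : IntervalIntegrable (fun t => (g t).re) volume a b := by
    rw [intervalIntegrable_iff] at hg ⊢; exact hg.re
  have him : IntervalIntegrable (fun t => (g t).im) volume a b := by
    rw [intervalIntegrable_iff] at hg ⊢; exact hg.im
  have h1 := (hre.absolutelyContinuousOnInterval_intervalIntegral (c := a) (by simp)).ofReal
  have h2 := (him.absolutelyContinuousOnInterval_intervalIntegral (c := a) (by simp)).ofReal
  refine (h1.fun_add (h2.const_smul Complex.I)).congr_Icc fun t ht => ?_
  have hgt : IntervalIntegrable g volume a t :=
    hg.mono_set (Set.uIcc_subset_uIcc (by simp) ht)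
  have e1 := Complex.reCLM.intervalIntegral_comp_comm hgt
  have e2 := Complex.imCLM.intervalIntegral_comp_comm hgt
  simp only [Complex.reCLM_apply, Complex.imCLM_apply] at e1 e2
  rw [e1, e2, smul_eq_mul, mul_comm, Complex.re_add_im]

theorem _root_.MeasureTheory.MemLp.intervalIntegrable_two {g : ℝ → ℂ} {a b : ℝ} (hab : a ≤ b)
    (hg : MemLp g 2 (volume.restrict (Set.Icc a b))) : IntervalIntegrable g volume a b := by
  rw [intervalIntegrable_iff_integrableOn_Icc_of_le hab]
  exact hg.integrable one_le_two

/-- The difference of the two sides is absolutely continuous with derivative zero almost everywhere,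
hence constant. -/
theorem integral_eq_of_ae_hasDerivAt {f g : ℝ → ℂ} {a b : ℝ} (hab : a ≤ b)
    (hf : AbsolutelyContinuousOnInterval f a b) (hg : IntervalIntegrable g volume a b)
    (h : ∀ᵐ t, t ∈ Set.Icc a b → HasDerivAt f (g t) t) :
    ∀ t ∈ Set.Icc a b, f t = f a + ∫ s in a..t, g s := by
  have hd := hf.fun_sub (absolutelyContinuousOnInterval_integral hg)
  obtain ⟨C, hC⟩ := hd.const_of_ae_hasDerivAt_zero (by
    filter_upwards [h, hg.ae_hasDerivAt_integral] with t h1 h2 ht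
    rw [Set.uIcc_of_le hab] at ht h2
    simpa using (h1 ht).fun_sub (h2 ht a (by simp [hab])))
  intro t ht
  rw [Set.uIcc_of_le hab] at hC
  have h1 := hC t ht
  have h2 := hC a (by simp [hab])
  simp only [intervalIntegral.integral_same, sub_zero] at h2
  rw [h2, ← h1]; ring

theorem hasDerivAt_of_integral {f g : ℝ → ℂ} {a b : ℝ} (hab : a ≤ b)
    (hg : IntervalIntegrable g volume a b)
    (h : ∀ t ∈ Set.Icc a b, f t = f a + ∫ s in a..t, g s) :
    ∀ᵐ t, t ∈ Set.Icc a b → HasDerivAt f (g t) t := by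
  have hne : ∀ x : ℝ, ∀ᵐ t : ℝ, t ≠ x := fun x => by simp [ae_iff, measure_singleton]
  filter_upwards [hg.ae_hasDerivAt_integral, hne a, hne b] with t h2 ha hb ht
  rw [Set.uIcc_of_le hab] at h2
  have := (h2 ht a (by simp [hab])).const_add (f a)
  refine this.congr_of_eventuallyEq ?_
  have : Set.Ioo a b ∈ 𝓝 t := Ioo_mem_nhds (lt_of_le_of_ne ht.1 ha.symm) (lt_of_le_of_ne ht.2 hb)
  filter_upwards [this] with s hs
  exact h s ⟨hs.1.le, hs.2.le⟩

theorem _root_.MeasureTheory.MemLp.congr_deriv {f g : ℝ → ℂ} {a b : ℝ}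
    (hg : MemLp g 2 (volume.restrict (Set.Icc a b)))
    (h : ∀ᵐ t, t ∈ Set.Icc a b → HasDerivAt f (g t) t) :
    MemLp (deriv f) 2 (volume.restrict (Set.Icc a b)) ∧
      ∀ᵐ t, t ∈ Set.Icc a b → deriv f t = g t := by
  have h' : ∀ᵐ t, t ∈ Set.Icc a b → deriv f t = g t := by
    filter_upwards [h] with t ht h using (ht h).deriv
  refine ⟨(memLp_congr_ae ?_).2 hg, h'⟩
  rw [Filter.EventuallyEq, ae_restrict_iff' measurableSet_Icc]
  exact h'

theorem integral_congr_Icc {E : Type*} [NormedAddCommGroup E] [NormedSpace ℝ E] {f g : ℝ → E}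
    {a b : ℝ} (hab : a ≤ b) (h : ∀ᵐ t, t ∈ Set.Icc a b → f t = g t) :
    ∫ t in a..b, f t = ∫ t in a..b, g t := by
  refine intervalIntegral.integral_congr_ae ?_
  filter_upwards [h] with t ht h
  rw [Set.uIoc_of_le hab] at h
  exact ht ⟨h.1.le, h.2⟩

/-- Any square integrable density will do: by Lebesgue differentiation it agrees almost everywhere
with `deriv f`, whose default values on the exceptional null set do not matter. -/
theorem memH1_of_integral {f g : ℝ → ℂ} {a b : ℝ} (hab : a ≤ b)
    (hg : MemLp g 2 (volume.restrict (Set.Icc a b)))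
    (h : ∀ t ∈ Set.Icc a b, f t = f a + ∫ s in a..t, g s) : MemH1 a b f := by
  have hi := hg.intervalIntegrable_two hab
  obtain ⟨h1, h2⟩ := hg.congr_deriv (hasDerivAt_of_integral hab hi h)
  refine ⟨h1, fun t ht => ?_⟩
  rw [h t ht]
  congr 1
  refine integral_congr_Icc ht.1 ?_
  filter_upwards [h2] with s hs hst
  exact (hs ⟨hst.1, hst.2.trans ht.2⟩).symm

theorem memH1_of_hasDerivAt {f g : ℝ → ℂ} {a b : ℝ} (hab : a ≤ b)
    (hf : AbsolutelyContinuousOnInterval f a b)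
    (hg : MemLp g 2 (volume.restrict (Set.Icc a b)))
    (h : ∀ᵐ t, t ∈ Set.Icc a b → HasDerivAt f (g t) t) : MemH1 a b f :=
  memH1_of_integral hab hg
    (integral_eq_of_ae_hasDerivAt hab hf (hg.intervalIntegrable_two hab) h)

namespace MemH1

variable {a b : ℝ} {u v : ℝ → ℂ}

theorem intervalIntegrable (h : MemH1 a b u) (hab : a ≤ b) :
    IntervalIntegrable (deriv u) volume a b := h.1.intervalIntegrable_two hab

theorem ae_hasDerivAt (h : MemH1 a b u) (hab : a ≤ b) :
    ∀ᵐ t, t ∈ Set.Icc a b → HasDerivAt u (deriv u t) t :=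
  hasDerivAt_of_integral hab (h.intervalIntegrable hab) h.2

theorem absolutelyContinuous (h : MemH1 a b u) (hab : a ≤ b) :
    AbsolutelyContinuousOnInterval u a b := by
  have h1 := absolutelyContinuousOnInterval_integral (h.intervalIntegrable hab)
  have h2 : AbsolutelyContinuousOnInterval (fun _ : ℝ => u a) a b :=
    (LipschitzWith.const (u a)).lipschitzOnWith.absolutelyContinuousOnInterval
  exact (h2.fun_add h1).congr_Icc fun t ht => h.2 t (by rwa [Set.uIcc_of_le hab] at ht)

theorem continuousOn (h : MemH1 a b u) (hab : a ≤ b) : ContinuousOn u (Set.Icc a b) := by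
  have := (h.absolutelyContinuous hab).continuousOn
  rwa [Set.uIcc_of_le hab] at this

theorem mono (h : MemH1 a b u) {c d : ℝ} (hac : a ≤ c) (hcd : c ≤ d) (hdb : d ≤ b) :
    MemH1 c d u := by
  have hi := h.intervalIntegrable (hac.trans (hcd.trans hdb))
  refine ⟨h.1.mono_measure (Measure.restrict_mono (Set.Icc_subset_Icc hac hdb) le_rfl),
    fun t ht => ?_⟩
  rw [h.2 t ⟨hac.trans ht.1, ht.2.trans hdb⟩, h.2 c ⟨hac, hcd.trans hdb⟩, add_assoc,
    intervalIntegral.integral_add_adjacent_intervals]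
  all_goals refine hi.mono_set ?_
  all_goals rw [Set.uIcc_of_le (by linarith [ht.1]), Set.uIcc_of_le (by linarith [ht.2])]
  all_goals refine Set.Icc_subset_Icc ?_ ?_ <;> linarith [ht.1, ht.2]

theorem sub_eq_integral (h : MemH1 a b u) {s t : ℝ} (has : a ≤ s) (hst : s ≤ t) (htb : t ≤ b) :
    u t - u s = ∫ r in s..t, deriv u r := by
  rw [(h.mono has hst htb).2 t ⟨hst, le_rfl⟩]; ring

theorem congr (h : MemH1 a b u) (hab : a ≤ b) (huv : ∀ t ∈ Set.Icc a b, v t = u t) :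
    MemH1 a b v := by
  refine memH1_of_integral hab h.1 fun t ht => ?_
  rw [huv t ht, huv a ⟨le_rfl, hab⟩, h.2 t ht]

theorem trans {c : ℝ} (h : MemH1 a b u) (h' : MemH1 b c u) (hab : a ≤ b) (hbc : b ≤ c) :
    MemH1 a c u := by
  constructor
  · rw [← Set.Icc_union_Icc_eq_Icc hab hbc]
    have hm : AEStronglyMeasurable (deriv u) (volume.restrict (Set.Icc a b ∪ Set.Icc b c)) :=
      aestronglyMeasurable_union_iff.2 ⟨h.1.1, h'.1.1⟩
    have h1 := (memLp_two_iff_integrable_sq_norm h.1.1).1 h.1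
    have h2 := (memLp_two_iff_integrable_sq_norm h'.1.1).1 h'.1
    exact (memLp_two_iff_integrable_sq_norm hm).2 (IntegrableOn.union h1 h2)
  · intro t ht
    rcases le_total t b with htb | htb
    · exact h.2 t ⟨ht.1, htb⟩
    · rw [h'.2 t ⟨htb, ht.2⟩, h.2 b ⟨hab, le_rfl⟩, add_assoc,
        intervalIntegral.integral_add_adjacent_intervals (h.intervalIntegrable hab)]
      exact (h'.mono le_rfl htb ht.2).intervalIntegrable htb

theorem add (hu : MemH1 a b u) (hv : MemH1 a b v) (hab : a ≤ b) :
    MemH1 a b (fun t => u t + v t) ∧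
      ∀ᵐ t, t ∈ Set.Icc a b → HasDerivAt (fun t => u t + v t) (deriv u t + deriv v t) t := by
  have h : ∀ᵐ t, t ∈ Set.Icc a b →
      HasDerivAt (fun t => u t + v t) (deriv u t + deriv v t) t := by
    filter_upwards [hu.ae_hasDerivAt hab, hv.ae_hasDerivAt hab] with t h1 h2 ht
    exact (h1 ht).fun_add (h2 ht)
  exact ⟨memH1_of_hasDerivAt hab ((hu.absolutelyContinuous hab).fun_add
    (hv.absolutelyContinuous hab)) (hu.1.add hv.1) h, h⟩

theorem const_smul (hu : MemH1 a b u) (hab : a ≤ b) (s : ℝ) :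
    MemH1 a b (fun t => (s : ℂ) * u t) ∧
      ∀ᵐ t, t ∈ Set.Icc a b → HasDerivAt (fun t => (s : ℂ) * u t) (s * deriv u t) t := by
  have h : ∀ᵐ t, t ∈ Set.Icc a b → HasDerivAt (fun t => (s : ℂ) * u t) (s * deriv u t) t := by
    filter_upwards [hu.ae_hasDerivAt hab] with t h1 ht
    exact (h1 ht).const_mul _
  exact ⟨memH1_of_hasDerivAt hab ((hu.absolutelyContinuous hab).const_smul (s : ℂ))
    (hu.1.const_mul _) h, h⟩

end MemH1

theorem memH1_const {a b : ℝ} (hab : a ≤ b) (z : ℂ) : MemH1 a b (fun _ => z) :=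
  memH1_of_integral (g := fun _ => 0) hab MemLp.zero' (by simp)

theorem measurePreserving_affine {p : ℝ} (hp : 0 < p) (q : ℝ) :
    MeasurePreserving (fun t : ℝ => p * t + q) (ENNReal.ofReal |p| • volume) volume := by
  refine ⟨by fun_prop, ?_⟩
  have h1 := Real.smul_map_volume_mul_left hp.ne'
  have h2 := map_add_right_eq_self (volume : Measure ℝ) q
  rw [show (fun t : ℝ => p * t + q) = (fun t => t + q) ∘ (fun t => p * t) from rfl,
    ← Measure.map_map (by fun_prop) (by fun_prop), Measure.map_smul, h1, h2]

theorem MemH1.comp_affine {a b : ℝ} {u : ℝ → ℂ} {p q c d : ℝ} (hp : 0 < p) (hcd : c ≤ d)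
    (h : MemH1 a b u) (hac : a ≤ p * c + q) (hdb : p * d + q ≤ b) :
    MemH1 c d (fun t => u (p * t + q)) ∧
      ∀ t, deriv (fun t => u (p * t + q)) t = p * deriv u (p * t + q) := by
  have hd : ∀ t, deriv (fun t => u (p * t + q)) t = p * deriv u (p * t + q) := by
    intro t
    have := deriv_comp_mul_left p (fun s => u (s + q)) t
    rw [this, deriv_comp_add_const]
    simp
  have hab : a ≤ b := hac.trans (le_trans (by nlinarith) hdb)
  refine ⟨⟨?_, ?_⟩, hd⟩
  · rw [funext hd]
    refine MemLp.const_mul ?_ _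
    have hmono := (h.mono hac (by nlinarith) hdb).1
    have hmp := measurePreserving_affine hp q
    have hpre : (fun t : ℝ => p * t + q) ⁻¹' (Set.Icc (p * c + q) (p * d + q)) = Set.Icc c d := by
      ext t; simp [hp]
    have hmp' := hmp.restrict_preimage (s := Set.Icc (p * c + q) (p * d + q)) measurableSet_Icc
    rw [hpre, Measure.restrict_smul] at hmp'
    have h3 := hmono.comp_measurePreserving hmp'
    have h4 := h3.smul_measure (c := (ENNReal.ofReal |p|)⁻¹) (by simp [hp.ne'])
    rwa [smul_smul, ENNReal.inv_mul_cancel (by simp [hp.ne']) (by simp), one_smul] at h4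
  · intro t ht
    simp only [hd]
    have hm : MemH1 (p * c + q) (p * d + q) u := h.mono hac (by nlinarith) hdb
    rw [hm.2 (p * t + q) ⟨by nlinarith [ht.1], by nlinarith [ht.2]⟩]
    congr 1
    rw [intervalIntegral.integral_const_mul, intervalIntegral.integral_comp_mul_add _ hp.ne']
    rw [Complex.real_smul, ← mul_assoc, ← Complex.ofReal_mul, mul_inv_cancel₀ hp.ne']
    simp

end

section

/-! ### Winding numbers -/

/-- Angles add under multiplication, so a factor `s e^{i l}` with `s > 0` changes the winding number
by the number of turns of `l`. -/
theorem HasWindingNumber.mul {a b : ℝ} {γ γ' : ℝ → ℂ} {z z' : ℂ} {n k : ℤ} {s l : ℝ → ℝ}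
    (h : HasWindingNumber a b γ z n) (hs : ∀ t ∈ Set.Icc a b, 0 < s t)
    (hl : ContinuousOn l (Set.Icc a b))
    (hγ : ∀ t ∈ Set.Icc a b, γ' t - z' = (γ t - z) * (s t * Complex.exp (l t * Complex.I)))
    (hk : l b - l a = 2 * Real.pi * k) : HasWindingNumber a b γ' z' (n + k) := by
  obtain ⟨θ, h1, h2, h3⟩ := h
  refine ⟨fun t => θ t + l t, h1.add hl, fun t ht => ⟨?_, ?_⟩, by push_cast; linarith⟩
  · rw [← sub_ne_zero, hγ t ht]
    refine mul_ne_zero (sub_ne_zero.2 (h2 t ht).1) (mul_ne_zero ?_ (Complex.exp_ne_zero _))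
    exact_mod_cast (hs t ht).ne'
  · have e := (h2 t ht).2
    have hn : ‖(γ t - z) * (s t * Complex.exp (l t * Complex.I))‖ = ‖γ t - z‖ * s t := by
      rw [norm_mul, norm_mul, Complex.norm_exp_ofReal_mul_I, mul_one, Complex.norm_real,
        Real.norm_of_nonneg (hs t ht).le]
    rw [hγ t ht, hn]
    conv_lhs => rw [e]
    push_cast
    rw [add_mul, Complex.exp_add]
    ring

/-- The principal argument is continuous on the slit plane, so a factor that closes up there makes
no turn. -/
theorem HasWindingNumber.mul_slitPlane {a b : ℝ} {γ γ' : ℝ → ℂ} {z z' : ℂ} {n : ℤ} {ρ : ℝ → ℂ}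
    (h : HasWindingNumber a b γ z n) (hρ : ContinuousOn ρ (Set.Icc a b))
    (hs : ∀ t ∈ Set.Icc a b, ρ t ∈ Complex.slitPlane)
    (hγ : ∀ t ∈ Set.Icc a b, γ' t - z' = (γ t - z) * ρ t) (hab : ρ a = ρ b) :
    HasWindingNumber a b γ' z' n := by
  have := h.mul (γ' := γ') (z' := z') (k := 0) (s := fun t => ‖ρ t‖) (l := fun t => (ρ t).arg)
    (fun t ht => norm_pos_iff.2 (Complex.slitPlane_ne_zero (hs t ht)))
    (fun t ht => (Complex.continuousAt_arg (hs t ht)).comp_continuousWithinAt (hρ t ht))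
    (fun t ht => by rw [hγ t ht, Complex.norm_mul_exp_arg_mul_I]) (by simp [hab])
  simpa using this

/-- Two angle functions differ by a continuous function with values in `2πℤ`, which is constant on
an interval. -/
theorem HasWindingNumber.unique {a b : ℝ} (hab : a ≤ b) {γ : ℝ → ℂ} {z : ℂ} {n m : ℤ}
    (h : HasWindingNumber a b γ z n) (h' : HasWindingNumber a b γ z m) : n = m := by
  obtain ⟨θ, h1, h2, h3⟩ := h
  obtain ⟨θ', h1', h2', h3'⟩ := h'
  have key : ∀ t ∈ Set.Icc a b, ∃ k : ℤ, θ t - θ' t = k * (2 * Real.pi) := by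
    intro t ht
    have e := (h2 t ht).2
    have e' := (h2' t ht).2
    rw [e] at e'
    have hne : (‖γ t - z‖ : ℂ) ≠ 0 := by
      exact_mod_cast norm_ne_zero_iff.2 (sub_ne_zero.2 (h2 t ht).1)
    have hn : ‖(‖γ t - z‖ : ℂ) * Complex.exp (θ t * Complex.I)‖ = ‖γ t - z‖ := by
      rw [norm_mul, Complex.norm_exp_ofReal_mul_I, mul_one, Complex.norm_real, norm_norm]
    rw [hn] at e'
    have := mul_left_cancel₀ hne e'
    obtain ⟨k, hk⟩ := Complex.exp_eq_exp_iff_exists_int.1 this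
    refine ⟨k, ?_⟩
    have h4 : (θ t : ℂ) * Complex.I = (θ' t + k * (2 * Real.pi)) * Complex.I := by
      rw [hk]; ring
    have h5 := mul_right_cancel₀ Complex.I_ne_zero h4
    have h6 : θ t = θ' t + k * (2 * Real.pi) := by exact_mod_cast h5
    linarith
  have hd : ContinuousOn (fun t => (θ t - θ' t) / (2 * Real.pi)) (Set.Icc a b) :=
    (h1.sub h1').div_const _
  have hpi := Real.pi_pos
  have hconst := isPreconnected_Icc.constant_of_mapsTo (T := Set.range ((↑) : ℤ → ℝ))
    Int.isClosedEmbedding_coe_real.isEmbedding.isDiscrete_range hd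
    (fun t ht => by
      obtain ⟨k, hk⟩ := key t ht
      exact ⟨k, by beta_reduce; rw [hk]; field_simp⟩) (Set.left_mem_Icc.2 hab) (Set.right_mem_Icc.2 hab)
  have h7 : θ a - θ' a = θ b - θ' b := by
    beta_reduce at hconst
    field_simp at hconst
    exact hconst
  have : (n : ℝ) = m := by
    have : 2 * Real.pi * (n : ℝ) = 2 * Real.pi * m := by linarith
    exact mul_left_cancel₀ (by positivity) this
  exact_mod_cast this

/-- The angle is the imaginary part of a lift of `γ - z` through the covering map `exp`. -/
theorem exists_hasWindingNumber {a b : ℝ} (hab : a < b) {γ : ℝ → ℂ} {z : ℂ}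
    (hγ : ContinuousOn γ (Set.Icc a b)) (hz : ∀ t ∈ Set.Icc a b, γ t ≠ z) (hc : γ a = γ b) :
    ∃ n : ℤ, HasWindingNumber a b γ z n := by
  let g : C(unitInterval, {w : ℂ // w ≠ 0}) :=
    ⟨fun s => ⟨γ (a + (b - a) * s) - z, sub_ne_zero.2 (hz _
      ⟨by nlinarith [s.2.1], by nlinarith [s.2.2]⟩)⟩, by
      refine Continuous.subtype_mk (Continuous.sub ?_ continuous_const) _
      refine hγ.comp_continuous (by fun_prop) fun s => ⟨by nlinarith [s.2.1], by nlinarith [s.2.2]⟩⟩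
  have h0 : γ a - z ≠ 0 := sub_ne_zero.2 (hz a ⟨le_rfl, hab.le⟩)
  have hg0 : g 0 = ⟨Complex.exp (Complex.log (γ a - z)), Complex.exp_ne_zero _⟩ := by
    apply Subtype.ext
    simp [g, Complex.exp_log h0]
  let L := Complex.isCoveringMap_exp.liftPath g (Complex.log (γ a - z)) hg0
  have hL : ∀ s : unitInterval, Complex.exp (L s) = γ (a + (b - a) * s) - z := by
    intro s
    have := congrFun (Complex.isCoveringMap_exp.liftPath_lifts g (Complex.log (γ a - z)) hg0) s
    exact congrArg Subtype.val this
  have hba : (b - a) ≠ 0 := by linarith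
  let σ : ℝ → unitInterval := fun t => Set.projIcc 0 1 zero_le_one ((t - a) / (b - a))
  have hσ : Continuous σ := continuous_projIcc.comp (by fun_prop)
  have hσt : ∀ t ∈ Set.Icc a b, a + (b - a) * (σ t : ℝ) = t := by
    intro t ht
    have : (t - a) / (b - a) ∈ Set.Icc (0 : ℝ) 1 :=
      ⟨div_nonneg (by linarith [ht.1]) (by linarith),
        (div_le_one (by linarith)).2 (by linarith [ht.2])⟩
    simp only [σ, Set.projIcc_of_mem zero_le_one this]
    field_simp; ring
  have hLt : ∀ t ∈ Set.Icc a b, Complex.exp (L (σ t)) = γ t - z := fun t ht => by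
    rw [hL, hσt t ht]
  have hee : Complex.exp (L (σ b)) = Complex.exp (L (σ a)) := by
    rw [hLt a ⟨le_rfl, hab.le⟩, hLt b ⟨hab.le, le_rfl⟩, hc]
  obtain ⟨n, hn⟩ := Complex.exp_eq_exp_iff_exists_int.1 hee
  refine ⟨n, fun t => (L (σ t)).im, ?_, fun t ht => ⟨hz t ht, ?_⟩, ?_⟩
  · exact (Complex.continuous_im.comp (L.continuous.comp hσ)).continuousOn
  · rw [← hLt t ht, Complex.norm_exp, Complex.ofReal_exp, ← Complex.exp_add, Complex.re_add_im]
  · have := congrArg Complex.im hn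
    simp at this
    linarith

/-! ### Closing up -/

theorem closingAngle_nonneg (p₁ p₂ : ℂ) : 0 ≤ closingAngle p₁ p₂ :=
  (toIcoMod_mem_Ico Real.two_pi_pos 0 _).1

theorem closedUp_of_le {b t : ℝ} (u : ℝ → ℂ) (h : t ≤ b) : closedUp b u t = u t := by
  simp [closedUp, h]

theorem closedUp_of_ge {b t : ℝ} (u : ℝ → ℂ) (h : b ≤ t) : closedUp b u t =
    ‖u b‖ * Complex.exp ((t - b + Complex.arg (u b) : ℝ) * Complex.I) := by
  rcases h.eq_or_lt with rfl | h
  · simp [closedUp]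
  · simp [closedUp, not_le.2 h]

theorem norm_closedUp_of_ge {b t : ℝ} (u : ℝ → ℂ) (h : b ≤ t) : ‖closedUp b u t‖ = ‖u b‖ := by
  rw [closedUp_of_ge u h, norm_mul, Complex.norm_exp_ofReal_mul_I]; simp

theorem continuousOn_closedUp {a b c : ℝ} {u : ℝ → ℂ} (hab : a ≤ b)
    (hu : ContinuousOn u (Set.Icc a b)) : ContinuousOn (closedUp b u) (Set.Icc a c) := by
  have h1 : ContinuousOn (fun t => u (min t b)) (Set.Icc a c) :=
    hu.comp (by fun_prop) fun t ht => ⟨le_min ht.1 hab, min_le_right _ _⟩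
  have h2 : ContinuousOn (fun t => u (min t b) + ((‖u b‖ * Complex.exp
      ((max t b - b + Complex.arg (u b) : ℝ) * Complex.I)) - u b)) (Set.Icc a c) := by
    refine h1.add (Continuous.continuousOn ?_)
    fun_prop
  refine h2.congr fun t _ => ?_
  beta_reduce
  rcases le_total t b with h | h
  · rw [closedUp_of_le u h, min_eq_left h, max_eq_right h]
    simp
  · rw [closedUp_of_ge u h, min_eq_right h, max_eq_left h]
    simp

theorem closedUp_closes {b : ℝ} {u : ℝ → ℂ} {p₁ : ℂ} (h : ‖p₁‖ = ‖u b‖) :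
    closedUp b u (b + closingAngle p₁ (u b)) = p₁ := by
  rw [closedUp_of_ge u (by linarith [closingAngle_nonneg p₁ (u b)])]
  obtain ⟨k, hk⟩ : ∃ k : ℤ, closingAngle p₁ (u b) =
      Complex.arg p₁ - Complex.arg (u b) - k * (2 * Real.pi) :=
    ⟨toIcoDiv Real.two_pi_pos 0 (Complex.arg p₁ - Complex.arg (u b)), by
      rw [closingAngle, ← self_sub_toIcoDiv_zsmul, zsmul_eq_mul]⟩
  rw [hk, ← h]
  have : (((b + (Complex.arg p₁ - Complex.arg (u b) - k * (2 * Real.pi)) - b +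
      Complex.arg (u b) : ℝ) : ℂ) * Complex.I) =
      Complex.arg p₁ * Complex.I - k * (2 * Real.pi * Complex.I) := by
    push_cast; ring
  rw [this, Complex.exp_sub, Complex.exp_int_mul_two_pi_mul_I, div_one,
    Complex.norm_mul_exp_arg_mul_I]

/-- The dog-on-a-leash principle: the quotient of the two closed curves, seen from `z`, stays in the
unit disc around `1`. On the closing arc the curves coincide. -/
theorem hasWindingNumber_closedUp_of_near {a b d : ℝ} {u v : ℝ → ℂ} {z : ℂ} {n : ℤ} (hab : a ≤ b)
    (hu : ContinuousOn u (Set.Icc a b)) (hv : ContinuousOn v (Set.Icc a b))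
    (hb : v b = u b) (hclose : closedUp b u (b + d) = u a) (hclose' : closedUp b v (b + d) = v a)
    (huv : ∀ t ∈ Set.Icc a b, ‖v t - u t‖ < ‖u t - z‖)
    (h : HasWindingNumber a (b + d) (closedUp b u) z n) :
    HasWindingNumber a (b + d) (closedUp b v) z n := by
  obtain ⟨θ, h1, h2, h3⟩ := id h
  have hne : ∀ t ∈ Set.Icc a (b + d), closedUp b u t - z ≠ 0 :=
    fun t ht => sub_ne_zero.2 (h2 t ht).1
  refine h.mul_slitPlane (ρ := fun t => (closedUp b v t - z) / (closedUp b u t - z)) ?_ ?_ ?_ ?_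
  · exact ((continuousOn_closedUp hab hv).sub continuousOn_const).div
      ((continuousOn_closedUp hab hu).sub continuousOn_const) hne
  · intro t ht
    have h4 := hne t ht
    have : (closedUp b v t - z) / (closedUp b u t - z) =
        1 + (closedUp b v t - closedUp b u t) / (closedUp b u t - z) := by
      field_simp; ring
    rw [this]
    refine Complex.mem_slitPlane_of_norm_lt_one ?_
    rw [norm_div, div_lt_one (norm_pos_iff.2 h4)]
    rcases le_total t b with htb | htb
    · rw [closedUp_of_le u htb, closedUp_of_le v htb]
      exact huv t ⟨ht.1, htb⟩
    · rw [show closedUp b v t = closedUp b u t by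
        rw [closedUp_of_ge u htb, closedUp_of_ge v htb, hb], sub_self, norm_zero]
      exact norm_pos_iff.2 h4
  · intro t ht
    have h4 := hne t ht
    field_simp
  · simp only [hclose, hclose', closedUp_of_le u hab, closedUp_of_le v hab]

/-- The ratio of the two difference vectors stays in the unit disc around `1`. This makes all
winding numbers of a distant path equal. -/
theorem HasWindingNumber.change_centre {a b : ℝ} {γ : ℝ → ℂ} {z z' : ℂ} {n : ℤ}
    (hγ : ContinuousOn γ (Set.Icc a b)) (hc : γ a = γ b)
    (hz : ∀ t ∈ Set.Icc a b, ‖z - z'‖ < ‖γ t - z‖)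
    (h : HasWindingNumber a b γ z n) : HasWindingNumber a b γ z' n := by
  have hne : ∀ t ∈ Set.Icc a b, γ t - z ≠ 0 := fun t ht =>
    norm_pos_iff.1 ((norm_nonneg _).trans_lt (hz t ht))
  refine h.mul_slitPlane (ρ := fun t => 1 + (z - z') / (γ t - z)) ?_ ?_ ?_ ?_
  · exact continuousOn_const.add (continuousOn_const.div (hγ.sub continuousOn_const) hne)
  · intro t ht
    refine Complex.mem_slitPlane_of_norm_lt_one ?_
    rw [norm_div, div_lt_one (norm_pos_iff.2 (hne t ht))]
    exact hz t ht
  · intro t ht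
    have := hne t ht
    field_simp; ring
  · simp only [hc]

theorem HasWindingNumber.closedUp_comp {a b a' b' d : ℝ} {u : ℝ → ℂ} {z : ℂ} {n : ℤ} {φ : ℝ → ℝ}
    (hab' : a' ≤ b') (hd : 0 ≤ d) (hφ : ContinuousOn φ (Set.Icc a' b'))
    (hmaps : Set.MapsTo φ (Set.Icc a' b') (Set.Icc a b)) (ha : φ a' = a) (hb : φ b' = b)
    (h : HasWindingNumber a (b + d) (closedUp b u) z n) :
    HasWindingNumber a' (b' + d) (closedUp b' (fun t => u (φ t))) z n := by
  obtain ⟨θ, h1, h2, h3⟩ := h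
  -- The change of time is continued with unit speed over the closing arc.
  let ψ : ℝ → ℝ := fun t => φ (min t b') + max (t - b') 0
  have hψ : ContinuousOn ψ (Set.Icc a' (b' + d)) := by
    refine (hφ.comp (by fun_prop) fun t ht => ⟨le_min ht.1 hab', min_le_right _ _⟩).add ?_
    exact Continuous.continuousOn (by fun_prop)
  have hψ1 : ∀ t, t ≤ b' → ψ t = φ t := fun t ht => by
    simp [ψ, ht]
  have hψ2 : ∀ t, b' ≤ t → ψ t = b + (t - b') := fun t ht => by
    simp [ψ, ht, hb]
  have hψm : Set.MapsTo ψ (Set.Icc a' (b' + d)) (Set.Icc a (b + d)) := by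
    intro t ht
    have hab : a ≤ b := (hmaps (Set.left_mem_Icc.2 hab')).1.trans
      (hmaps (Set.left_mem_Icc.2 hab')).2
    rcases le_total t b' with h | h
    · rw [hψ1 t h]
      have := hmaps ⟨ht.1, h⟩
      exact ⟨this.1, this.2.trans (by linarith)⟩
    · rw [hψ2 t h]
      exact ⟨by linarith, by linarith [ht.2]⟩
  have hval : ∀ t ∈ Set.Icc a' (b' + d), closedUp b' (fun t => u (φ t)) t = closedUp b u (ψ t) := by
    intro t ht
    rcases le_total t b' with h | h
    · rw [hψ1 t h, closedUp_of_le _ h, closedUp_of_le _ (hmaps ⟨ht.1, h⟩).2]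
    · rw [hψ2 t h, closedUp_of_ge _ h, closedUp_of_ge _ (by linarith)]
      simp only [hb]
      congr 5
      ring
  refine ⟨fun t => θ (ψ t), h1.comp hψ hψm, fun t ht => ?_, ?_⟩
  · rw [hval t ht]; exact h2 _ (hψm ht)
  · beta_reduce
    rw [hψ2 (b' + d) (by linarith), hψ1 a' hab', ha]
    simpa using h3

end

section

/-! ### The `L²` pairing and Hölder continuity -/

section L2

variable {a b : ℝ}

theorem setIntegral_Icc_eq {E : Type*} [NormedAddCommGroup E] [NormedSpace ℝ E] (hab : a ≤ b)
    (f : ℝ → E) : ∫ t in Set.Icc a b, f t = ∫ t in a..b, f t := by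
  rw [intervalIntegral.integral_of_le hab, integral_Icc_eq_integral_Ioc]

theorem inner_toLp {f g : ℝ → ℂ} (hab : a ≤ b) (hf : MemLp f 2 (volume.restrict (Set.Icc a b)))
    (hg : MemLp g 2 (volume.restrict (Set.Icc a b))) :
    inner ℝ (hf.toLp f) (hg.toLp g) = ∫ t in a..b, inner ℝ (f t) (g t) := by
  rw [L2.inner_def, ← setIntegral_Icc_eq hab]
  refine integral_congr_ae ?_
  filter_upwards [hf.coeFn_toLp, hg.coeFn_toLp] with t h1 h2
  rw [h1, h2]

theorem norm_toLp_sq {f : ℝ → ℂ} (hab : a ≤ b) (hf : MemLp f 2 (volume.restrict (Set.Icc a b))) :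
    ‖hf.toLp f‖ ^ 2 = ∫ t in a..b, ‖f t‖ ^ 2 := by
  rw [← real_inner_self_eq_norm_sq, inner_toLp hab]
  simp_rw [real_inner_self_eq_norm_sq]

theorem _root_.MeasureTheory.MemLp.intervalIntegrable_inner {f g : ℝ → ℂ} (hab : a ≤ b)
    (hf : MemLp f 2 (volume.restrict (Set.Icc a b)))
    (hg : MemLp g 2 (volume.restrict (Set.Icc a b))) :
    IntervalIntegrable (fun t => inner ℝ (f t) (g t)) volume a b := by
  rw [intervalIntegrable_iff_integrableOn_Icc_of_le hab]
  refine (L2.integrable_inner (𝕜 := ℝ) (hf.toLp f) (hg.toLp g)).congr ?_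
  filter_upwards [hf.coeFn_toLp, hg.coeFn_toLp] with t h1 h2
  rw [h1, h2]

theorem _root_.MeasureTheory.MemLp.intervalIntegrable_sq {f : ℝ → ℂ} (hab : a ≤ b)
    (hf : MemLp f 2 (volume.restrict (Set.Icc a b))) :
    IntervalIntegrable (fun t => ‖f t‖ ^ 2) volume a b := by
  simpa only [real_inner_self_eq_norm_sq] using hf.intervalIntegrable_inner hab hf

theorem abs_integral_inner_le {f g : ℝ → ℂ} (hab : a ≤ b)
    (hf : MemLp f 2 (volume.restrict (Set.Icc a b)))
    (hg : MemLp g 2 (volume.restrict (Set.Icc a b))) :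
    |∫ t in a..b, inner ℝ (f t) (g t)| ≤
      Real.sqrt (∫ t in a..b, ‖f t‖ ^ 2) * Real.sqrt (∫ t in a..b, ‖g t‖ ^ 2) := by
  rw [← inner_toLp hab hf hg, ← norm_toLp_sq hab hf, ← norm_toLp_sq hab hg,
    Real.sqrt_sq (norm_nonneg _), Real.sqrt_sq (norm_nonneg _)]
  exact abs_real_inner_le_norm _ _

theorem integral_norm_sq_nonneg {f : ℝ → ℂ} (hab : a ≤ b) : 0 ≤ ∫ t in a..b, ‖f t‖ ^ 2 :=
  intervalIntegral.integral_nonneg hab fun _ _ => by positivity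

theorem _root_.ContinuousOn.memLp_two {f : ℝ → ℂ} (hf : ContinuousOn f (Set.Icc a b)) :
    MemLp f 2 (volume.restrict (Set.Icc a b)) := by
  obtain ⟨C, hC⟩ := isCompact_Icc.exists_bound_of_continuousOn hf
  refine MemLp.of_bound (hf.aestronglyMeasurable measurableSet_Icc) C ?_
  exact (ae_restrict_iff' measurableSet_Icc).2 (Eventually.of_forall hC)

end L2

/-- Cauchy–Schwarz against the constant path with value the integral itself. This is the source of
the Hölder continuity of `H¹` paths. -/
theorem sq_norm_integral_le {f : ℝ → ℂ} {a b : ℝ} (hab : a ≤ b)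
    (hf : MemLp f 2 (volume.restrict (Set.Icc a b))) :
    ‖∫ t in a..b, f t‖ ^ 2 ≤ (b - a) * ∫ t in a..b, ‖f t‖ ^ 2 := by
  set D := ∫ t in a..b, f t
  have h1 : MemLp (fun _ : ℝ => D) 2 (volume.restrict (Set.Icc a b)) :=
    continuousOn_const.memLp_two
  have h2 := abs_integral_inner_le hab h1 hf
  have h3 : ∫ t in a..b, inner ℝ D (f t) = ‖D‖ ^ 2 := by
    rw [← real_inner_self_eq_norm_sq]
    exact (innerSL ℝ D).intervalIntegral_comp_comm (hf.intervalIntegrable_two hab)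
  have h4 : ∫ t in a..b, ‖D‖ ^ 2 = (b - a) * ‖D‖ ^ 2 := by simp
  rw [h3, h4, abs_of_nonneg (by positivity), ← Real.sqrt_mul (mul_nonneg (by linarith)
    (by positivity))] at h2
  have hI := integral_norm_sq_nonneg (f := f) hab
  rcases eq_or_ne (‖D‖ ^ 2) 0 with h0 | h0
  · rw [h0]; exact mul_nonneg (by linarith) hI
  · have : 0 < ‖D‖ ^ 2 := lt_of_le_of_ne (by positivity) h0.symm
    have h5 := (Real.le_sqrt' this).1 h2
    nlinarith

theorem MemH1.sq_norm_sub_le {a b : ℝ} {u : ℝ → ℂ} (h : MemH1 a b u) {s t : ℝ} (has : a ≤ s)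
    (hst : s ≤ t) (htb : t ≤ b) :
    ‖u t - u s‖ ^ 2 ≤ (t - s) * ∫ r in s..t, ‖deriv u r‖ ^ 2 := by
  rw [h.sub_eq_integral has hst htb]
  exact sq_norm_integral_le hst (h.mono has hst htb).1

theorem MemH1.integral_mono {a b : ℝ} {u : ℝ → ℂ} (h : MemH1 a b u) {s t : ℝ} (has : a ≤ s)
    (hst : s ≤ t) (htb : t ≤ b) :
    ∫ r in s..t, ‖deriv u r‖ ^ 2 ≤ ∫ r in a..b, ‖deriv u r‖ ^ 2 := by
  have hab : a ≤ b := has.trans (hst.trans htb)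
  refine intervalIntegral.integral_mono_interval has hst htb ?_ (h.1.intervalIntegrable_sq hab)
  exact Eventually.of_forall fun _ => by positivity

theorem MemH1.sq_norm_sub_le' {a b : ℝ} {u : ℝ → ℂ} (h : MemH1 a b u) {s t : ℝ}
    (hs : s ∈ Set.Icc a b) (ht : t ∈ Set.Icc a b) :
    ‖u t - u s‖ ^ 2 ≤ |t - s| * ∫ r in a..b, ‖deriv u r‖ ^ 2 := by
  wlog hst : s ≤ t generalizing s t
  · rw [norm_sub_rev, abs_sub_comm]; exact this ht hs (le_of_not_ge hst)
  rw [abs_of_nonneg (by linarith)]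
  refine (h.sq_norm_sub_le hs.1 hst ht.2).trans ?_
  exact mul_le_mul_of_nonneg_left (h.integral_mono hs.1 hst ht.2) (by linarith)

/-- Bounded energy makes the paths Hölder continuous with a common constant, so convergence on a
finite net is enough. -/
theorem tendstoUniformlyOn_of_bounded {a b C : ℝ} {w : ℕ → ℝ → ℂ} {u : ℝ → ℂ}
    (hw : ∀ n, MemH1 a b (w n)) (hu : MemH1 a b u)
    (hC : ∀ n, ∫ t in a..b, ‖deriv (w n) t‖ ^ 2 ≤ C)
    (hlim : ∀ t ∈ Set.Icc a b, Tendsto (fun n => w n t) atTop (𝓝 (u t))) :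
    TendstoUniformlyOn w u atTop (Set.Icc a b) := by
  rw [Metric.tendstoUniformlyOn_iff]
  intro ε hε
  obtain ⟨C', hC', hwC, huC⟩ : ∃ C' > 0, (∀ n, ∫ t in a..b, ‖deriv (w n) t‖ ^ 2 ≤ C') ∧
      ∫ t in a..b, ‖deriv u t‖ ^ 2 ≤ C' := by
    refine ⟨max (max C (∫ t in a..b, ‖deriv u t‖ ^ 2)) 1, by positivity,
      fun n => (hC n).trans ?_, ?_⟩ <;> simp
  set δ := (ε / 3) ^ 2 / (2 * C') with hδ
  have hδ0 : 0 < δ := by positivity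
  have small : ∀ v : ℝ → ℂ, MemH1 a b v → ∫ t in a..b, ‖deriv v t‖ ^ 2 ≤ C' →
      ∀ s ∈ Set.Icc a b, ∀ t ∈ Set.Icc a b, dist t s < δ → dist (v t) (v s) < ε / 3 := by
    intro v hv hvC s hs t ht hd
    rw [Real.dist_eq] at hd
    rw [dist_eq_norm]
    have h1 := hv.sq_norm_sub_le' hs ht
    have h2 : |t - s| * ∫ r in a..b, ‖deriv v r‖ ^ 2 ≤ δ * C' :=
      mul_le_mul hd.le hvC (integral_norm_sq_nonneg (hs.1.trans hs.2)) hδ0.le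
    have h3 : δ * C' < (ε / 3) ^ 2 := by
      rw [hδ]; field_simp; nlinarith [sq_nonneg ε, pow_pos hε 2]
    exact lt_of_pow_lt_pow_left₀ 2 (by positivity) (by linarith)
  obtain ⟨T, hTs, hTf, hT⟩ := isCompact_Icc.finite_cover_balls (s := Set.Icc a b) hδ0
  have hev : ∀ᶠ n in atTop, ∀ s ∈ T, dist (w n s) (u s) < ε / 3 := by
    rw [hTf.eventually_all]
    intro s hs
    exact (Metric.tendsto_nhds.1 (hlim s (hTs hs))) _ (by positivity)
  filter_upwards [hev] with n hn t ht
  obtain ⟨s, hs, hst⟩ := Set.mem_iUnion₂.1 (hT ht)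
  have h1 := small u hu huC s (hTs hs) t ht hst
  have h2 := small (w n) (hw n) (hwC n) s (hTs hs) t ht hst
  have h3 := hn s hs
  calc dist (u t) (w n t) ≤ dist (u t) (u s) + dist (u s) (w n s) + dist (w n s) (w n t) :=
        dist_triangle4 _ _ _ _
    _ < ε := by rw [dist_comm (u s), dist_comm (w n s) (w n t)]; linarith

theorem tendsto_of_tendsto_inner {a b : ℝ} {w : ℕ → ℝ → ℂ} {u : ℝ → ℂ}
    (hw : ∀ n, MemH1 a b (w n)) (hu : MemH1 a b u) (ha : ∀ n, w n a = u a)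
    (hlim : ∀ ψ : ℝ → ℂ, MemLp ψ 2 (volume.restrict (Set.Icc a b)) →
      Tendsto (fun n => ∫ t in a..b, inner ℝ (ψ t) (deriv (w n) t)) atTop
        (𝓝 (∫ t in a..b, inner ℝ (ψ t) (deriv u t)))) :
    ∀ t ∈ Set.Icc a b, Tendsto (fun n => w n t) atTop (𝓝 (u t)) := by
  intro t ht
  have hab : a ≤ b := ht.1.trans ht.2
  have key : ∀ e : ℂ, Tendsto (fun n => inner ℝ e (w n t)) atTop (𝓝 (inner ℝ e (u t))) := by
    intro e
    -- Testing derivatives with the indicator of `[a, t]` times `e` evaluates the increment of the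
    -- path over `[a, t]`.
    have hψ : MemLp ((Set.Icc a t).indicator (fun _ => e)) 2 (volume.restrict (Set.Icc a b)) :=
      (continuousOn_const.memLp_two).indicator measurableSet_Icc
    have hval : ∀ v : ℝ → ℂ, MemH1 a b v →
        ∫ s in a..b, inner ℝ ((Set.Icc a t).indicator (fun _ => e) s) (deriv v s) =
          inner ℝ e (v t) - inner ℝ e (v a) := by
      intro v hv
      rw [← inner_sub_right, hv.sub_eq_integral le_rfl ht.1 ht.2]
      have h1 : (fun s => inner ℝ ((Set.Icc a t).indicator (fun _ => e) s) (deriv v s)) =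
          (Set.Icc a t).indicator (fun s => inner ℝ e (deriv v s)) := by
        ext s
        by_cases hs : s ∈ Set.Icc a t <;> simp [hs]
      rw [h1, ← setIntegral_Icc_eq hab, setIntegral_indicator measurableSet_Icc,
        Set.inter_eq_self_of_subset_right (Set.Icc_subset_Icc le_rfl ht.2),
        setIntegral_Icc_eq ht.1]
      exact (innerSL ℝ e).intervalIntegral_comp_comm
        ((hv.mono le_rfl ht.1 ht.2).intervalIntegrable ht.1)
    have h2 := hlim _ hψ
    simp_rw [hval _ (hw _), hval u hu, ha] at h2
    simpa using h2.add_const (inner ℝ e (u a))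
  have h1 := key 1
  have h2 := key Complex.I
  have e1 : ∀ z : ℂ, inner ℝ (1 : ℂ) z = z.re := fun z => by simp [Complex.inner]
  have e2 : ∀ z : ℂ, inner ℝ Complex.I z = z.im := fun z => by simp [Complex.inner]
  simp only [e1, e2] at h1 h2
  have h3 := ((Complex.continuous_ofReal.tendsto _).comp h1).add
    (((Complex.continuous_ofReal.tendsto _).comp h2).mul_const Complex.I)
  simpa only [Function.comp_def, Complex.re_add_im] using h3

/-- Weakly convergent sequences are bounded, by the uniform boundedness principle in `L²`. -/
theorem exists_bound_of_tendsto_inner {a b : ℝ} (hab : a ≤ b) {w : ℕ → ℝ → ℂ} {u : ℝ → ℂ}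
    (hw : ∀ n, MemH1 a b (w n))
    (hlim : ∀ ψ : ℝ → ℂ, MemLp ψ 2 (volume.restrict (Set.Icc a b)) →
      Tendsto (fun n => ∫ t in a..b, inner ℝ (ψ t) (deriv (w n) t)) atTop
        (𝓝 (∫ t in a..b, inner ℝ (ψ t) (deriv u t)))) :
    ∃ C, ∀ n, ∫ t in a..b, ‖deriv (w n) t‖ ^ 2 ≤ C := by
  obtain ⟨C, hC⟩ := banach_steinhaus (g := fun n => innerSL ℝ ((hw n).1.toLp)) (fun x => by
    have h1 := hlim x (Lp.memLp x)
    obtain ⟨C, hC⟩ := (Metric.isBounded_range_of_tendsto _ h1).exists_norm_le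
    refine ⟨C, fun n => ?_⟩
    have h2 := hC _ ⟨n, rfl⟩
    beta_reduce at h2
    rw [← inner_toLp hab (Lp.memLp x) (hw n).1, Lp.toLp_coeFn, real_inner_comm] at h2
    exact h2)
  refine ⟨C ^ 2, fun n => ?_⟩
  rw [← norm_toLp_sq hab (hw n).1]
  have := hC n
  rw [innerSL_apply_norm] at this
  exact pow_le_pow_left₀ (norm_nonneg _) this 2

theorem TendstoWeaklyH1.tendstoUniformlyOn {a b : ℝ} (hab : a ≤ b) {w : ℕ → ℝ → ℂ} {u : ℝ → ℂ}
    (hw : ∀ n, MemH1 a b (w n)) (hu : MemH1 a b u) (ha : ∀ n, w n a = u a)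
    (h : TendstoWeaklyH1 a b w u) : TendstoUniformlyOn w u atTop (Set.Icc a b) := by
  have hlim : ∀ ψ : ℝ → ℂ, MemLp ψ 2 (volume.restrict (Set.Icc a b)) →
      Tendsto (fun n => ∫ t in a..b, inner ℝ (ψ t) (deriv (w n) t)) atTop
        (𝓝 (∫ t in a..b, inner ℝ (ψ t) (deriv u t))) := by
    intro ψ hψ
    simpa using h (fun _ => 0) ψ MemLp.zero' hψ
  obtain ⟨C, hC⟩ := exists_bound_of_tendsto_inner hab hw hlim
  exact tendstoUniformlyOn_of_bounded hw hu hC (tendsto_of_tendsto_inner hw hu ha hlim)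

/-! ### Weak compactness -/

/-- The sequential Banach–Alaoglu theorem, transported to `H` by Riesz representation; separability
makes the ball of the dual sequentially compact. -/
theorem exists_weakly_convergent_subseq {H : Type*} [NormedAddCommGroup H] [InnerProductSpace ℝ H]
    [CompleteSpace H] [TopologicalSpace.SeparableSpace H] {x : ℕ → H} {C : ℝ}
    (hx : ∀ n, ‖x n‖ ≤ C) : ∃ y : H, ∃ φ : ℕ → ℕ, StrictMono φ ∧
      ∀ z, Tendsto (fun n => inner ℝ (x (φ n)) z) atTop (𝓝 (inner ℝ y z)) := by
  have hc := WeakDual.isSeqCompact_closedBall ℝ H (0 : StrongDual ℝ H) C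
  obtain ⟨f, -, φ, hφ, hlim⟩ := hc (x := fun n => StrongDual.toWeakDual (innerSL ℝ (x n)))
    (fun n => by
      simp only [Set.mem_preimage, Metric.mem_closedBall, dist_zero_right]
      change ‖innerSL ℝ (x n)‖ ≤ C
      rw [innerSL_apply_norm]; exact hx n)
  refine ⟨(InnerProductSpace.toDual ℝ H).symm (WeakDual.toStrongDual f), φ, hφ, fun z => ?_⟩
  rw [InnerProductSpace.toDual_symm_apply]
  exact ((WeakDual.eval_continuous z).tendsto f).comp hlim

/-- Weak compactness is applied to the derivatives alone; the limit path is rebuilt by integration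
from the common starting point. -/
theorem exists_weakly_convergent_paths {a b C : ℝ} (hab : a ≤ b) {w : ℕ → ℝ → ℂ} {p : ℂ}
    (hw : ∀ n, MemH1 a b (w n)) (ha : ∀ n, w n a = p)
    (hC : ∀ n, ∫ t in a..b, ‖deriv (w n) t‖ ^ 2 ≤ C) :
    ∃ u : ℝ → ℂ, ∃ φ : ℕ → ℕ, StrictMono φ ∧ MemH1 a b u ∧ u a = p ∧
      (∀ ψ : ℝ → ℂ, MemLp ψ 2 (volume.restrict (Set.Icc a b)) →
        Tendsto (fun n => ∫ t in a..b, inner ℝ (ψ t) (deriv (w (φ n)) t)) atTop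
          (𝓝 (∫ t in a..b, inner ℝ (ψ t) (deriv u t)))) ∧
      TendstoUniformlyOn (fun n => w (φ n)) u atTop (Set.Icc a b) := by
  have : Fact ((2 : ENNReal) ≠ ⊤) := ⟨by simp⟩
  have : SecondCountableTopology (Lp ℂ 2 (volume.restrict (Set.Icc a b))) := inferInstance
  obtain ⟨y, φ, hφ, hy⟩ := exists_weakly_convergent_subseq (x := fun n => (hw n).1.toLp)
    (C := Real.sqrt C) (fun n => by
      refine Real.le_sqrt_of_sq_le ?_
      rw [norm_toLp_sq hab]; exact hC n)
  set u : ℝ → ℂ := fun t => p + ∫ s in a..t, y s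
  have hyL := Lp.memLp y
  have hua : u a = p := by simp [u]
  have hut : ∀ t ∈ Set.Icc a b, u t = u a + ∫ s in a..t, y s := fun t _ => by rw [hua]
  have hu : MemH1 a b u := memH1_of_integral hab hyL hut
  have hd := (hyL.congr_deriv
    (hasDerivAt_of_integral hab (hyL.intervalIntegrable_two hab) hut)).2
  have hlim : ∀ ψ : ℝ → ℂ, MemLp ψ 2 (volume.restrict (Set.Icc a b)) →
        Tendsto (fun n => ∫ t in a..b, inner ℝ (ψ t) (deriv (w (φ n)) t)) atTop
          (𝓝 (∫ t in a..b, inner ℝ (ψ t) (deriv u t))) := by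
    intro ψ hψ
    have h1 := hy hψ.toLp
    have h2 : inner ℝ y hψ.toLp = ∫ t in a..b, inner ℝ (ψ t) (deriv u t) := by
      rw [real_inner_comm]
      conv_lhs => rw [← Lp.toLp_coeFn y hyL]
      rw [inner_toLp hab]
      refine integral_congr_Icc hab ?_
      filter_upwards [hd] with t ht h
      rw [ht h]
    rw [h2] at h1
    refine h1.congr fun n => ?_
    rw [real_inner_comm, inner_toLp hab]
  refine ⟨u, φ, hφ, hu, hua, hlim, ?_⟩
  exact tendstoUniformlyOn_of_bounded (fun n => hw _) hu (fun n => hC _)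
    (tendsto_of_tendsto_inner (fun n => hw _) hu (fun n => by rw [ha, hua]) hlim)

end

section

/-! ### The topological description of the classes -/

/-- The `H¹` paths that meet every centre around which their winding number does not have the
parity prescribed by `l`. -/
def topClass {N : ℕ} (c : Fin N → ℂ) (p₁ p₂ : ℂ) (l : Fin N → ZMod 2) (a b : ℝ) :
    Set (ℝ → ℂ) :=
  {u | MemH1 a b u ∧ u a = p₁ ∧ u b = p₂ ∧ ∀ j, (∃ t ∈ Set.Icc a b, u t = c j) ∨
    ∃ n : ℤ, HasWindingNumber a (b + closingAngle p₁ p₂) (closedUp b u) (c j) n ∧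
      (n : ZMod 2) = l j}

variable {N : ℕ} {c : Fin N → ℂ} {p₁ p₂ : ℂ} {l : Fin N → ZMod 2} {a b : ℝ}

theorem freeClass_subset_topClass : freeClass c p₁ p₂ l a b ⊆ topClass c p₁ p₂ l a b := by
  rintro u ⟨h1, h2, h3, -, h5⟩
  refine ⟨h1, h2, h3, fun j => Or.inr ?_⟩
  have := h5 j
  rwa [h2, h3] at this

theorem closedUp_closes' {u : ℝ → ℂ} (hp : ‖p₁‖ = ‖p₂‖) (ha : u a = p₁) (hb : u b = p₂) :
    closedUp b u (b + closingAngle p₁ p₂) = u a := by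
  have := closedUp_closes (b := b) (u := u) (p₁ := p₁) (by rw [hp, hb])
  rw [hb] at this
  rw [this, ha]

/-- A limit that avoids a centre keeps a distance `δ` from it. A path closer than `δ / 2` to the
limit is then nearer to it than to the centre, and has the same winding number. -/
theorem mem_topClass_of_tendstoUniformlyOn (hab : a ≤ b) (hp : ‖p₁‖ = ‖p₂‖) {w : ℕ → ℝ → ℂ}
    {u : ℝ → ℂ} (hw : ∀ n, w n ∈ topClass c p₁ p₂ l a b) (hu : MemH1 a b u) (ha : u a = p₁)
    (hb : u b = p₂) (hlim : TendstoUniformlyOn w u atTop (Set.Icc a b)) :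
    u ∈ topClass c p₁ p₂ l a b := by
  refine ⟨hu, ha, hb, fun j => ?_⟩
  by_cases hj : ∃ t ∈ Set.Icc a b, u t = c j
  · exact Or.inl hj
  right
  push Not at hj
  obtain ⟨t₀, ht₀, hmin⟩ := isCompact_Icc.exists_isMinOn (Set.nonempty_Icc.2 hab)
    (((hu.continuousOn hab).sub continuousOn_const).norm (f := fun t => u t - c j))
  set δ := ‖u t₀ - c j‖
  have hδ : 0 < δ := norm_pos_iff.2 (sub_ne_zero.2 (hj t₀ ht₀))
  obtain ⟨n, hn⟩ := (Metric.tendstoUniformlyOn_iff.1 hlim (δ / 2) (by positivity)).exists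
  have key : ∀ t ∈ Set.Icc a b, ‖u t - w n t‖ < ‖w n t - c j‖ := by
    intro t ht
    have h1 := hn t ht
    have h2 : δ ≤ ‖u t - c j‖ := hmin ht
    rw [dist_eq_norm] at h1
    have h3 : ‖u t - c j‖ ≤ ‖u t - w n t‖ + ‖w n t - c j‖ := norm_sub_le_norm_sub_add_norm_sub _ _ _
    linarith
  obtain ⟨hwn, hwa, hwb, hwj⟩ := hw n
  rcases hwj j with ⟨t, ht, h⟩ | ⟨k, hk, hkl⟩
  · have := key t ht
    rw [h, sub_self, norm_zero] at this
    exact absurd this (not_lt.2 (norm_nonneg _))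
  · exact ⟨k, hasWindingNumber_closedUp_of_near hab (hwn.continuousOn hab) (hu.continuousOn hab)
      (by rw [hb, hwb]) (closedUp_closes' hp hwa hwb) (closedUp_closes' hp ha hb) key hk, hkl⟩

theorem weakClass_subset_topClass (hab : a ≤ b) (hp : ‖p₁‖ = ‖p₂‖) :
    weakClass c p₁ p₂ l a b ⊆ topClass c p₁ p₂ l a b := by
  rintro u ⟨hu, ha, hb, w, hw, hlim⟩
  refine mem_topClass_of_tendstoUniformlyOn hab hp (fun n => freeClass_subset_topClass (hw n))
    hu ha hb (hlim.tendstoUniformlyOn hab (fun n => (hw n).1) hu fun n => ?_)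
  rw [(hw n).2.1, ha]

/-- Monotonicity of the change of time is not needed: the endpoints are fixed, so collisions survive
by the intermediate value theorem and winding numbers by composing the angle function. -/
theorem comp_mem_topClass {a' b' : ℝ} {u : ℝ → ℂ} {φ : ℝ → ℝ} (hab' : a' ≤ b')
    (hu : u ∈ topClass c p₁ p₂ l a b) (hφ : ContinuousOn φ (Set.Icc a' b'))
    (hmaps : Set.MapsTo φ (Set.Icc a' b') (Set.Icc a b)) (ha : φ a' = a) (hb : φ b' = b)
    (hm : MemH1 a' b' (fun t => u (φ t))) :
    (fun t => u (φ t)) ∈ topClass c p₁ p₂ l a' b' := by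
  obtain ⟨-, h1, h2, h3⟩ := hu
  refine ⟨hm, by simp only [ha, h1], by simp only [hb, h2], fun j => ?_⟩
  rcases h3 j with ⟨t, ht, h⟩ | ⟨n, hn, hl⟩
  · left
    have := intermediate_value_Icc hab' hφ
    rw [ha, hb] at this
    obtain ⟨s, hs, rfl⟩ := this ht
    exact ⟨s, hs, h⟩
  · exact Or.inr ⟨n, hn.closedUp_comp hab' (closingAngle_nonneg _ _) hφ hmaps ha hb, hl⟩

/-- Outside radius `r > 3ε` the closed path is farther than `2ε` from each centre, and two centres
are at most `2ε` apart. All winding numbers would then agree, against the choice of `l`. -/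
theorem exists_norm_le_of_mem_topClass {R ε r : ℝ} {u : ℝ → ℂ} (hab : a ≤ b) (hp₁ : ‖p₁‖ = R)
    (hp₂ : ‖p₂‖ = R) (hl : IsWindingVector l) (hc : ∀ k, ‖c k‖ ≤ ε) (hr : 3 * ε < r) (hrR : r < R)
    (hu : u ∈ topClass c p₁ p₂ l a b) : ∃ t ∈ Set.Icc a b, ‖u t‖ ≤ r := by
  by_contra! hcon
  obtain ⟨hm, ha, hb, hw⟩ := hu
  obtain ⟨j, k, -, hjk⟩ := hl
  have hε : 0 ≤ ε := (norm_nonneg _).trans (hc j)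
  have hfree : ∀ i, ¬ ∃ t ∈ Set.Icc a b, u t = c i := by
    rintro i ⟨t, ht, h⟩
    have := hcon t ht
    rw [h] at this
    linarith [hc i]
  obtain ⟨n, hn, hnl⟩ := (hw j).resolve_left (hfree j)
  obtain ⟨m, hm', hml⟩ := (hw k).resolve_left (hfree k)
  have hγ := continuousOn_closedUp (c := b + closingAngle p₁ p₂) hab (hm.continuousOn hab)
  have hd := closingAngle_nonneg p₁ p₂
  have hn' := hn.change_centre (z' := c k) hγ (by
    rw [closedUp_closes' (by rw [hp₁, hp₂]) ha hb, closedUp_of_le _ hab]) (fun t ht => by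
    have h1 : r < ‖closedUp b u t‖ := by
      rcases le_total t b with h | h
      · rw [closedUp_of_le _ h]; exact hcon t ⟨ht.1, h⟩
      · rw [norm_closedUp_of_ge _ h, hb, hp₂]; exact hrR
    have h2 := norm_sub_norm_le (closedUp b u t) (c j)
    have h3 := norm_sub_le (c j) (c k)
    linarith [hc j, hc k])
  have := hn'.unique (by linarith) hm'
  rw [this] at hnl
  exact hjk (hnl.symm.trans hml)

/-! ### Avoiding a collision -/

theorem memH1_of_continuous_deriv {f f' : ℝ → ℂ} (hab : a ≤ b) (hf : ∀ t, HasDerivAt f (f' t) t)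
    (hf' : Continuous f') : MemH1 a b f := by
  refine memH1_of_integral hab hf'.continuousOn.memLp_two fun t _ => ?_
  rw [intervalIntegral.integral_eq_sub_of_hasDerivAt (fun s _ => hf s)
    (hf'.intervalIntegrable _ _)]
  ring

/-- The affine function with values `x` at `s` and `y` at `t`. -/
def affineInterp (s t x y : ℝ) : ℝ → ℝ := fun r => x + (y - x) / (t - s) * (r - s)

theorem hasDerivAt_affineInterp (s t x y r : ℝ) :
    HasDerivAt (affineInterp s t x y) ((y - x) / (t - s)) r := by
  have := (((hasDerivAt_id r).sub_const s).const_mul ((y - x) / (t - s))).const_add x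
  rwa [mul_one] at this

theorem continuous_affineInterp (s t x y : ℝ) : Continuous (affineInterp s t x y) := by
  unfold affineInterp; fun_prop

theorem affineInterp_left (s t x y : ℝ) : affineInterp s t x y s = x := by simp [affineInterp]

theorem affineInterp_right {s t : ℝ} (h : s < t) (x y : ℝ) : affineInterp s t x y t = y := by
  have : t - s ≠ 0 := by linarith
  simp only [affineInterp]; field_simp; ring

theorem affineInterp_pos {s t x y r : ℝ} (h : s < t) (hx : 0 < x) (hy : 0 < y)
    (hr : r ∈ Set.Icc s t) : 0 < affineInterp s t x y r := by
  have h1 : 0 < t - s := by linarith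
  have : affineInterp s t x y r = (x * (t - r) + y * (r - s)) / (t - s) := by
    simp only [affineInterp]; field_simp; ring
  rw [this]
  refine div_pos ?_ h1
  rcases hr.1.eq_or_lt with h | h
  · rw [← h]; nlinarith
  · nlinarith [mul_nonneg hx.le (sub_nonneg.2 hr.2), mul_pos hy (sub_pos.2 h)]

theorem affineInterp_le {s t x y r M : ℝ} (h : s < t) (hx : x ≤ M) (hy : y ≤ M)
    (hr : r ∈ Set.Icc s t) : affineInterp s t x y r ≤ M := by
  have h1 : 0 < t - s := by linarith
  have : affineInterp s t x y r = (x * (t - r) + y * (r - s)) / (t - s) := by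
    simp only [affineInterp]; field_simp; ring
  rw [this, div_le_iff₀ h1]
  nlinarith [mul_le_mul_of_nonneg_right hx (sub_nonneg.2 hr.2),
    mul_le_mul_of_nonneg_right hy (sub_nonneg.2 hr.1)]

/-- The path around `z` in polar coordinates that are affine functions of time. -/
def polarSegment (z : ℂ) (s t r₀ r₁ θ₀ θ₁ : ℝ) : ℝ → ℂ := fun x =>
  z + affineInterp s t r₀ r₁ x * Complex.exp (affineInterp s t θ₀ θ₁ x * Complex.I)

/-- The derivative of `polarSegment`. -/
def polarSegmentDeriv (s t r₀ r₁ θ₀ θ₁ : ℝ) : ℝ → ℂ := fun x =>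
  (((r₁ - r₀) / (t - s) : ℝ) + affineInterp s t r₀ r₁ x * ((θ₁ - θ₀) / (t - s) : ℝ) * Complex.I) *
    Complex.exp (affineInterp s t θ₀ θ₁ x * Complex.I)

theorem hasDerivAt_polarSegment (z : ℂ) (s t r₀ r₁ θ₀ θ₁ x : ℝ) :
    HasDerivAt (polarSegment z s t r₀ r₁ θ₀ θ₁) (polarSegmentDeriv s t r₀ r₁ θ₀ θ₁ x) x := by
  have h1 := (hasDerivAt_affineInterp s t r₀ r₁ x).ofReal_comp
  have h2 := ((hasDerivAt_affineInterp s t θ₀ θ₁ x).ofReal_comp.mul_const Complex.I).cexp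
  refine ((h1.mul h2).const_add z).congr_deriv ?_
  simp only [polarSegmentDeriv]
  ring

theorem continuous_polarSegmentDeriv (s t r₀ r₁ θ₀ θ₁ : ℝ) :
    Continuous (polarSegmentDeriv s t r₀ r₁ θ₀ θ₁) := by
  have h1 := continuous_affineInterp s t r₀ r₁
  have h2 := continuous_affineInterp s t θ₀ θ₁
  unfold polarSegmentDeriv
  fun_prop

theorem norm_sq_polarSegmentDeriv (s t r₀ r₁ θ₀ θ₁ x : ℝ) :
    ‖polarSegmentDeriv s t r₀ r₁ θ₀ θ₁ x‖ ^ 2 =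
      ((r₁ - r₀) ^ 2 + affineInterp s t r₀ r₁ x ^ 2 * (θ₁ - θ₀) ^ 2) / (t - s) ^ 2 := by
  rw [polarSegmentDeriv, norm_mul, Complex.norm_exp_ofReal_mul_I, mul_one, ← Complex.normSq_eq_norm_sq]
  rw [← Complex.ofReal_mul, Complex.normSq_add_mul_I,
    mul_pow, div_pow, div_pow]
  ring

theorem MemH1.deriv_eq_of_eqOn {u v : ℝ → ℂ} {s t : ℝ} (h : ∀ x ∈ Set.Ioo s t, v x = u x) {x : ℝ}
    (hx : x ∈ Set.Ioo s t) : deriv v x = deriv u x :=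
  Filter.EventuallyEq.deriv_eq (by
    filter_upwards [Ioo_mem_nhds hx.1 hx.2] with y hy using h y hy)

/-- The path `u` with its part over `[s, t]` replaced by `w`. -/
def splice (s t : ℝ) (u w : ℝ → ℂ) : ℝ → ℂ := fun x => if x ∈ Set.Icc s t then w x else u x

theorem splice_of_mem {s t x : ℝ} {u w : ℝ → ℂ} (h : x ∈ Set.Icc s t) : splice s t u w x = w x :=
  if_pos h

theorem splice_of_notMem {s t x : ℝ} {u w : ℝ → ℂ} (h : x ∉ Set.Ioo s t) (hs : w s = u s)
    (ht : w t = u t) : splice s t u w x = u x := by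
  by_cases hx : x ∈ Set.Icc s t
  · rw [splice_of_mem hx]
    rcases hx.1.eq_or_lt with h1 | h1
    · rw [← h1, hs]
    rcases hx.2.eq_or_lt with h2 | h2
    · rw [h2, ht]
    exact absurd ⟨h1, h2⟩ h
  · exact if_neg hx

theorem memH1_splice {s t : ℝ} {u w : ℝ → ℂ} (has : a ≤ s) (hst : s ≤ t) (htb : t ≤ b)
    (hu : MemH1 a b u) (hw : MemH1 s t w) (hs : w s = u s) (ht : w t = u t) :
    MemH1 a b (splice s t u w) := by
  have h1 : MemH1 a s (splice s t u w) := (hu.mono le_rfl has (hst.trans htb)).congr has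
    fun x hx => splice_of_notMem (fun h => by linarith [h.1, hx.2]) hs ht
  have h2 : MemH1 s t (splice s t u w) := hw.congr hst fun x hx => splice_of_mem hx
  have h3 : MemH1 t b (splice s t u w) := (hu.mono (has.trans hst) htb le_rfl).congr htb
    fun x hx => splice_of_notMem (fun h => by linarith [h.2, hx.1]) hs ht
  exact (h1.trans h2 has hst).trans h3 (has.trans hst) htb

theorem ae_ne (x : ℝ) : ∀ᵐ t : ℝ, t ≠ x := by simp [ae_iff, measure_singleton]

theorem deriv_splice {s t : ℝ} {u w : ℝ → ℂ} (hs : w s = u s) (ht : w t = u t) :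
    ∀ᵐ x, deriv (splice s t u w) x = if x ∈ Set.Icc s t then deriv w x else deriv u x := by
  filter_upwards [ae_ne s, ae_ne t] with x hxs hxt
  by_cases hx : x ∈ Set.Icc s t
  · rw [if_pos hx]
    exact MemH1.deriv_eq_of_eqOn (s := s) (t := t) (fun y hy => splice_of_mem ⟨hy.1.le, hy.2.le⟩)
      ⟨lt_of_le_of_ne hx.1 hxs.symm, lt_of_le_of_ne hx.2 hxt⟩
  · rw [if_neg hx]
    refine Filter.EventuallyEq.deriv_eq ?_
    filter_upwards [isClosed_Icc.isOpen_compl.mem_nhds hx] with y hy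
    exact splice_of_notMem (fun h => hy ⟨h.1.le, h.2.le⟩) hs ht

theorem integral_sq_sub_splice {s t : ℝ} {u w : ℝ → ℂ} (has : a ≤ s) (hst : s ≤ t) (htb : t ≤ b)
    (hs : w s = u s) (ht : w t = u t) :
    ∫ x in a..b, ‖deriv u x - deriv (splice s t u w) x‖ ^ 2 =
      ∫ x in s..t, ‖deriv u x - deriv w x‖ ^ 2 := by
  have hab : a ≤ b := has.trans (hst.trans htb)
  have h1 : ∫ x in a..b, ‖deriv u x - deriv (splice s t u w) x‖ ^ 2 =
      ∫ x in a..b, (Set.Icc s t).indicator (fun x => ‖deriv u x - deriv w x‖ ^ 2) x := by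
    refine integral_congr_Icc hab ?_
    filter_upwards [deriv_splice hs ht] with x hx _
    rw [hx]
    by_cases h : x ∈ Set.Icc s t <;> simp [h]
  rw [h1, ← setIntegral_Icc_eq hab, setIntegral_indicator measurableSet_Icc,
        Set.inter_eq_self_of_subset_right (Set.Icc_subset_Icc has htb),
        setIntegral_Icc_eq hst]

end

/-! ### Collision-free approximation of paths with finitely many collisions. -/

section

variable {N : ℕ} {c : Fin N → ℂ} {p₁ p₂ : ℂ} {l : Fin N → ZMod 2} {a b : ℝ}

theorem integral_norm_sub_sq_le {f g : ℝ → ℂ} (hab : a ≤ b)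
    (hf : MemLp f 2 (volume.restrict (Set.Icc a b)))
    (hg : MemLp g 2 (volume.restrict (Set.Icc a b))) :
    ∫ t in a..b, ‖f t - g t‖ ^ 2 ≤
      2 * (∫ t in a..b, ‖f t‖ ^ 2) + 2 * ∫ t in a..b, ‖g t‖ ^ 2 := by
  rw [← intervalIntegral.integral_const_mul, ← intervalIntegral.integral_const_mul,
    ← intervalIntegral.integral_add ((hf.intervalIntegrable_sq hab).const_mul 2)
      ((hg.intervalIntegrable_sq hab).const_mul 2)]
  refine intervalIntegral.integral_mono_on hab ((hf.sub hg).intervalIntegrable_sq hab)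
    (((hf.intervalIntegrable_sq hab).const_mul 2).add
      ((hg.intervalIntegrable_sq hab).const_mul 2)) fun t _ => ?_
  have h1 := norm_sub_le (f t) (g t)
  have h2 := pow_le_pow_left₀ (norm_nonneg _) h1 2
  nlinarith [sq_nonneg (‖f t‖ - ‖g t‖)]

theorem MemH1.tendsto_integral_symm {u : ℝ → ℂ} (hu : MemH1 a b u) {t₀ : ℝ}
    (ht₀ : t₀ ∈ Set.Ioo a b) :
    Tendsto (fun τ => ∫ r in (t₀ - τ)..(t₀ + τ), ‖deriv u r‖ ^ 2) (𝓝[>] 0) (𝓝 0) := by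
  have hab : a ≤ b := (ht₀.1.trans ht₀.2).le
  have hi := hu.1.intervalIntegrable_sq hab
  have hF : ContinuousOn (fun x => ∫ r in a..x, ‖deriv u r‖ ^ 2) (Set.Icc a b) := by
    have := intervalIntegral.continuousOn_primitive_interval' hi (a := a) Set.left_mem_uIcc
    rwa [Set.uIcc_of_le hab] at this
  have hF0 := hF.continuousAt (Icc_mem_nhds ht₀.1 ht₀.2)
  have h1 : Tendsto (fun τ : ℝ => t₀ + τ) (𝓝[>] 0) (𝓝 t₀) := by
    have : ContinuousAt (fun τ : ℝ => t₀ + τ) 0 := by fun_prop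
    simpa using this.tendsto.mono_left nhdsWithin_le_nhds
  have h2 : Tendsto (fun τ : ℝ => t₀ - τ) (𝓝[>] 0) (𝓝 t₀) := by
    have : ContinuousAt (fun τ : ℝ => t₀ - τ) 0 := by fun_prop
    simpa using this.tendsto.mono_left nhdsWithin_le_nhds
  have h3 := (hF0.tendsto.comp h1).sub (hF0.tendsto.comp h2)
  rw [sub_self] at h3
  refine h3.congr' ?_
  filter_upwards [h1 (Icc_mem_nhds ht₀.1 ht₀.2), h2 (Icc_mem_nhds ht₀.1 ht₀.2)] with τ h4 h5
  simp only [Function.comp_apply]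
  refine intervalIntegral.integral_interval_sub_left ?_ ?_
  all_goals refine hi.mono_set (Set.uIcc_subset_uIcc (by simp) ?_)
  all_goals rw [Set.uIcc_of_le hab]
  exacts [h4, h5]

/-- The short arc around the collision time is replaced by a path in polar coordinates around the
collision point, with affine radius and angle. The versions `m = 0` and `m = 1` differ by one full
turn. Their cost is comparable to the energy of `u` on the arc, because the squared radius is at
most the half-length of the arc times that energy. -/
theorem exists_detour {u : ℝ → ℂ} (hu : MemH1 a b u) {t₀ τ₀ : ℝ} (ht₀ : t₀ ∈ Set.Ioo a b)
    (hτ₀ : 0 < τ₀) (hne : ∀ t, t ≠ t₀ → |t - t₀| ≤ τ₀ → u t ≠ u t₀) {η d : ℝ} (hη : 0 < η)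
    (hd : 0 < d) :
    ∃ s t : ℝ, a < s ∧ s < t₀ ∧ t₀ < t ∧ t < b ∧ t₀ - τ₀ ≤ s ∧ t ≤ t₀ + τ₀ ∧
      (∀ x ∈ Set.Icc s t, ‖u x - u t₀‖ < d) ∧ ∃ w : ℕ → ℝ → ℂ,
        (∀ m ≤ 1, MemH1 a b (w m) ∧ (∀ x, x ∉ Set.Ioo s t → w m x = u x) ∧
          (∀ x ∈ Set.Icc s t, w m x ≠ u t₀ ∧ ‖w m x - u t₀‖ < d) ∧
          ∫ x in a..b, ‖deriv u x - deriv (w m) x‖ ^ 2 < η) ∧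
        ∀ x ∈ Set.Icc s t, w 1 x - u t₀ = (w 0 x - u t₀) *
          Complex.exp (affineInterp s t 0 (2 * Real.pi) x * Complex.I) := by
  have hE := hu.tendsto_integral_symm ht₀
  have hτE : Tendsto (fun τ => τ * ∫ r in (t₀ - τ)..(t₀ + τ), ‖deriv u r‖ ^ 2) (𝓝[>] 0) (𝓝 0) := by
    have : Tendsto (fun τ : ℝ => τ) (𝓝[>] 0) (𝓝 0) := tendsto_id.mono_left nhdsWithin_le_nhds
    simpa using this.mul hE
  -- With `E` the energy of `u` on the arc, `2E` bounds the contribution of `u`, and `(1 + 16π²)E`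
  -- that of the detour, whose angle changes by at most `4π`.
  have hEc := hE.const_mul (3 + 16 * Real.pi ^ 2)
  rw [mul_zero] at hEc
  have hlt : ∀ x : ℝ, 0 < x → ∀ᶠ τ in 𝓝[>] (0 : ℝ), τ < x := fun x hx =>
    mem_nhdsWithin_of_mem_nhds (Iio_mem_nhds hx)
  obtain ⟨τ, hτpos, hτ1, hτ2, hτ3, hτ4, hτ5⟩ :=
    ((eventually_mem_nhdsWithin (a := (0 : ℝ)) (s := Set.Ioi 0)).and ((hlt (t₀ - a) (by linarith [ht₀.1])).and
      ((hlt (b - t₀) (by linarith [ht₀.2])).and ((hlt τ₀ hτ₀).and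
      ((hτE.eventually (Iio_mem_nhds (show (0 : ℝ) < d ^ 2 by positivity))).and
        (hEc.eventually (Iio_mem_nhds hη))))))).exists
  rw [Set.mem_Ioi] at hτpos
  set s := t₀ - τ with hs
  set t := t₀ + τ with ht
  set E := ∫ r in s..t, ‖deriv u r‖ ^ 2 with hEdef
  have hst : s < t := by linarith
  have hE0 : 0 ≤ E := integral_norm_sq_nonneg hst.le
  have hus : MemH1 s t u := hu.mono (by linarith) hst.le (by linarith)
  set z := u t₀ with hz
  have hmem : t₀ ∈ Set.Icc s t := ⟨by linarith, by linarith⟩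
  have hr : ∀ x ∈ Set.Icc s t, ‖u x - z‖ ^ 2 ≤ τ * E := by
    intro x hx
    refine (hus.sq_norm_sub_le' hmem hx).trans (mul_le_mul_of_nonneg_right ?_ hE0)
    rw [abs_le]; constructor <;> linarith [hx.1, hx.2]
  set σ := Real.sqrt (τ * E) with hσ
  have hσ2 : σ ^ 2 = τ * E := Real.sq_sqrt (by positivity)
  have hσ0 : 0 ≤ σ := Real.sqrt_nonneg _
  have hσd : σ < d := lt_of_pow_lt_pow_left₀ 2 hd.le (by rw [hσ2]; exact hτ4)
  have hr' : ∀ x ∈ Set.Icc s t, ‖u x - z‖ ≤ σ := fun x hx => Real.le_sqrt_of_sq_le (hr x hx)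
  have hsI : s ∈ Set.Icc s t := ⟨le_rfl, hst.le⟩
  have htI : t ∈ Set.Icc s t := ⟨hst.le, le_rfl⟩
  set r₀ := ‖u s - z‖
  set r₁ := ‖u t - z‖
  have hr₀ : 0 < r₀ := norm_pos_iff.2 (sub_ne_zero.2 (hne s (by linarith) (by
    rw [abs_le]; constructor <;> linarith)))
  have hr₁ : 0 < r₁ := norm_pos_iff.2 (sub_ne_zero.2 (hne t (by linarith) (by
    rw [abs_le]; constructor <;> linarith)))
  set θ₀ := (u s - z).arg
  set θ₁ := (u t - z).arg
  let g : ℕ → ℝ → ℂ := fun m => polarSegment z s t r₀ r₁ θ₀ (θ₁ + 2 * Real.pi * m)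
  have hgs : ∀ m, g m s = u s := by
    intro m
    simp only [g, polarSegment, affineInterp_left]
    rw [Complex.norm_mul_exp_arg_mul_I]; ring
  have hgt : ∀ m, g m t = u t := by
    intro m
    simp only [g, polarSegment, affineInterp_right hst]
    have : ((θ₁ + 2 * Real.pi * m : ℝ) : ℂ) * Complex.I =
        θ₁ * Complex.I + (m : ℤ) * (2 * Real.pi * Complex.I) := by push_cast; ring
    rw [this, Complex.exp_add, Complex.exp_int_mul_two_pi_mul_I, mul_one,
      Complex.norm_mul_exp_arg_mul_I]
    ring
  have hgn : ∀ m, ∀ x ∈ Set.Icc s t, ‖g m x - z‖ = affineInterp s t r₀ r₁ x := by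
    intro m x hx
    simp only [g, polarSegment, add_sub_cancel_left]
    rw [norm_mul, Complex.norm_exp_ofReal_mul_I, mul_one, Complex.norm_real,
      Real.norm_of_nonneg (affineInterp_pos hst hr₀ hr₁ hx).le]
  have haff : ∀ x ∈ Set.Icc s t, affineInterp s t r₀ r₁ x ≤ σ := fun x hx =>
    affineInterp_le hst (hr' s hsI) (hr' t htI) hx
  have hgH : ∀ m, MemH1 s t (g m) := fun m =>
    memH1_of_continuous_deriv hst.le (hasDerivAt_polarSegment _ _ _ _ _ _ _)
      (continuous_polarSegmentDeriv _ _ _ _ _ _)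
  refine ⟨s, t, by linarith, by linarith, by linarith, by linarith, by linarith, by linarith,
    fun x hx => (hr' x hx).trans_lt hσd, fun m => splice s t u (g m), fun m hm => ⟨?_, ?_, ?_, ?_⟩,
    ?_⟩
  · exact memH1_splice (by linarith) hst.le (by linarith) hu (hgH m) (hgs m) (hgt m)
  · exact fun x hx => splice_of_notMem hx (hgs m) (hgt m)
  · intro x hx
    simp only [splice_of_mem hx]
    have h1 := hgn m x hx
    have h2 := affineInterp_pos hst hr₀ hr₁ hx
    refine ⟨fun h => ?_, by rw [h1]; exact (haff x hx).trans_lt hσd⟩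
    rw [h, sub_self, norm_zero] at h1
    linarith
  · rw [integral_sq_sub_splice (by linarith) hst.le (by linarith) (hgs m) (hgt m)]
    refine (integral_norm_sub_sq_le hst.le hus.1 (hgH m).1).trans_lt ?_
    have h1 : ∫ x in s..t, ‖deriv (g m) x‖ ^ 2 ≤
        ∫ x in s..t, (σ ^ 2 + σ ^ 2 * (4 * Real.pi) ^ 2) / (t - s) ^ 2 := by
      refine intervalIntegral.integral_mono_on hst.le ((hgH m).1.intervalIntegrable_sq hst.le)
        (by simp) fun x hx => ?_
      rw [(hasDerivAt_polarSegment z s t r₀ r₁ θ₀ (θ₁ + 2 * Real.pi * m) x).deriv,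
        norm_sq_polarSegmentDeriv]
      have h2 := affineInterp_pos hst hr₀ hr₁ hx
      have h3 : (r₁ - r₀) ^ 2 ≤ σ ^ 2 := by
        rw [sq_le_sq, abs_of_nonneg hσ0, abs_le]
        constructor <;> linarith [hr' s hsI, hr' t htI]
      have h4 : affineInterp s t r₀ r₁ x ^ 2 ≤ σ ^ 2 := pow_le_pow_left₀ h2.le (haff x hx) 2
      have h5 : (θ₁ + 2 * Real.pi * m - θ₀) ^ 2 ≤ (4 * Real.pi) ^ 2 := by
        have hpi := Real.pi_pos
        have e1 := Complex.arg_mem_Ioc (u s - z)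
        have e2 := Complex.arg_mem_Ioc (u t - z)
        have e3 : (m : ℝ) ≤ 1 := by exact_mod_cast hm
        have e4 : (0 : ℝ) ≤ m := by positivity
        rw [sq_le_sq, abs_of_nonneg (by positivity : (0 : ℝ) ≤ 4 * Real.pi), abs_le]
        constructor <;> nlinarith [e1.1, e1.2, e2.1, e2.2]
      gcongr
    have h2 : ∫ x in s..t, (σ ^ 2 + σ ^ 2 * (4 * Real.pi) ^ 2) / (t - s) ^ 2 =
        E * (1 + 16 * Real.pi ^ 2) / 2 := by
      rw [intervalIntegral.integral_const, hσ2, smul_eq_mul, show t - s = 2 * τ by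
        rw [hs, ht]; ring]
      field_simp
      ring
    rw [h2] at h1
    have : (3 + 16 * Real.pi ^ 2) * E < η := hτ5
    nlinarith
  · intro x hx
    simp only [splice_of_mem hx, g, polarSegment, add_sub_cancel_left, mul_assoc]
    rw [← Complex.exp_add]
    congr 2
    simp only [affineInterp]
    push_cast
    ring

theorem collisions_interior {R : ℝ} {u : ℝ → ℂ} (hp₁ : ‖p₁‖ = R) (hp₂ : ‖p₂‖ = R)
    (hc : ∀ k, ‖c k‖ < R) (ha : u a = p₁) (hb : u b = p₂) {t : ℝ} (ht : t ∈ Set.Icc a b)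
    (hk : ∃ k, u t = c k) : t ∈ Set.Ioo a b := by
  obtain ⟨k, hk⟩ := hk
  refine ⟨lt_of_le_of_ne ht.1 ?_, lt_of_le_of_ne ht.2 ?_⟩
  · rintro rfl
    have := hc k
    rw [← hk, ha, hp₁] at this
    exact lt_irrefl _ this
  · rintro rfl
    have := hc k
    rw [← hk, hb, hp₂] at this
    exact lt_irrefl _ this

/-- A small detour does not affect the winding numbers around the other centres. Around the centre
that is met at `t₀`, the two detours have winding numbers of different parity, so one of them fits,
unless the path meets this centre again and no parity is required. -/
theorem exists_remove_collision {R : ℝ} {u : ℝ → ℂ} (hinj : Function.Injective c)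
    (hp₁ : ‖p₁‖ = R) (hp₂ : ‖p₂‖ = R) (hc : ∀ k, ‖c k‖ < R) (hu : u ∈ topClass c p₁ p₂ l a b)
    (hfin : {t ∈ Set.Icc a b | ∃ k, u t = c k}.Finite) {t₀ : ℝ}
    (ht₀ : t₀ ∈ {t ∈ Set.Icc a b | ∃ k, u t = c k}) {η : ℝ} (hη : 0 < η) :
    ∃ w ∈ topClass c p₁ p₂ l a b, ∫ x in a..b, ‖deriv u x - deriv w x‖ ^ 2 < η ∧
      {t ∈ Set.Icc a b | ∃ k, w t = c k} ⊆ {t ∈ Set.Icc a b | ∃ k, u t = c k} \ {t₀} := by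
  obtain ⟨hm, ha, hb, hw⟩ := id hu
  have htI := collisions_interior hp₁ hp₂ hc ha hb ht₀.1 ht₀.2
  have hab : a < b := htI.1.trans htI.2
  obtain ⟨j, hj⟩ := ht₀.2
  -- an isolating time
  obtain ⟨τ₀, hτ₀, hiso⟩ : ∃ τ₀ > 0, ∀ t, t ≠ t₀ → |t - t₀| ≤ τ₀ →
      t ∈ Set.Icc a b ∧ ∀ k, u t ≠ c k := by
    have h1 : ({t ∈ Set.Icc a b | ∃ k, u t = c k} \ {t₀})ᶜ ∩ Set.Icc a b ∈ 𝓝 t₀ :=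
      Filter.inter_mem ((hfin.subset Set.sdiff_subset).isClosed.isOpen_compl.mem_nhds (by simp))
        (Icc_mem_nhds htI.1 htI.2)
    obtain ⟨r, hr, hball⟩ := Metric.nhds_basis_closedBall.mem_iff.1 h1
    refine ⟨r, hr, fun t ht htr => ?_⟩
    have h2 := hball (show t ∈ Metric.closedBall t₀ r by
      rwa [Metric.mem_closedBall, Real.dist_eq])
    refine ⟨h2.2, fun k hk => h2.1 ⟨⟨h2.2, k, hk⟩, ht⟩⟩
  -- the distance to the other centres
  obtain ⟨d, hd, hdist⟩ : ∃ d > 0, ∀ i, i ≠ j → 4 * d ≤ ‖c j - c i‖ := by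
    have : ∀ᶠ d in 𝓝[>] (0 : ℝ), ∀ i, i ≠ j → 4 * d ≤ ‖c j - c i‖ := by
      rw [eventually_all]
      intro i
      by_cases hij : i = j
      · simp [hij]
      · have hpos : 0 < ‖c j - c i‖ / 4 := by
          have := norm_pos_iff.2 (sub_ne_zero.2 fun h => hij (hinj h).symm)
          positivity
        filter_upwards [mem_nhdsWithin_of_mem_nhds (Iio_mem_nhds hpos)] with d hd _
        have : d < ‖c j - c i‖ / 4 := hd
        linarith
    obtain ⟨d, hd, h⟩ := ((eventually_mem_nhdsWithin (a := (0 : ℝ)) (s := Set.Ioi 0)).and this).exists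
    exact ⟨d, hd, h⟩
  obtain ⟨s, t, has, hst₀, ht₀t, htb, hsτ, htτ, hud, w, hwm, hw01⟩ :=
    exists_detour hm htI hτ₀ (fun t ht h => by rw [hj]; exact (hiso t ht h).2 j) hη hd
  rw [hj] at hud hw01
  have hwa : ∀ m ≤ 1, w m a = p₁ := fun m hm => by
    rw [(hwm m hm).2.1 a (fun h => by linarith [h.1]), ha]
  have hwb : ∀ m ≤ 1, w m b = p₂ := fun m hm => by
    rw [(hwm m hm).2.1 b (fun h => by linarith [h.2]), hb]
  have hpp : ‖p₁‖ = ‖p₂‖ := by rw [hp₁, hp₂]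
  have hd0 := closingAngle_nonneg p₁ p₂
  -- collisions of the new path
  have hcoll : ∀ m ≤ 1, ∀ x ∈ Set.Icc a b, ∀ k, w m x = c k → u x = c k ∧ x ≠ t₀ := by
    intro m hm x hx k hk
    by_cases hxI : x ∈ Set.Icc s t
    · exfalso
      obtain ⟨h1, h2⟩ := (hwm m hm).2.2.1 x hxI
      rw [hj, hk] at h1 h2
      have hkj : k ≠ j := fun h => h1 (by rw [h])
      have := hdist k hkj
      rw [norm_sub_rev] at this
      linarith
    · rw [(hwm m hm).2.1 x (fun h => hxI ⟨h.1.le, h.2.le⟩)] at hk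
      exact ⟨hk, fun h => hxI (by rw [h]; exact ⟨hst₀.le, ht₀t.le⟩)⟩
  have hother : ∀ m ≤ 1, ∀ i, i ≠ j → (∃ x ∈ Set.Icc a b, w m x = c i) ∨
      ∃ n : ℤ, HasWindingNumber a (b + closingAngle p₁ p₂) (closedUp b (w m)) (c i) n ∧
      (n : ZMod 2) = l i := by
    intro m hm' i hij
    rcases hw i with ⟨x, hx, hxi⟩ | ⟨n, hn, hnl⟩
    · left
      refine ⟨x, hx, ?_⟩
      rw [(hwm m hm').2.1 x, hxi]
      intro hxI
      by_cases hxt : x = t₀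
      · rw [hxt, hj] at hxi
        exact hij (hinj hxi).symm
      · exact (hiso x hxt (by rw [abs_le]; constructor <;> linarith [hxI.1, hxI.2])).2 i hxi
    · right
      refine ⟨n, hasWindingNumber_closedUp_of_near hab.le (hm.continuousOn hab.le)
        ((hwm m hm').1.continuousOn hab.le) (by rw [hwb m hm', hb]) (closedUp_closes' hpp ha hb)
        (closedUp_closes' hpp (hwa m hm') (hwb m hm')) ?_ hn, hnl⟩
      intro x hx
      by_cases hxI : x ∈ Set.Icc s t
      · have h1 := ((hwm m hm').2.2.1 x hxI).2
        have h2 := hud x hxI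
        rw [hj] at h1
        have h3 := hdist i hij
        have h4 : ‖w m x - u x‖ ≤ ‖w m x - c j‖ + ‖u x - c j‖ := by
          rw [norm_sub_rev (u x)]; exact norm_sub_le_norm_sub_add_norm_sub _ _ _
        have h5 : ‖c j - c i‖ ≤ ‖u x - c j‖ + ‖u x - c i‖ := by
          rw [norm_sub_rev (u x) (c j)]; exact norm_sub_le_norm_sub_add_norm_sub _ _ _
        linarith
      · rw [(hwm m hm').2.1 x (fun h => hxI ⟨h.1.le, h.2.le⟩), sub_self, norm_zero]
        refine norm_pos_iff.2 (sub_ne_zero.2 ?_)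
        obtain ⟨θ, -, hθ, -⟩ := hn
        have := (hθ x ⟨hx.1, by linarith [hx.2]⟩).1
        rwa [closedUp_of_le _ hx.2] at this
  -- the winding number around `c j`
  suffices hmain : ∃ m ≤ 1, (∃ x ∈ Set.Icc a b, w m x = c j) ∨
      ∃ n : ℤ, HasWindingNumber a (b + closingAngle p₁ p₂) (closedUp b (w m)) (c j) n ∧
      (n : ZMod 2) = l j by
    obtain ⟨m, hm', hmj⟩ := hmain
    refine ⟨w m, ⟨(hwm m hm').1, hwa m hm', hwb m hm', fun i => ?_⟩, (hwm m hm').2.2.2, ?_⟩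
    · by_cases hij : i = j
      · rw [hij]; exact hmj
      · exact hother m hm' i hij
    · rintro x ⟨hx, k, hk⟩
      obtain ⟨h1, h2⟩ := hcoll m hm' x hx k hk
      exact ⟨⟨hx, k, h1⟩, h2⟩
  -- Both detours meet `c j` at the same other times, so if this happens either of them may be used.
  by_cases h0 : ∃ x ∈ Set.Icc a b, w 0 x = c j
  · exact ⟨0, by norm_num, Or.inl h0⟩
  push Not at h0
  obtain ⟨n, hn⟩ := exists_hasWindingNumber (z := c j) (b := b + closingAngle p₁ p₂)
    (γ := closedUp b (w 0)) (a := a) (by linarith)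
    (continuousOn_closedUp hab.le ((hwm 0 (by norm_num)).1.continuousOn hab.le))
    (fun x hx => by
      rcases le_total x b with h | h
      · rw [closedUp_of_le _ h]; exact h0 x ⟨hx.1, h⟩
      · intro h'
        have := norm_closedUp_of_ge (w 0) h
        rw [h', hwb 0 (by norm_num), hp₂] at this
        exact (hc j).ne this)
    (by rw [closedUp_closes' hpp (hwa 0 (by norm_num)) (hwb 0 (by norm_num)),
      closedUp_of_le _ hab.le])
  by_cases hnl : (n : ZMod 2) = l j
  · exact ⟨0, by norm_num, Or.inr ⟨n, hn, hnl⟩⟩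
  refine ⟨1, le_rfl, Or.inr ⟨n + 1, ?_, ?_⟩⟩
  · have hst : s < t := hst₀.trans ht₀t
    refine hn.mul (s := fun _ => 1)
      (l := fun x => affineInterp s t 0 (2 * Real.pi) (max s (min x t))) (fun _ _ => one_pos)
      ((continuous_affineInterp _ _ _ _).comp (by fun_prop)).continuousOn (fun x hx => ?_) ?_
    · rw [Complex.ofReal_one, one_mul]
      rcases le_total x b with hxb | hxb
      · rw [closedUp_of_le _ hxb, closedUp_of_le _ hxb]
        by_cases hxI : x ∈ Set.Icc s t
        · rw [hw01 x hxI, min_eq_left hxI.2, max_eq_right hxI.1]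
        · rw [(hwm 0 (by norm_num)).2.1 x (fun h => hxI ⟨h.1.le, h.2.le⟩),
            (hwm 1 (by norm_num)).2.1 x (fun h => hxI ⟨h.1.le, h.2.le⟩)]
          rcases lt_or_ge x s with h | h
          · rw [min_eq_left (by linarith), max_eq_left h.le, affineInterp_left]
            simp
          · have : t < x := lt_of_not_ge fun h' => hxI ⟨h, h'⟩
            rw [min_eq_right this.le, max_eq_right hst.le, affineInterp_right hst]
            push_cast
            rw [Complex.exp_two_pi_mul_I, mul_one]
      · rw [closedUp_of_ge _ hxb, closedUp_of_ge _ hxb, hwb 0 (by norm_num), hwb 1 le_rfl,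
          min_eq_right (by linarith), max_eq_right hst.le, affineInterp_right hst]
        push_cast
        rw [Complex.exp_two_pi_mul_I, mul_one]
    · rw [min_eq_right (by linarith), max_eq_right hst.le, affineInterp_right hst,
        min_eq_left (by linarith), max_eq_left has.le, affineInterp_left]
      simp
  -- In `ZMod 2`, two elements that differ, differ by `1`.
  · generalize l j = y at hnl
    push_cast
    generalize (n : ZMod 2) = x at hnl
    revert x y
    decide

/-- Strong induction on the number of collisions, which drops with every detour. -/
theorem exists_free_near {R : ℝ} (hab : a < b) (hinj : Function.Injective c) (hp₁ : ‖p₁‖ = R)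
    (hp₂ : ‖p₂‖ = R) (hc : ∀ k, ‖c k‖ < R) (n : ℕ) :
    ∀ u ∈ topClass c p₁ p₂ l a b, {t ∈ Set.Icc a b | ∃ k, u t = c k}.Finite →
      {t ∈ Set.Icc a b | ∃ k, u t = c k}.ncard = n → ∀ η > 0,
      ∃ w ∈ freeClass c p₁ p₂ l a b, ∫ x in a..b, ‖deriv u x - deriv w x‖ ^ 2 < η := by
  induction n using Nat.strong_induction_on with
  | _ n ih =>
    intro u hu hfin hn η hη
    rcases Set.eq_empty_or_nonempty {t ∈ Set.Icc a b | ∃ k, u t = c k} with h0 | ⟨t₀, ht₀⟩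
    · have hfree : ∀ t ∈ Set.Icc a b, ∀ j, u t ≠ c j := fun t ht j hj => by
        have : t ∈ {t ∈ Set.Icc a b | ∃ k, u t = c k} := ⟨ht, j, hj⟩
        rw [h0] at this
        exact this
      obtain ⟨h1, h2, h3, h4⟩ := hu
      refine ⟨u, ⟨h1, h2, h3, hfree, fun j => ?_⟩, by simpa using hη⟩
      rw [h2, h3]
      exact (h4 j).resolve_left fun ⟨t, ht, h⟩ => hfree t ht j h
    · obtain ⟨v, hv, hvη, hvs⟩ := exists_remove_collision hinj hp₁ hp₂ hc hu hfin ht₀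
        -- Two errors below `η / 4` add up to less than `η`, since the squared distance satisfies
        -- the triangle inequality only up to a factor `2`.
        (show 0 < η / 4 by positivity)
      obtain ⟨w, hw, hwη⟩ := ih _ (by
        rw [← hn]
        refine Set.ncard_lt_ncard ?_ hfin
        exact (Set.ssubset_of_subset_of_ssubset hvs (Set.sdiff_singleton_ssubset.2 ht₀)))
        v hv (hfin.subset (hvs.trans Set.sdiff_subset)) rfl (η / 4) (by positivity)
      refine ⟨w, hw, ?_⟩
      have h1 : MemLp (fun x => deriv u x - deriv v x) 2 (volume.restrict (Set.Icc a b)) :=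
        hu.1.1.sub hv.1.1
      have h2 : MemLp (fun x => deriv w x - deriv v x) 2 (volume.restrict (Set.Icc a b)) :=
        hw.1.1.sub hv.1.1
      have h3 := integral_norm_sub_sq_le hab.le h1 h2
      simp only [sub_sub_sub_cancel_right] at h3
      have h4 : ∫ x in a..b, ‖deriv w x - deriv v x‖ ^ 2 =
          ∫ x in a..b, ‖deriv v x - deriv w x‖ ^ 2 := by simp_rw [norm_sub_rev]
      rw [h4] at h3
      linarith

theorem tendsto_integral_inner_of_tendsto {f : ℕ → ℝ → ℂ} {g ψ : ℝ → ℂ} (hab : a ≤ b)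
    (hψ : MemLp ψ 2 (volume.restrict (Set.Icc a b)))
    (hf : ∀ n, MemLp (f n) 2 (volume.restrict (Set.Icc a b)))
    (hg : MemLp g 2 (volume.restrict (Set.Icc a b)))
    (h : Tendsto (fun n => ∫ t in a..b, ‖g t - f n t‖ ^ 2) atTop (𝓝 0)) :
    Tendsto (fun n => ∫ t in a..b, inner ℝ (ψ t) (f n t)) atTop
      (𝓝 (∫ t in a..b, inner ℝ (ψ t) (g t))) := by
  rw [tendsto_iff_dist_tendsto_zero]
  have h1 := (h.sqrt).const_mul (Real.sqrt (∫ t in a..b, ‖ψ t‖ ^ 2))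
  rw [Real.sqrt_zero, mul_zero] at h1
  refine squeeze_zero (fun _ => dist_nonneg) (fun n => ?_) h1
  rw [dist_comm, Real.dist_eq, ← intervalIntegral.integral_sub (hψ.intervalIntegrable_inner hab hg)
    (hψ.intervalIntegrable_inner hab (hf n))]
  simp_rw [← inner_sub_right]
  exact abs_integral_inner_le hab hψ (hg.sub (hf n))

/-- The converse of `weakClass_subset_topClass` for finitely many collisions. The approximating
paths share their starting point, so `L²` convergence of the derivatives already gives strong, hence
weak, convergence in `H¹`. -/
theorem mem_weakClass_of_finite_collisions {R : ℝ} (hab : a < b) (hinj : Function.Injective c)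
    (hp₁ : ‖p₁‖ = R) (hp₂ : ‖p₂‖ = R) (hc : ∀ k, ‖c k‖ < R) {u : ℝ → ℂ}
    (hu : u ∈ topClass c p₁ p₂ l a b) (hfin : {t ∈ Set.Icc a b | ∃ k, u t = c k}.Finite) :
    u ∈ weakClass c p₁ p₂ l a b := by
  have hex := fun n : ℕ => exists_free_near hab hinj hp₁ hp₂ hc _ u hu hfin rfl
    (1 / ((n : ℝ) + 1)) (by positivity)
  choose w hw hwη using hex
  have hlim : Tendsto (fun n => ∫ x in a..b, ‖deriv u x - deriv (w n) x‖ ^ 2) atTop (𝓝 0) :=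
    squeeze_zero (fun n => integral_norm_sq_nonneg hab.le) (fun n => (hwη n).le)
      tendsto_one_div_add_atTop_nhds_zero_nat
  refine ⟨hu.1, hu.2.1, hu.2.2.1, w, hw, fun φ ψ hφ hψ => ?_⟩
  refine Tendsto.add (tendsto_integral_inner_of_tendsto hab.le hφ
    (fun n => ((hw n).1.continuousOn hab.le).memLp_two) (hu.1.continuousOn hab.le).memLp_two ?_)
    (tendsto_integral_inner_of_tendsto hab.le hψ (fun n => (hw n).1.1) hu.1.1 hlim)
  have h1 := (hlim.const_mul (b - a)).const_mul (b - a)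
  rw [mul_zero, mul_zero] at h1
  refine squeeze_zero (fun n => integral_norm_sq_nonneg hab.le) (fun n => ?_) h1
  have hpt : ∀ t ∈ Set.Icc a b, ‖u t - w n t‖ ^ 2 ≤
      (b - a) * ∫ x in a..b, ‖deriv u x - deriv (w n) x‖ ^ 2 := by
    intro t ht
    have hut := hu.1.mono le_rfl ht.1 ht.2
    have hwt := (hw n).1.mono le_rfl ht.1 ht.2
    have h2 : u t - w n t = ∫ x in a..t, (deriv u x - deriv (w n) x) := by
      rw [intervalIntegral.integral_sub (hut.intervalIntegrable ht.1)
        (hwt.intervalIntegrable ht.1), hu.1.2 t ht, (hw n).1.2 t ht, hu.2.1, (hw n).2.1]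
      ring
    rw [h2]
    refine (sq_norm_integral_le ht.1 (hut.1.sub hwt.1)).trans ?_
    refine mul_le_mul (by linarith [ht.2]) ?_ (integral_norm_sq_nonneg ht.1) (by linarith)
    exact intervalIntegral.integral_mono_interval le_rfl ht.1 ht.2
      (Eventually.of_forall fun _ => by positivity)
      ((hu.1.1.sub (hw n).1.1).intervalIntegrable_sq hab.le)
  calc ∫ t in a..b, ‖u t - w n t‖ ^ 2
      ≤ ∫ t in a..b, (b - a) * ∫ x in a..b, ‖deriv u x - deriv (w n) x‖ ^ 2 := by
        refine intervalIntegral.integral_mono_on hab.le ?_ (by simp) hpt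
        exact (((hu.1.continuousOn hab.le).sub
          ((hw n).1.continuousOn hab.le)).memLp_two).intervalIntegrable_sq hab.le
    _ = _ := by rw [intervalIntegral.integral_const, smul_eq_mul]

end

section

/-! ### The potential -/

/-- The gradient of the effective potential. -/
def potentialGradient {N : ℕ} (α : ℝ) (m : Fin N → ℝ) (c : Fin N → ℂ) (ν : ℝ) (y : ℂ) : ℂ :=
  (ν ^ 2 : ℝ) • y - ∑ k, (m k / ‖y - c k‖ ^ (α + 2)) • (y - c k)

variable {N : ℕ} {α : ℝ} {m : Fin N → ℝ} {c : Fin N → ℂ} {ν : ℝ}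

/-- The potential is a power of the smooth function `‖y - z‖²`, with exponent `-α / 2`. -/
theorem hasGradientAt_kepler {μ : ℝ} (hα : α ≠ 0) {z y : ℂ} (hy : y ≠ z) :
    HasGradientAt (fun y => μ / (α * ‖y - z‖ ^ α)) (-((μ / ‖y - z‖ ^ (α + 2)) • (y - z))) y := by
  rw [hasGradientAt_iff_hasFDerivAt]
  have hpos : 0 < ‖y - z‖ := norm_pos_iff.2 (sub_ne_zero.2 hy)
  have h1 : HasFDerivAt (fun y : ℂ => ‖y - z‖ ^ 2) (2 • (innerSL ℝ (y - z))) y := by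
    have := (hasStrictFDerivAt_norm_sq (y - z)).hasFDerivAt.comp y ((hasFDerivAt_id y).sub_const z)
    simpa [Function.comp_def] using! this
  have h2 : HasDerivAt (fun x : ℝ => μ / α * x ^ (-α / 2))
      (μ / α * (-α / 2 * (‖y - z‖ ^ 2) ^ (-α / 2 - 1))) (‖y - z‖ ^ 2) :=
    (Real.hasDerivAt_rpow_const (Or.inl (by positivity))).const_mul _
  have h3 := h2.comp_hasFDerivAt y h1
  refine (h3.congr_fderiv ?_).congr_of_eventuallyEq ?_
  · ext w
    simp only [smul_apply, innerSL_apply_apply, map_neg,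
      neg_apply, InnerProductSpace.toDual_apply_apply, real_inner_smul_left,
      smul_eq_mul, nsmul_eq_mul, Nat.cast_ofNat]
    rw [← Real.rpow_natCast_mul hpos.le, show ((2 : ℕ) : ℝ) * (-α / 2 - 1) = -(α + 2) by
      push_cast; ring, Real.rpow_neg hpos.le]
    field_simp
  · filter_upwards with x
    simp only [Function.comp_apply]
    rw [← Real.rpow_natCast_mul (norm_nonneg _), show ((2 : ℕ) : ℝ) * (-α / 2) = -α by
      push_cast; ring, Real.rpow_neg (norm_nonneg _)]
    field_simp

theorem hasGradientAt_effectivePotential (hα : α ≠ 0) {y : ℂ} (hy : ∀ k, y ≠ c k) :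
    HasGradientAt (effectivePotential α m c ν) (potentialGradient α m c ν y) y := by
  have h1 : HasGradientAt (fun y : ℂ => ν ^ 2 / 2 * ‖y‖ ^ 2) ((ν ^ 2 : ℝ) • y) y := by
    rw [hasGradientAt_iff_hasFDerivAt]
    refine ((hasStrictFDerivAt_norm_sq y).hasFDerivAt.const_mul (ν ^ 2 / 2)).congr_fderiv ?_
    ext w
    simp only [smul_apply, innerSL_apply_apply, InnerProductSpace.toDual_apply_apply,
      real_inner_smul_left, smul_eq_mul, nsmul_eq_mul, Nat.cast_ofNat]
    ring
  have h2 : HasGradientAt (fun y : ℂ => ∑ k, m k / (α * ‖y - c k‖ ^ α))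
      (∑ k, -((m k / ‖y - c k‖ ^ (α + 2)) • (y - c k))) y := by
    rw [hasGradientAt_iff_hasFDerivAt, map_sum]
    exact HasFDerivAt.fun_sum fun k _ =>
      (hasGradientAt_iff_hasFDerivAt.1 (hasGradientAt_kepler hα (hy k)))
  have h3 := (hasGradientAt_iff_hasFDerivAt.1 h1).add (hasGradientAt_iff_hasFDerivAt.1 h2)
  rw [hasGradientAt_iff_hasFDerivAt]
  refine h3.congr_fderiv ?_
  rw [← map_add, potentialGradient, Finset.sum_neg_distrib, sub_eq_add_neg]

theorem continuousAt_potentialGradient {y : ℂ} (hy : ∀ k, y ≠ c k) :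
    ContinuousAt (potentialGradient α m c ν) y := by
  unfold potentialGradient
  refine ContinuousAt.sub (by fun_prop) (tendsto_finsetSum _ fun k _ => ?_)
  have hpos : 0 < ‖y - c k‖ := norm_pos_iff.2 (sub_ne_zero.2 (hy k))
  refine ContinuousAt.smul (f := fun y => m k / ‖y - c k‖ ^ (α + 2)) (g := fun y => y - c k)
    (continuousAt_const.div ?_ (Real.rpow_pos_of_pos hpos _).ne') (by fun_prop)
  exact ContinuousAt.rpow_const (by fun_prop) (Or.inl hpos.ne')

theorem continuousAt_effectivePotential (hα : α ≠ 0) {y : ℂ} (hy : ∀ k, y ≠ c k) :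
    ContinuousAt (effectivePotential α m c ν) y :=
  (hasGradientAt_effectivePotential hα hy).continuousAt

/-- Continuity as a map to `[0, ∞]`, including the value `∞` at the centres, is what Fatou's lemma
needs. Near a centre its own term alone forces the divergence. -/
theorem continuous_extendedPotential (hα : 0 < α) (hm : ∀ k, 0 < m k) (h : ℝ) :
    Continuous (extendedPotential α m c h ν) := by
  have hclosed : IsClosed (Set.range c) := (Set.finite_range c).isClosed
  rw [continuous_iff_continuousAt]
  intro y
  by_cases hy : ∃ k, y = c k
  · obtain ⟨k, rfl⟩ := hy
    have htop : extendedPotential α m c h ν (c k) = ⊤ := if_pos ⟨k, rfl⟩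
    rw [ContinuousAt, htop, ENNReal.tendsto_nhds_top_iff_nnreal]
    intro x
    have hlim : Tendsto (fun y => m k / α * (‖y - c k‖ ^ α)⁻¹ + h) (𝓝[≠] (c k)) atTop := by
      refine tendsto_atTop_add_const_right _ _ (Tendsto.const_mul_atTop (div_pos (hm k) hα) ?_)
      refine tendsto_inv_nhdsGT_zero.comp (tendsto_nhdsWithin_iff.2 ⟨?_, ?_⟩)
      · have : ContinuousAt (fun y => ‖y - c k‖ ^ α) (c k) :=
          ContinuousAt.rpow_const (by fun_prop) (Or.inr hα.le)
        have h2 := this.tendsto.mono_left (nhdsWithin_le_nhds (s := {c k}ᶜ))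
        simpa [Real.zero_rpow hα.ne'] using h2
      · filter_upwards [self_mem_nhdsWithin] with y hy
        exact Real.rpow_pos_of_pos (norm_pos_iff.2 (sub_ne_zero.2 hy)) _
    have hev := hlim.eventually_gt_atTop (x : ℝ)
    rw [eventually_nhdsWithin_iff] at hev
    filter_upwards [hev] with y hy
    unfold extendedPotential
    split_ifs with hk
    · exact ENNReal.coe_lt_top
    · push Not at hk
      refine lt_of_lt_of_le ?_ (ENNReal.ofReal_le_ofReal (p := m k / α * (‖y - c k‖ ^ α)⁻¹ + h) ?_)
      · rw [← ENNReal.ofReal_coe_nnreal]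
        exact (ENNReal.ofReal_lt_ofReal_iff_of_nonneg x.2).2 (hy (hk k))
      · unfold effectivePotential
        have h1 : m k / α * (‖y - c k‖ ^ α)⁻¹ ≤ ∑ k, m k / (α * ‖y - c k‖ ^ α) := by
          have := Finset.single_le_sum (f := fun k => m k / (α * ‖y - c k‖ ^ α))
            (fun j _ => div_nonneg (hm j).le (by positivity)) (Finset.mem_univ k)
          refine le_trans (le_of_eq ?_) this
          field_simp
        have h2 : 0 ≤ ν ^ 2 / 2 * ‖y‖ ^ 2 := by positivity
        linarith
  · push Not at hy
    have h1 : ContinuousAt (fun y => ENNReal.ofReal (effectivePotential α m c ν y + h)) y :=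
      ENNReal.continuous_ofReal.continuousAt.comp
        ((continuousAt_effectivePotential hα.ne' hy).add continuousAt_const)
    refine h1.congr ?_
    have : (Set.range c)ᶜ ∈ 𝓝 y := hclosed.isOpen_compl.mem_nhds (by
      rintro ⟨k, hk⟩; exact hy k hk.symm)
    filter_upwards [this] with x hx
    refine (if_neg ?_).symm
    rintro ⟨k, hk⟩
    exact hx ⟨k, hk.symm⟩

theorem extendedPotential_of_ne {h : ℝ} {y : ℂ} (hy : ∀ k, y ≠ c k) :
    extendedPotential α m c h ν y = ENNReal.ofReal (effectivePotential α m c ν y + h) :=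
  if_neg (by push Not; exact hy)

theorem circularRadius_rpow (hα : 0 < α) (hα₂ : α < 2) (hm : ∀ k, 0 < m k) :
    circularRadius α m ^ α = (2 - α) * (∑ k, m k) / (2 * α) := by
  have h0 : 0 ≤ ∑ k, m k := Finset.sum_nonneg fun k _ => (hm k).le
  rw [circularRadius, ← Real.rpow_mul (div_nonneg (mul_nonneg (by linarith) h0) (by linarith)),
    one_div_mul_cancel hα.ne', Real.rpow_one]

theorem circularRadius_pos [NeZero N] (hα : 0 < α) (hα₂ : α < 2) (hm : ∀ k, 0 < m k) :
    0 < circularRadius α m := by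
  have h0 : 0 < ∑ k, m k := Finset.sum_pos (fun k _ => hm k) Finset.univ_nonempty
  exact Real.rpow_pos_of_pos (div_pos (mul_pos (by linarith) h0) (by linarith)) _

/-- By the choice of `R`, the Kepler potential at radius `R` is `2 / (2 - α)`, at least `2` for `α ≥
1`. Displacing the centres by at most `R / 8` costs at most a factor `81 / 64`, which leaves more
than `3 / 2`. -/
theorem half_le_effectivePotential [NeZero N] (hα : 1 ≤ α) (hα₂ : α < 2) (hm : ∀ k, 0 < m k)
    (hc : ∀ k, ‖c k‖ ≤ circularRadius α m / 8) {y : ℂ} (hy : ‖y‖ ≤ circularRadius α m)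
    (hyc : ∀ k, y ≠ c k) : 1 / 2 ≤ effectivePotential α m c ν y + (-1) := by
  set R := circularRadius α m with hR
  have hα0 : 0 < α := by linarith
  have hR0 : 0 < R := circularRadius_pos hα0 hα₂ hm
  have hM : 0 < ∑ k, m k := Finset.sum_pos (fun k _ => hm k) Finset.univ_nonempty
  have hRα : R ^ α = (2 - α) * (∑ k, m k) / (2 * α) := circularRadius_rpow hα0 hα₂ hm
  have h1 : (9 / 8 * R) ^ α ≤ 81 / 64 * R ^ α := by
    rw [Real.mul_rpow (by norm_num) hR0.le]
    refine mul_le_mul_of_nonneg_right ?_ (by positivity)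
    calc (9 / 8 : ℝ) ^ α ≤ (9 / 8 : ℝ) ^ (2 : ℝ) :=
          Real.rpow_le_rpow_of_exponent_le (by norm_num) hα₂.le
      _ = 81 / 64 := by norm_num
  have h2 : ∀ k, m k / (α * (81 / 64 * R ^ α)) ≤ m k / (α * ‖y - c k‖ ^ α) := by
    intro k
    have hpos : 0 < ‖y - c k‖ := norm_pos_iff.2 (sub_ne_zero.2 (hyc k))
    have h3 : ‖y - c k‖ ≤ 9 / 8 * R := by
      have := norm_sub_le y (c k)
      linarith [hc k]
    refine div_le_div_of_nonneg_left (hm k).le (by positivity) ?_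
    refine mul_le_mul_of_nonneg_left ?_ hα0.le
    exact (Real.rpow_le_rpow hpos.le h3 hα0.le).trans h1
  have h3 : 3 / 2 ≤ ∑ k, m k / (α * ‖y - c k‖ ^ α) := by
    refine le_trans ?_ (Finset.sum_le_sum fun k _ => h2 k)
    rw [← Finset.sum_div, hRα]
    have : 0 < 2 - α := by linarith
    rw [le_div_iff₀ (by positivity)]
    field_simp
    nlinarith
  have h4 : 0 ≤ ν ^ 2 / 2 * ‖y‖ ^ 2 := by positivity
  unfold effectivePotential
  linarith

theorem half_le_extendedPotential [NeZero N] (hα : 1 ≤ α) (hα₂ : α < 2) (hm : ∀ k, 0 < m k)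
    (hc : ∀ k, ‖c k‖ ≤ circularRadius α m / 8) {y : ℂ} (hy : ‖y‖ ≤ circularRadius α m) :
    ENNReal.ofReal (1 / 2) ≤ extendedPotential α m c (-1) ν y := by
  unfold extendedPotential
  split_ifs with h
  · exact le_top
  · push Not at h
    exact ENNReal.ofReal_le_ofReal (half_le_effectivePotential hα hα₂ hm hc hy h)

/-! ### Virial estimates -/

theorem rpow_add_two {r : ℝ} (hr : 0 < r) : r ^ (α + 2) = r ^ α * r ^ 2 := by
  rw [Real.rpow_add hr]; norm_num

theorem norm_velocity_le {M ρ R : ℝ} (hα : 0 < α) (hm : ∀ k, 0 < m k) (hM : ∑ k, m k = M)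
    (hρ : 0 < ρ) {y v : ℂ} (hyc : ∀ k, ρ ≤ ‖y - c k‖) (hy : ‖y‖ ≤ R) (hν : |ν| ≤ 1)
    (hv : ‖v‖ ^ 2 = 2 * (effectivePotential α m c ν y + (-1))) :
    ‖v‖ ≤ Real.sqrt (R ^ 2 + 2 * (M / (α * ρ ^ α))) := by
  refine Real.le_sqrt_of_sq_le ?_
  rw [hv]
  have h1 : ∑ k, m k / (α * ‖y - c k‖ ^ α) ≤ M / (α * ρ ^ α) := by
    rw [← hM, Finset.sum_div]
    refine Finset.sum_le_sum fun k _ => ?_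
    have := Real.rpow_le_rpow hρ.le (hyc k) hα.le
    have := hm k
    gcongr
  have h2 : ν ^ 2 ≤ 1 := by rw [← sq_abs]; nlinarith [abs_nonneg ν]
  have h3 : ν ^ 2 / 2 * ‖y‖ ^ 2 ≤ 1 / 2 * R ^ 2 := by
    have := pow_le_pow_left₀ (norm_nonneg y) hy 2
    gcongr
  unfold effectivePotential
  linarith

/-- The force of a centre points to `z` and not to the origin. Writing `y = (y - z) + z`, the
discrepancy is at most `ε` times the size of the force. -/
theorem virial_term_ge {μ r ε : ℝ} (hα : 0 < α) (hμ : 0 < μ) {y z : ℂ} (hr : 0 < r)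
    (hz : ‖z‖ ≤ ε) (hyz : r ≤ ‖y - z‖) :
    (2 - α) / α * (μ / ‖y - z‖ ^ α) - ε * (μ / r ^ (α + 1)) ≤
      2 * (μ / (α * ‖y - z‖ ^ α)) - inner ℝ ((μ / ‖y - z‖ ^ (α + 2)) • (y - z)) y := by
  have hpos : 0 < ‖y - z‖ := hr.trans_le hyz
  set d := ‖y - z‖
  have hdα : 0 < d ^ α := Real.rpow_pos_of_pos hpos _
  have h1 : inner ℝ (y - z) y ≤ d ^ 2 + d * ε := by
    have e : inner ℝ (y - z) y = inner ℝ (y - z) (y - z) + inner ℝ (y - z) z := by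
      rw [← inner_add_right, sub_add_cancel]
    rw [e, real_inner_self_eq_norm_sq]
    have := (real_inner_le_norm (y - z) z).trans (mul_le_mul_of_nonneg_left hz hpos.le)
    linarith
  have h2 : inner ℝ ((μ / d ^ (α + 2)) • (y - z)) y ≤ μ / d ^ α + ε * (μ / r ^ (α + 1)) := by
    rw [real_inner_smul_left]
    calc μ / d ^ (α + 2) * inner ℝ (y - z) y ≤ μ / d ^ (α + 2) * (d ^ 2 + d * ε) :=
          mul_le_mul_of_nonneg_left h1 (by positivity)
      _ = μ / d ^ α + ε * (μ / d ^ (α + 1)) := by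
          rw [rpow_add_two hpos, Real.rpow_add_one hpos.ne']
          field_simp
      _ ≤ _ := by
          have hε : 0 ≤ ε := (norm_nonneg z).trans hz
          have := Real.rpow_le_rpow hr.le hyz (show 0 ≤ α + 1 by linarith)
          gcongr
  have h3 : 2 * (μ / (α * d ^ α)) = (2 - α) / α * (μ / d ^ α) + μ / d ^ α := by
    field_simp; ring
  linarith

theorem virial_ge {R ε B : ℝ} (hα : 0 < α) (hα₂ : α < 2) (hm : ∀ k, 0 < m k) (hR : 0 < R)
    (hε : ε ≤ R / 8) (hc : ∀ k, ‖c k‖ ≤ ε) {y v : ℂ} (hyR : R / 2 ≤ ‖y‖)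
    (hyR' : ‖y‖ ≤ R) (hv : ‖v‖ ≤ B) :
    (2 - α) / α * ((∑ k, m k) / (R + ε) ^ α) - ε * ((∑ k, m k) / (R / 4) ^ (α + 1)) - 2 -
      2 * |ν| * R * B ≤ 2 * (effectivePotential α m c ν y + (-1)) +
        inner ℝ (potentialGradient α m c ν y) y + 2 * ν * inner ℝ (Complex.I * y) v := by
  have h1 : ∀ k, R / 4 ≤ ‖y - c k‖ := fun k => by
    have := norm_sub_norm_le y (c k)
    linarith [hc k]
  have h2 : ∀ k, ‖y - c k‖ ≤ R + ε := fun k => by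
    have := norm_sub_le y (c k)
    linarith [hc k]
  have h3 : (2 - α) / α * ((∑ k, m k) / (R + ε) ^ α) - ε * ((∑ k, m k) / (R / 4) ^ (α + 1)) ≤
      ∑ k, (2 * (m k / (α * ‖y - c k‖ ^ α)) -
        inner ℝ ((m k / ‖y - c k‖ ^ (α + 2)) • (y - c k)) y) := by
    rw [Finset.sum_div, Finset.sum_div, Finset.mul_sum, Finset.mul_sum, ← Finset.sum_sub_distrib]
    refine Finset.sum_le_sum fun k _ => ?_
    refine le_trans ?_ (virial_term_ge hα (hm k) (by positivity) (hc k) (h1 k))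
    have h4 : m k / (R + ε) ^ α ≤ m k / ‖y - c k‖ ^ α := by
      have hpos : 0 < ‖y - c k‖ := lt_of_lt_of_le (by positivity) (h1 k)
      have := Real.rpow_le_rpow hpos.le (h2 k) hα.le
      have := hm k
      gcongr
    have h5 : 0 ≤ (2 - α) / α := div_nonneg (by linarith) hα.le
    have := mul_le_mul_of_nonneg_left h4 h5
    linarith
  have h4 : |inner ℝ (Complex.I * y) v| ≤ R * B := by
    refine (abs_real_inner_le_norm _ _).trans ?_
    rw [norm_mul, Complex.norm_I, one_mul]
    exact mul_le_mul hyR' hv (norm_nonneg _) hR.le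
  have h5 : -(2 * |ν| * R * B) ≤ 2 * ν * inner ℝ (Complex.I * y) v := by
    have h6 : |2 * ν * inner ℝ (Complex.I * y) v| ≤ 2 * |ν| * R * B := by
      rw [abs_mul, abs_mul, abs_two]
      have := mul_le_mul_of_nonneg_left h4 (show 0 ≤ 2 * |ν| by positivity)
      linarith
    exact (abs_le.1 h6).1
  rw [Finset.sum_sub_distrib, ← Finset.mul_sum] at h3
  rw [effectivePotential, potentialGradient, inner_sub_left, sum_inner, real_inner_smul_left,
    real_inner_self_eq_norm_sq]
  have h7 : 0 ≤ ν ^ 2 * ‖y‖ ^ 2 := by positivity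
  linarith

/-- For `ε = ν = 0` the expression is `(2 - α) M / (α |y|^α) - 2`, with `M` the total mass, and this
is nonnegative up to radius `R`. The displacement of the centres and the Coriolis term are small
perturbations, since energy bounds the velocity on the annulus. -/
theorem exists_virial_ge [NeZero N] (hα : 1 ≤ α) (hα₂ : α < 2) (hm : ∀ k, 0 < m k) {κ : ℝ}
    (hκ : 0 < κ) : ∃ ε₁ > 0, ∃ ν₁ > 0, ∀ c : Fin N → ℂ, ∀ ε, 0 ≤ ε → ε < ε₁ → (∀ k, ‖c k‖ ≤ ε) →
      ∀ ν : ℝ, |ν| < ν₁ → ∀ y v : ℂ, circularRadius α m / 2 ≤ ‖y‖ → ‖y‖ ≤ circularRadius α m →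
        ‖v‖ ^ 2 = 2 * (effectivePotential α m c ν y + (-1)) →
        -κ ≤ 2 * (effectivePotential α m c ν y + (-1)) +
        inner ℝ (potentialGradient α m c ν y) y + 2 * ν * inner ℝ (Complex.I * y) v := by
  set R := circularRadius α m with hR
  have hα0 : 0 < α := by linarith
  have hR0 : 0 < R := circularRadius_pos hα0 hα₂ hm
  have hRα : R ^ α = (2 - α) * (∑ k, m k) / (2 * α) := circularRadius_rpow hα0 hα₂ hm
  have hM : 0 < ∑ k, m k := Finset.sum_pos (fun k _ => hm k) Finset.univ_nonempty
  set B := Real.sqrt (R ^ 2 + 2 * ((∑ k, m k) / (α * (R / 4) ^ α)))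
  have hB : 0 ≤ B := Real.sqrt_nonneg _
  have hlim : ContinuousAt (fun ε : ℝ => (2 - α) / α * ((∑ k, m k) / (R + ε) ^ α) -
      ε * ((∑ k, m k) / (R / 4) ^ (α + 1)) - 2) 0 := by
    have h1 : ContinuousAt (fun ε : ℝ => (R + ε) ^ α) 0 :=
      ContinuousAt.rpow_const (by fun_prop) (Or.inl (by simpa using hR0.ne'))
    have h2 : ((R + 0) ^ α : ℝ) ≠ 0 := by rw [add_zero]; positivity
    exact (((continuousAt_const.div h1 h2).const_mul _).sub (by fun_prop)).sub continuousAt_const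
  have hval : (2 - α) / α * ((∑ k, m k) / (R + 0) ^ α) -
      0 * ((∑ k, m k) / (R / 4) ^ (α + 1)) - 2 = 0 := by
    rw [add_zero, hRα]
    have : 2 - α ≠ 0 := by linarith
    have := hM.ne'
    field_simp
    ring
  have hev := hlim.eventually (lt_mem_nhds (show -(κ / 2) < _ by beta_reduce; rw [hval]; linarith))
  obtain ⟨ε₀, hε₀, hball⟩ := Metric.eventually_nhds_iff.1 hev
  refine ⟨min ε₀ (R / 8), by positivity, min 1 (κ / (4 * R * (B + 1))), by positivity,
    fun c ε hε hε1 hc ν hν y v hy1 hy2 hv => ?_⟩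
  have hε2 : ε < R / 8 := hε1.trans_le (min_le_right _ _)
  have h1 := hball (y := ε) (by
    rw [Real.dist_eq, sub_zero, abs_of_nonneg hε]; exact hε1.trans_le (min_le_left _ _))
  have h2 : ‖v‖ ≤ B := norm_velocity_le hα0 hm rfl (by positivity) (fun k => by
    have := norm_sub_norm_le y (c k)
    linarith [hc k]) hy2 (hν.le.trans (min_le_left _ _)) hv
  have h3 := virial_ge (ν := ν) hα0 hα₂ hm hR0 hε2.le hc hy1 hy2 h2
  have h4 : 2 * |ν| * R * B ≤ κ / 2 := by
    have h5 : |ν| ≤ κ / (4 * R * (B + 1)) := hν.le.trans (min_le_right _ _)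
    rw [le_div_iff₀ (by positivity)] at h5
    nlinarith [mul_nonneg (abs_nonneg ν) hR0.le]
  linarith

/-- With `r` the distance to `c k`, the singular part is `(2 - α) / α * m k * r^{-α}`, which tends
to `+∞` because `α < 2`. The Coriolis term is at least `-(1 + ν² r² |v|²)`, and the energy relation
makes `r² |v|²` of order `r^{2-α}`. Injectivity keeps the contributions of the other centres
continuous. -/
theorem exists_virial_pos (hα : 0 < α) (hα₂ : α < 2) (hm : ∀ k, 0 < m k)
    (hinj : Function.Injective c) (k : Fin N) :
    ∀ᶠ y in 𝓝[≠] (c k), ∀ v : ℂ, ‖v‖ ^ 2 = 2 * (effectivePotential α m c ν y + (-1)) →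
      0 < 2 * (effectivePotential α m c ν y + (-1)) +
        inner ℝ (potentialGradient α m c ν y) (y - c k) +
        2 * ν * inner ℝ (Complex.I * (y - c k)) v := by
  set S : ℂ → ℝ := fun y => ν ^ 2 / 2 * ‖y‖ ^ 2 +
    ∑ j ∈ Finset.univ.erase k, m j / (α * ‖y - c j‖ ^ α) with hS
  set T : ℂ → ℂ := fun y => (ν ^ 2 : ℝ) • y -
    ∑ j ∈ Finset.univ.erase k, (m j / ‖y - c j‖ ^ (α + 2)) • (y - c j) with hT
  have hΦ : ∀ y, effectivePotential α m c ν y = S y + m k / (α * ‖y - c k‖ ^ α) := by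
    intro y
    rw [effectivePotential, hS, ← Finset.sum_erase_add _ _ (Finset.mem_univ k)]; ring
  have hG : ∀ y, potentialGradient α m c ν y =
      T y - (m k / ‖y - c k‖ ^ (α + 2)) • (y - c k) := by
    intro y
    rw [potentialGradient, ← Finset.sum_erase_add _ _ (Finset.mem_univ k)]
    exact (sub_sub _ _ _).symm
  have hne : ∀ j ∈ Finset.univ.erase k, ‖c k - c j‖ ≠ 0 := fun j hj =>
    norm_ne_zero_iff.2 (sub_ne_zero.2 fun h => (Finset.ne_of_mem_erase hj) (hinj h).symm)
  have hSc : ContinuousAt S (c k) := by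
    refine ContinuousAt.add (by fun_prop) (tendsto_finsetSum _ fun j hj => ?_)
    refine continuousAt_const.div (continuousAt_const.mul
      (ContinuousAt.rpow_const (by fun_prop) (Or.inl (hne j hj)))) ?_
    have := Real.rpow_pos_of_pos ((norm_nonneg _).lt_of_ne' (hne j hj)) α
    positivity
  have hTc : ContinuousAt T (c k) := by
    refine ContinuousAt.sub (by fun_prop) (tendsto_finsetSum _ fun j hj => ?_)
    refine ContinuousAt.smul (f := fun y => m j / ‖y - c j‖ ^ (α + 2)) (g := fun y => y - c j)
      (continuousAt_const.div ?_
        (Real.rpow_pos_of_pos ((norm_nonneg _).lt_of_ne' (hne j hj)) _).ne') (by fun_prop)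
    exact ContinuousAt.rpow_const (by fun_prop) (Or.inl (hne j hj))
  -- the terms of lower order are bounded below
  have hL : ContinuousAt (fun y => 2 * (S y - 1) + inner ℝ (T y) (y - c k) - 1 -
      ν ^ 2 * (‖y - c k‖ ^ 2 * (2 * (S y - 1)) + 2 * m k / α * ‖y - c k‖ ^ (2 - α))) (c k) := by
    refine ContinuousAt.sub (ContinuousAt.sub (((hSc.sub continuousAt_const).const_mul _).add
      (hTc.inner (by fun_prop))) continuousAt_const) (continuousAt_const.mul (ContinuousAt.add
        (ContinuousAt.mul (by fun_prop) ((hSc.sub continuousAt_const).const_mul _))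
        (continuousAt_const.mul
          (ContinuousAt.rpow_const (by fun_prop) (Or.inr (by linarith))))))
  have hlim : Tendsto (fun y => (2 - α) / α * m k * (‖y - c k‖ ^ α)⁻¹) (𝓝[≠] (c k)) atTop := by
    refine Tendsto.const_mul_atTop (mul_pos (div_pos (by linarith) hα) (hm k)) ?_
    refine tendsto_inv_nhdsGT_zero.comp (tendsto_nhdsWithin_iff.2 ⟨?_, ?_⟩)
    · have : ContinuousAt (fun y => ‖y - c k‖ ^ α) (c k) :=
        ContinuousAt.rpow_const (by fun_prop) (Or.inr hα.le)
      have h2 := this.tendsto.mono_left (nhdsWithin_le_nhds (s := {c k}ᶜ))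
      simpa [Real.zero_rpow hα.ne'] using h2
    · filter_upwards [self_mem_nhdsWithin] with y hy
      exact Real.rpow_pos_of_pos (norm_pos_iff.2 (sub_ne_zero.2 hy)) _
  have hsum := hlim.atTop_add (hL.tendsto.mono_left nhdsWithin_le_nhds)
  filter_upwards [hsum.eventually_gt_atTop 0, self_mem_nhdsWithin] with y hy hyk v hv
  have hr : 0 < ‖y - c k‖ := norm_pos_iff.2 (sub_ne_zero.2 hyk)
  set r := ‖y - c k‖
  have hrα : 0 < r ^ α := Real.rpow_pos_of_pos hr _
  have h1 : |inner ℝ (Complex.I * (y - c k)) v| ≤ r * ‖v‖ := by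
    refine (abs_real_inner_le_norm _ _).trans ?_
    rw [norm_mul, Complex.norm_I, one_mul]
  have h2 : -(1 + ν ^ 2 * (r * ‖v‖) ^ 2) ≤ 2 * ν * inner ℝ (Complex.I * (y - c k)) v := by
    have h3 : |ν * inner ℝ (Complex.I * (y - c k)) v| ≤ |ν| * (r * ‖v‖) := by
      rw [abs_mul]; exact mul_le_mul_of_nonneg_left h1 (abs_nonneg _)
    have h4 := (abs_le.1 h3).1
    have h5 : ν ^ 2 = |ν| ^ 2 := (sq_abs ν).symm
    rw [h5]
    nlinarith [sq_nonneg (1 - |ν| * (r * ‖v‖))]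
  have h3 : (r * ‖v‖) ^ 2 = r ^ 2 * (2 * (S y - 1)) + 2 * m k / α * r ^ (2 - α) := by
    have hΦy : effectivePotential α m c ν y = S y + m k / (α * r ^ α) := hΦ y
    rw [mul_pow, hv, hΦy, Real.rpow_sub hr, Real.rpow_two]
    field_simp
    ring
  have h4 : inner ℝ ((m k / r ^ (α + 2)) • (y - c k)) (y - c k) = m k / r ^ α := by
    rw [real_inner_smul_left, real_inner_self_eq_norm_sq, rpow_add_two hr]
    rw [div_mul_eq_mul_div, mul_div_mul_right _ _ (by positivity)]
  rw [hΦ, hG, inner_sub_left, h4]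
  have h5 : (2 - α) / α * m k * (r ^ α)⁻¹ = 2 * (m k / (α * r ^ α)) - m k / r ^ α := by
    field_simp
  rw [h3] at h2
  linarith

end

section

/-! ### The functional and its minimizers -/

variable {N : ℕ} {α : ℝ} {m : Fin N → ℝ} {c : Fin N → ℂ} {h ν : ℝ} {p₁ p₂ : ℂ}
  {l : Fin N → ZMod 2} {a b R : ℝ} {u v : ℝ → ℂ}

/-- `∫_a^b |u'|²` as a real number. -/
def kin (a b : ℝ) (u : ℝ → ℂ) : ℝ := ∫ t in a..b, ‖deriv u t‖ ^ 2

/-- `∫_a^b ⟨i u, u'⟩`. -/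
def area (a b : ℝ) (u : ℝ → ℂ) : ℝ := ∫ t in a..b, inner ℝ (Complex.I * u t) (deriv u t)

theorem kin_nonneg (hab : a ≤ b) : 0 ≤ kin a b u := integral_norm_sq_nonneg hab

theorem MemH1.kineticIntegral_eq (hu : MemH1 a b u) (hab : a ≤ b) :
    kineticIntegral a b u = ENNReal.ofReal (kin a b u) := by
  rw [kineticIntegral, kin, ← setIntegral_Icc_eq hab, ofReal_integral_eq_lintegral_ofReal]
  · exact (memLp_two_iff_integrable_sq_norm hu.1.1).1 hu.1
  · exact Eventually.of_forall fun _ => by positivity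

theorem maupertuis_eq (hu : MemH1 a b u) (hab : a ≤ b)
    (hP : potentialIntegral α m c h ν a b u ≠ ⊤) :
    maupertuis α m c h ν a b u = ((Real.sqrt 2 * Real.sqrt (kin a b u) *
      Real.sqrt (potentialIntegral α m c h ν a b u).toReal + ν * area a b u : ℝ) : EReal) := by
  rw [maupertuis, hu.kineticIntegral_eq hab, EReal.coe_add, area]
  congr 1
  conv_lhs => rw [← ENNReal.ofReal_toReal hP]
  rw [ENNReal.ofReal_rpow_of_nonneg (kin_nonneg hab) (by norm_num),
    ENNReal.ofReal_rpow_of_nonneg ENNReal.toReal_nonneg (by norm_num), ← Real.sqrt_eq_rpow,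
    ← Real.sqrt_eq_rpow, ← ENNReal.ofReal_mul (by positivity), ← ENNReal.ofReal_mul (by positivity),
    EReal.coe_ennreal_ofReal, max_eq_left (by positivity)]

/-- Positivity of the kinetic integral excludes the product `0 * ∞ = 0`, which would give a path of
infinite potential integral a finite value. -/
theorem maupertuis_eq_top (hu : MemH1 a b u) (hab : a ≤ b) (hK : 0 < kin a b u)
    (hP : potentialIntegral α m c h ν a b u = ⊤) : maupertuis α m c h ν a b u = ⊤ := by
  rw [maupertuis, hu.kineticIntegral_eq hab, hP, ENNReal.top_rpow_of_pos (by norm_num),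
    ENNReal.mul_top, EReal.coe_ennreal_top, EReal.top_add_coe]
  rw [ENNReal.ofReal_rpow_of_pos hK, ← ENNReal.ofReal_mul (by positivity)]
  have := Real.rpow_pos_of_pos hK (1 / 2)
  simp only [ne_eq, ENNReal.ofReal_eq_zero, not_le]
  positivity

theorem MemH1.continuousOn_I_mul (hu : MemH1 a b u) (hab : a ≤ b) :
    ContinuousOn (fun t => Complex.I * u t) (Set.Icc a b) :=
  continuousOn_const.mul (hu.continuousOn hab)

theorem MemH1.abs_area_le (hu : MemH1 0 1 u) (hR : ∀ t ∈ Set.Icc (0 : ℝ) 1, ‖u t‖ ≤ R) :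
    |area 0 1 u| ≤ R * Real.sqrt (kin 0 1 u) := by
  have hc := (hu.continuousOn_I_mul zero_le_one).memLp_two
  refine (abs_integral_inner_le zero_le_one hc hu.1).trans
    (mul_le_mul_of_nonneg_right ?_ (Real.sqrt_nonneg _))
  have hR0 : 0 ≤ R := (norm_nonneg _).trans (hR 0 (by simp))
  refine Real.sqrt_le_iff.2 ⟨hR0, ?_⟩
  calc ∫ t in (0 : ℝ)..1, ‖Complex.I * u t‖ ^ 2 ≤ ∫ _ in (0 : ℝ)..1, R ^ 2 := by
        refine intervalIntegral.integral_mono_on zero_le_one (hc.intervalIntegrable_sq zero_le_one)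
          (by simp) fun t ht => ?_
        rw [norm_mul, Complex.norm_I, one_mul]
        exact pow_le_pow_left₀ (norm_nonneg _) (hR t ht) 2
    _ = R ^ 2 := by simp

/-- The paths of `topClass` on `[a, b]` that stay in the closed ball of radius `R`. -/
def topBall (c : Fin N → ℂ) (R : ℝ) (p₁ p₂ : ℂ) (l : Fin N → ZMod 2) (a b : ℝ) : Set (ℝ → ℂ) :=
  {u | u ∈ topClass c p₁ p₂ l a b ∧ ∀ t ∈ Set.Icc a b, ‖u t‖ ≤ R}

theorem ballClass_subset_topBall (hab : a ≤ b) (hp : ‖p₁‖ = ‖p₂‖) :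
    ballClass c R p₁ p₂ l a b ⊆ topBall c R p₁ p₂ l a b :=
  fun _ hu => ⟨weakClass_subset_topClass hab hp hu.1, hu.2⟩

/-- The path starts at radius `R` and must reach radius `R / 2`, so it covers a distance of at least
`R / 2` in unit time. -/
theorem sq_half_le_kin (hR : 0 < R) (hp₁ : ‖p₁‖ = R) (hp₂ : ‖p₂‖ = R) (hl : IsWindingVector l)
    (hc : ∀ k, ‖c k‖ ≤ R / 8) (hu : u ∈ topClass c p₁ p₂ l 0 1) : (R / 2) ^ 2 ≤ kin 0 1 u := by
  obtain ⟨t, ht, hut⟩ := exists_norm_le_of_mem_topClass (r := R / 2) zero_le_one hp₁ hp₂ hl hc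
    (by linarith) (by linarith) hu
  have h1 := hu.1.sq_norm_sub_le' (s := 0) (by simp) ht
  rw [sub_zero, abs_of_nonneg ht.1, hu.2.1] at h1
  have h2 : R / 2 ≤ ‖u t - p₁‖ := by
    have := norm_sub_norm_le p₁ (u t)
    rw [norm_sub_rev] at this
    linarith
  have h3 := pow_le_pow_left₀ (by positivity) h2 2
  have h4 : t * ∫ r in (0 : ℝ)..1, ‖deriv u r‖ ^ 2 ≤ kin 0 1 u :=
    mul_le_of_le_one_left (kin_nonneg zero_le_one) ht.2
  linarith

theorem half_le_potentialIntegral [NeZero N] (hα : 1 ≤ α) (hα₂ : α < 2) (hm : ∀ k, 0 < m k)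
    (hc : ∀ k, ‖c k‖ ≤ circularRadius α m / 8)
    (hu : ∀ t ∈ Set.Icc (0 : ℝ) 1, ‖u t‖ ≤ circularRadius α m) :
    ENNReal.ofReal (1 / 2) ≤ potentialIntegral α m c (-1) ν 0 1 u := by
  have : ∫⁻ _ in Set.Icc (0 : ℝ) 1, ENNReal.ofReal (1 / 2) = ENNReal.ofReal (1 / 2) := by
    simp
  rw [← this]
  exact setLIntegral_mono' measurableSet_Icc fun t ht =>
    half_le_extendedPotential hα hα₂ hm hc (hu t ht)

theorem aemeasurable_extendedPotential (hα : 0 < α) (hm : ∀ k, 0 < m k)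
    (hu : ContinuousOn u (Set.Icc a b)) :
    AEMeasurable (fun t => extendedPotential α m c h ν (u t)) (volume.restrict (Set.Icc a b)) :=
  ((continuous_extendedPotential hα hm h).comp_continuousOn hu).aemeasurable measurableSet_Icc

/-- A bilinear pairing of a uniformly convergent factor with a weakly convergent one passes to the
limit. -/
theorem tendsto_area {w : ℕ → ℝ → ℂ} {C : ℝ} (hw : ∀ n, MemH1 0 1 (w n)) (hu : MemH1 0 1 u)
    (hC : ∀ n, kin 0 1 (w n) ≤ C)
    (hweak : ∀ ψ : ℝ → ℂ, MemLp ψ 2 (volume.restrict (Set.Icc (0 : ℝ) 1)) →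
      Tendsto (fun n => ∫ t in (0 : ℝ)..1, inner ℝ (ψ t) (deriv (w n) t)) atTop
        (𝓝 (∫ t in (0 : ℝ)..1, inner ℝ (ψ t) (deriv u t))))
    (hunif : TendstoUniformlyOn w u atTop (Set.Icc 0 1)) :
    Tendsto (fun n => area 0 1 (w n)) atTop (𝓝 (area 0 1 u)) := by
  have hcu := (hu.continuousOn_I_mul zero_le_one).memLp_two
  have h1 := hweak _ hcu
  have h2 : Tendsto (fun n => area 0 1 (w n) -
      ∫ t in (0 : ℝ)..1, inner ℝ (Complex.I * u t) (deriv (w n) t)) atTop (𝓝 0) := by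
    have hC0 : 0 ≤ C := (kin_nonneg zero_le_one).trans (hC 0)
    rw [Metric.tendsto_nhds]
    intro ε hε
    have hε' : 0 < ε / (Real.sqrt C + 1) := by positivity
    filter_upwards [Metric.tendstoUniformlyOn_iff.1 hunif _ hε'] with n hn
    have hcw := ((hw n).continuousOn_I_mul zero_le_one).memLp_two
    rw [Real.dist_eq, sub_zero, area, ← intervalIntegral.integral_sub
      (hcw.intervalIntegrable_inner zero_le_one (hw n).1)
      (hcu.intervalIntegrable_inner zero_le_one (hw n).1)]
    simp_rw [← inner_sub_left]
    refine (abs_integral_inner_le zero_le_one (hcw.sub hcu) (hw n).1).trans_lt ?_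
    have h3 : Real.sqrt (∫ t in (0 : ℝ)..1, ‖Complex.I * w n t - Complex.I * u t‖ ^ 2) ≤
        ε / (Real.sqrt C + 1) := by
      refine Real.sqrt_le_iff.2 ⟨hε'.le, ?_⟩
      calc ∫ t in (0 : ℝ)..1, ‖Complex.I * w n t - Complex.I * u t‖ ^ 2
          ≤ ∫ _ in (0 : ℝ)..1, (ε / (Real.sqrt C + 1)) ^ 2 := by
            refine intervalIntegral.integral_mono_on zero_le_one
              ((hcw.sub hcu).intervalIntegrable_sq zero_le_one) (by simp) fun t ht => ?_
            rw [← mul_sub, norm_mul, Complex.norm_I, one_mul]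
            refine pow_le_pow_left₀ (norm_nonneg _) ?_ 2
            have := hn t ht
            rw [dist_comm, dist_eq_norm] at this
            exact this.le
        _ = _ := by simp
    have h4 : Real.sqrt (∫ t in (0 : ℝ)..1, ‖deriv (w n) t‖ ^ 2) ≤ Real.sqrt C :=
      Real.sqrt_le_sqrt (hC n)
    calc _ ≤ ε / (Real.sqrt C + 1) * Real.sqrt C :=
          mul_le_mul h3 h4 (Real.sqrt_nonneg _) hε'.le
      _ < ε := by
          rw [div_mul_eq_mul_div, div_lt_iff₀ (by positivity)]
          nlinarith [Real.sqrt_nonneg C]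
  have h3 := h2.add h1
  simpa [area] using h3

/-- Weak lower semicontinuity: pairing with `deriv u` converges to `kin 0 1 u` and is bounded by
Cauchy–Schwarz. -/
theorem kin_le_of_weak {w : ℕ → ℝ → ℂ} {k : ℝ} (hw : ∀ n, MemH1 0 1 (w n)) (hu : MemH1 0 1 u)
    (hk : Tendsto (fun n => kin 0 1 (w n)) atTop (𝓝 k))
    (hweak : ∀ ψ : ℝ → ℂ, MemLp ψ 2 (volume.restrict (Set.Icc (0 : ℝ) 1)) →
      Tendsto (fun n => ∫ t in (0 : ℝ)..1, inner ℝ (ψ t) (deriv (w n) t)) atTop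
        (𝓝 (∫ t in (0 : ℝ)..1, inner ℝ (ψ t) (deriv u t)))) :
    kin 0 1 u ≤ k := by
  have h1 := hweak _ hu.1
  simp_rw [real_inner_self_eq_norm_sq] at h1
  have h2 : kin 0 1 u ≤ Real.sqrt (kin 0 1 u) * Real.sqrt k := by
    refine le_of_tendsto_of_tendsto' h1 ((hk.sqrt).const_mul _) fun n => ?_
    exact (le_abs_self _).trans (abs_integral_inner_le zero_le_one hu.1 (hw n).1)
  have h0 : 0 ≤ kin 0 1 u := kin_nonneg zero_le_one
  have hk0 : 0 ≤ k := ge_of_tendsto' hk fun n => kin_nonneg zero_le_one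
  rcases h0.eq_or_lt with h | h
  · rw [← h]; exact hk0
  · have h3 : 0 < Real.sqrt (kin 0 1 u) := Real.sqrt_pos.2 h
    have h4 : Real.sqrt (kin 0 1 u) ≤ Real.sqrt k := by
      have := Real.mul_self_sqrt h0
      nlinarith
    exact (Real.sqrt_le_sqrt_iff hk0).1 h4

theorem potentialIntegral_le_of_tendsto (hα : 0 < α) (hm : ∀ k, 0 < m k) {w : ℕ → ℝ → ℂ} {p : ℝ}
    (hw : ∀ n, ContinuousOn (w n) (Set.Icc a b))
    (hfin : ∀ n, potentialIntegral α m c h ν a b (w n) ≠ ⊤)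
    (hp : Tendsto (fun n => (potentialIntegral α m c h ν a b (w n)).toReal) atTop (𝓝 p))
    (hunif : ∀ t ∈ Set.Icc a b, Tendsto (fun n => w n t) atTop (𝓝 (u t))) :
    potentialIntegral α m c h ν a b u ≤ ENNReal.ofReal p := by
  have h1 : potentialIntegral α m c h ν a b u = ∫⁻ t in Set.Icc a b,
      liminf (fun n => extendedPotential α m c h ν (w n t)) atTop := by
    refine setLIntegral_congr_fun measurableSet_Icc fun t ht => ?_
    exact (((continuous_extendedPotential hα hm h).tendsto (u t)).comp
      (hunif t ht)).liminf_eq.symm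
  rw [h1]
  refine (lintegral_liminf_le' fun n => aemeasurable_extendedPotential hα hm (hw n)).trans ?_
  have h2 : Tendsto (fun n => potentialIntegral α m c h ν a b (w n)) atTop
      (𝓝 (ENNReal.ofReal p)) := by
    refine (ENNReal.tendsto_ofReal hp).congr fun n => ENNReal.ofReal_toReal (hfin n)
  exact h2.liminf_eq.le

/-- The real value of the functional. -/
def action (α : ℝ) (m : Fin N → ℝ) (c : Fin N → ℂ) (ν : ℝ) (u : ℝ → ℂ) : ℝ :=
  Real.sqrt 2 * Real.sqrt (kin 0 1 u) *
    Real.sqrt (potentialIntegral α m c (-1) ν 0 1 u).toReal + ν * area 0 1 u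

/-! ### Coercivity of the action and existence of minimizers. -/

theorem abs_mul_area_le (hu : MemH1 0 1 u) (hR : ∀ t ∈ Set.Icc (0 : ℝ) 1, ‖u t‖ ≤ R)
    (hν : |ν| * R ≤ 1 / 2) : |ν * area 0 1 u| ≤ 1 / 2 * Real.sqrt (kin 0 1 u) := by
  rw [abs_mul]
  calc |ν| * |area 0 1 u| ≤ |ν| * (R * Real.sqrt (kin 0 1 u)) :=
        mul_le_mul_of_nonneg_left (hu.abs_area_le hR) (abs_nonneg _)
    _ = |ν| * R * Real.sqrt (kin 0 1 u) := by ring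
    _ ≤ _ := mul_le_mul_of_nonneg_right hν (Real.sqrt_nonneg _)

/-- Since the potential integral is at least `1 / 2`, the product term dominates `√kin`. The area
term is at most half of `√kin`, so half of the product term remains. -/
theorem sqrt_kin_le_action [NeZero N] (hα : 1 ≤ α) (hα₂ : α < 2) (hm : ∀ k, 0 < m k)
    (hc : ∀ k, ‖c k‖ ≤ circularRadius α m / 8) (hν : |ν| * circularRadius α m ≤ 1 / 2)
    (hu : MemH1 0 1 u) (hR : ∀ t ∈ Set.Icc (0 : ℝ) 1, ‖u t‖ ≤ circularRadius α m)
    (hP : potentialIntegral α m c (-1) ν 0 1 u ≠ ⊤) :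
    Real.sqrt (kin 0 1 u) ≤ 2 * action α m c ν u ∧ Real.sqrt 2 * Real.sqrt (kin 0 1 u) *
      Real.sqrt (potentialIntegral α m c (-1) ν 0 1 u).toReal ≤ 2 * action α m c ν u := by
  have h1 := abs_le.1 (abs_mul_area_le hu hR hν)
  have h2 : 1 ≤ Real.sqrt 2 * Real.sqrt (potentialIntegral α m c (-1) ν 0 1 u).toReal := by
    rw [← Real.sqrt_mul (by norm_num), Real.one_le_sqrt]
    have := (ENNReal.ofReal_le_iff_le_toReal hP).1
      (half_le_potentialIntegral (ν := ν) hα hα₂ hm hc hR)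
    linarith
  have h3 : Real.sqrt (kin 0 1 u) ≤ Real.sqrt 2 * Real.sqrt (kin 0 1 u) *
      Real.sqrt (potentialIntegral α m c (-1) ν 0 1 u).toReal := by
    have := mul_le_mul_of_nonneg_left h2 (Real.sqrt_nonneg (kin 0 1 u))
    linarith
  unfold action
  constructor <;> linarith [h1.1]

theorem exists_minimizer [NeZero N] (hα : 1 ≤ α) (hα₂ : α < 2) (hm : ∀ k, 0 < m k)
    (hc : ∀ k, ‖c k‖ ≤ circularRadius α m / 8) (hν : |ν| * circularRadius α m ≤ 1 / 2)
    (hp₁ : ‖p₁‖ = circularRadius α m) (hp₂ : ‖p₂‖ = circularRadius α m) (hl : IsWindingVector l)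
    (hex : ∃ u ∈ topBall c (circularRadius α m) p₁ p₂ l 0 1,
      potentialIntegral α m c (-1) ν 0 1 u ≠ ⊤) :
    ∃ u ∈ topBall c (circularRadius α m) p₁ p₂ l 0 1,
      potentialIntegral α m c (-1) ν 0 1 u ≠ ⊤ ∧
      ∀ v ∈ topBall c (circularRadius α m) p₁ p₂ l 0 1,
        potentialIntegral α m c (-1) ν 0 1 v ≠ ⊤ → action α m c ν u ≤ action α m c ν v := by
  have hα0 : 0 < α := by linarith
  have hR0 : 0 < circularRadius α m := circularRadius_pos hα0 hα₂ hm
  set R := circularRadius α m with hR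
  set S := action α m c ν '' {u | u ∈ topBall c R p₁ p₂ l 0 1 ∧
      potentialIntegral α m c (-1) ν 0 1 u ≠ ⊤} with hS
  have hSne : S.Nonempty := by
    obtain ⟨u, h1, h2⟩ := hex
    exact ⟨_, u, ⟨h1, h2⟩, rfl⟩
  have hSbdd : BddBelow S := by
    refine ⟨0, ?_⟩
    rintro _ ⟨u, ⟨hu, hP⟩, rfl⟩
    have := (sqrt_kin_le_action hα hα₂ hm hc hν hu.1.1 hu.2 hP).1
    linarith [Real.sqrt_nonneg (kin 0 1 u)]
  obtain ⟨x, hx_anti, hx_lim, hxS⟩ := exists_seq_tendsto_sInf hSne hSbdd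
  choose w hw hwx using hxS
  have hx0 : ∀ n, x n ≤ x 0 := fun n => hx_anti (Nat.zero_le n)
  have hwK : ∀ n, kin 0 1 (w n) ≤ (2 * x 0) ^ 2 := by
    intro n
    have h1 := (sqrt_kin_le_action hα hα₂ hm hc hν (hw n).1.1.1 (hw n).1.2 (hw n).2).1
    rw [hwx n] at h1
    rw [← Real.sq_sqrt (kin_nonneg (u := w n) zero_le_one)]
    exact pow_le_pow_left₀ (Real.sqrt_nonneg _) (h1.trans (by linarith [hx0 n])) 2
  have hwK' : ∀ n, R / 2 ≤ Real.sqrt (kin 0 1 (w n)) := fun n =>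
    Real.le_sqrt_of_sq_le (sq_half_le_kin hR0 hp₁ hp₂ hl hc (hw n).1.1)
  set P : ℕ → ℝ := fun n => (potentialIntegral α m c (-1) ν 0 1 (w n)).toReal with hPdef
  have hwP : ∀ n, P n ≤ (4 * x 0 / R) ^ 2 := by
    intro n
    have h1 := (sqrt_kin_le_action hα hα₂ hm hc hν (hw n).1.1.1 (hw n).1.2 (hw n).2).2
    rw [hwx n] at h1
    have h2 : Real.sqrt (P n) ≤ 4 * x 0 / R := by
      rw [le_div_iff₀ hR0]
      have h3 : 1 * (R / 2) * Real.sqrt (P n) ≤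
          Real.sqrt 2 * Real.sqrt (kin 0 1 (w n)) * Real.sqrt (P n) := by
        have : (1 : ℝ) ≤ Real.sqrt 2 := by rw [Real.one_le_sqrt]; norm_num
        have := hwK' n
        gcongr
      have := hx0 n
      have h4 : Real.sqrt 2 * Real.sqrt (kin 0 1 (w n)) * Real.sqrt (P n) ≤ 2 * x n := h1
      linarith
    rw [← Real.sq_sqrt (show 0 ≤ P n from ENNReal.toReal_nonneg)]
    exact pow_le_pow_left₀ (Real.sqrt_nonneg _) h2 2
  -- extraction of subsequences
  obtain ⟨u, φ, hφ, hu, hu0, hweak, hunif⟩ := exists_weakly_convergent_paths zero_le_one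
    (fun n => (hw n).1.1.1) (fun n => (hw n).1.1.2.1) hwK
  -- The action contains a product of two integrals, each only lower semicontinuous. A further
  -- subsequence makes both converge, so that the two inequalities can be multiplied.
  have hcomp : IsCompact (Set.Icc (0 : ℝ) ((2 * x 0) ^ 2) ×ˢ Set.Icc (0 : ℝ) ((4 * x 0 / R) ^ 2)) :=
    isCompact_Icc.prod isCompact_Icc
  obtain ⟨⟨k, p⟩, -, ψ, hψ, hlim⟩ := hcomp.tendsto_subseq
    (x := fun n => (kin 0 1 (w (φ n)), P (φ n)))
    (fun n => ⟨⟨kin_nonneg zero_le_one, hwK _⟩, ⟨ENNReal.toReal_nonneg, hwP _⟩⟩)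
  have hk : Tendsto (fun n => kin 0 1 (w (φ (ψ n)))) atTop (𝓝 k) :=
    (continuous_fst.tendsto _).comp hlim
  have hp : Tendsto (fun n => P (φ (ψ n))) atTop (𝓝 p) := (continuous_snd.tendsto _).comp hlim
  have hunif' : TendstoUniformlyOn (fun n => w (φ (ψ n))) u atTop (Set.Icc 0 1) :=
    fun s hs => hψ.tendsto_atTop.eventually (hunif s hs)
  have hpt : ∀ t ∈ Set.Icc (0 : ℝ) 1, Tendsto (fun n => w (φ (ψ n)) t) atTop (𝓝 (u t)) :=
    fun t ht => hunif'.tendsto_at ht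
  have hweak' : ∀ f : ℝ → ℂ, MemLp f 2 (volume.restrict (Set.Icc (0 : ℝ) 1)) →
      Tendsto (fun n => ∫ t in (0 : ℝ)..1, inner ℝ (f t) (deriv (w (φ (ψ n))) t)) atTop
        (𝓝 (∫ t in (0 : ℝ)..1, inner ℝ (f t) (deriv u t))) :=
    fun f hf => (hweak f hf).comp hψ.tendsto_atTop
  have hKu := kin_le_of_weak (fun n => (hw _).1.1.1) hu hk hweak'
  have hAu := tendsto_area (fun n => (hw _).1.1.1) hu (fun n => hwK _) hweak' hunif'
  have hPu := potentialIntegral_le_of_tendsto hα0 hm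
    (fun n => (hw _).1.1.1.continuousOn zero_le_one) (fun n => (hw _).2) hp hpt
  have hPfin : potentialIntegral α m c (-1) ν 0 1 u ≠ ⊤ :=
    ne_top_of_le_ne_top ENNReal.ofReal_ne_top hPu
  have hp0 : 0 ≤ p := ge_of_tendsto' hp fun n => ENNReal.toReal_nonneg
  have hPu' : (potentialIntegral α m c (-1) ν 0 1 u).toReal ≤ p :=
    ENNReal.toReal_le_of_le_ofReal hp0 hPu
  have hu1 : u 1 = p₂ := by
    refine tendsto_nhds_unique (hpt 1 (by simp)) ?_
    simp_rw [(hw _).1.1.2.2.1]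
    exact tendsto_const_nhds
  have hact : action α m c ν u ≤ sInf S := by
    have h1 : Tendsto (fun n => action α m c ν (w (φ (ψ n)))) atTop (𝓝 (sInf S)) := by
      simp_rw [hwx]
      exact hx_lim.comp (hφ.tendsto_atTop.comp hψ.tendsto_atTop)
    have h2 : Tendsto (fun n => action α m c ν (w (φ (ψ n)))) atTop
        (𝓝 (Real.sqrt 2 * Real.sqrt k * Real.sqrt p + ν * area 0 1 u)) :=
      ((hk.sqrt.const_mul _).mul hp.sqrt).add (hAu.const_mul _)
    rw [tendsto_nhds_unique h1 h2, action]
    gcongr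
  refine ⟨u, ⟨mem_topClass_of_tendstoUniformlyOn zero_le_one (by rw [hp₁, hp₂])
    (fun n => (hw _).1.1) hu hu0 hu1 hunif', fun t ht => ?_⟩, hPfin, fun v hv hPv => ?_⟩
  · exact le_of_tendsto' (hpt t ht).norm fun n => (hw _).1.2 t ht
  · exact hact.trans (csInf_le hSbdd ⟨v, ⟨hv, hPv⟩, rfl⟩)

end

section

variable {N : ℕ} {α : ℝ} {m : Fin N → ℝ} {c : Fin N → ℂ} {h ν R : ℝ} {a b : ℝ} {u v : ℝ → ℂ}

/-! ### Changes of time -/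

theorem setLIntegral_comp_affine {p : ℝ} (hp : 0 < p) (q s t : ℝ) (f : ℝ → ENNReal) :
    ∫⁻ x in Set.Icc s t, f (p * x + q) =
      ENNReal.ofReal p⁻¹ * ∫⁻ x in Set.Icc (p * s + q) (p * t + q), f x := by
  have hmp := measurePreserving_affine hp q
  have hemb : MeasurableEmbedding (fun t : ℝ => p * t + q) :=
    ((Homeomorph.mulLeft₀ p hp.ne').trans (Homeomorph.addRight q)).measurableEmbedding
  have hpre : (fun t : ℝ => p * t + q) ⁻¹' (Set.Icc (p * s + q) (p * t + q)) = Set.Icc s t := by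
    ext t; simp [hp]
  rw [← hmp.setLIntegral_comp_preimage_emb hemb f (Set.Icc (p * s + q) (p * t + q)), hpre, Measure.restrict_smul, lintegral_smul_measure,
    abs_of_pos hp, smul_eq_mul, ← mul_assoc, ← ENNReal.ofReal_mul (by positivity),
    inv_mul_cancel₀ hp.ne', ENNReal.ofReal_one, one_mul]

theorem setLIntegral_comp_sub (T : ℝ) (f : ℝ → ENNReal) :
    ∫⁻ x in Set.Icc 0 T, f (T - x) = ∫⁻ x in Set.Icc 0 T, f x := by
  have hmp := Measure.measurePreserving_sub_left (volume : Measure ℝ) T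
  have hemb : MeasurableEmbedding (fun t : ℝ => T - t) :=
    (Homeomorph.subLeft T).measurableEmbedding
  have hpre : (fun t : ℝ => T - t) ⁻¹' (Set.Icc 0 T) = Set.Icc 0 T := by
    ext t; simp only [Set.mem_preimage, Set.mem_Icc]; constructor <;> rintro ⟨h1, h2⟩ <;>
      constructor <;> linarith
  rw [← hmp.setLIntegral_comp_preimage_emb hemb f (Set.Icc 0 T), hpre]

theorem kineticIntegral_congr (huv : ∀ t ∈ Set.Icc a b, v t = u t) :
    kineticIntegral a b v = kineticIntegral a b u := by
  refine lintegral_congr_ae ((ae_restrict_iff' measurableSet_Icc).2 ?_)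
  filter_upwards [ae_ne a, ae_ne b] with t hta htb ht
  rw [MemH1.deriv_eq_of_eqOn (fun x hx => huv x ⟨hx.1.le, hx.2.le⟩) ⟨lt_of_le_of_ne ht.1 hta.symm,
    lt_of_le_of_ne ht.2 htb⟩]

theorem potentialIntegral_congr (huv : ∀ t ∈ Set.Icc a b, v t = u t) :
    potentialIntegral α m c h ν a b v = potentialIntegral α m c h ν a b u :=
  setLIntegral_congr_fun measurableSet_Icc fun t ht => by rw [huv t ht]

theorem setLIntegral_Icc_add_le {f : ℝ → ENNReal} {d : ℝ} (hab : a ≤ b) (hbd : b ≤ d) :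
    ∫⁻ t in Set.Icc a d, f t ≤ (∫⁻ t in Set.Icc a b, f t) + ∫⁻ t in Set.Icc b d, f t := by
  rw [← Set.Icc_union_Icc_eq_Icc hab hbd]
  exact lintegral_union_le _ _ _

theorem kineticIntegral_comp_affine {p : ℝ} (hp : 0 < p) (q s t : ℝ) :
    kineticIntegral s t (fun x => u (p * x + q)) =
      ENNReal.ofReal p * kineticIntegral (p * s + q) (p * t + q) u := by
  have hd : ∀ t, deriv (fun t => u (p * t + q)) t = p * deriv u (p * t + q) := by
    intro t
    rw [deriv_comp_mul_left p (fun s => u (s + q)) t, deriv_comp_add_const]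
    simp
  simp only [kineticIntegral, hd, norm_mul, Complex.norm_real, Real.norm_of_nonneg hp.le, mul_pow]
  rw [setLIntegral_comp_affine hp q s t (fun x => ENNReal.ofReal (p ^ 2 * ‖deriv u x‖ ^ 2))]
  simp_rw [ENNReal.ofReal_mul (sq_nonneg p)]
  rw [lintegral_const_mul' _ _ (by simp), ← mul_assoc, ← ENNReal.ofReal_mul (by positivity)]
  congr 2
  field_simp

theorem potentialIntegral_comp_affine {p : ℝ} (hp : 0 < p) (q s t : ℝ) :
    potentialIntegral α m c h ν s t (fun x => u (p * x + q)) =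
      ENNReal.ofReal p⁻¹ * potentialIntegral α m c h ν (p * s + q) (p * t + q) u :=
  setLIntegral_comp_affine hp q s t (fun x => extendedPotential α m c h ν (u x))

theorem MemH1.reverse {T : ℝ} (hu : MemH1 0 T u) :
    MemH1 0 T (fun t => u (T - t)) := by
  have hd : ∀ t, deriv (fun t => u (T - t)) t = -deriv u (T - t) := fun t =>
    deriv_comp_const_sub (f := u) T t
  have hpre : (fun t : ℝ => T - t) ⁻¹' (Set.Icc 0 T) = Set.Icc 0 T := by
    ext t; simp only [Set.mem_preimage, Set.mem_Icc]; constructor <;> rintro ⟨h1, h2⟩ <;>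
      constructor <;> linarith
  have hmp := (Measure.measurePreserving_sub_left (volume : Measure ℝ) T).restrict_preimage
    (s := Set.Icc 0 T) measurableSet_Icc
  rw [hpre] at hmp
  refine ⟨?_, fun t ht => ?_⟩
  · rw [funext hd]
    exact (hu.1.comp_measurePreserving hmp).neg
  · simp only [hd, sub_zero]
    rw [intervalIntegral.integral_neg, intervalIntegral.integral_comp_sub_left (fun x => deriv u x),
      sub_zero, ← hu.sub_eq_integral (by linarith [ht.2]) (by linarith [ht.1]) le_rfl]
    ring

theorem kineticIntegral_reverse (T : ℝ) :
    kineticIntegral 0 T (fun t => u (T - t)) = kineticIntegral 0 T u := by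
  have hd : ∀ t, deriv (fun t => u (T - t)) t = -deriv u (T - t) := fun t =>
    deriv_comp_const_sub (f := u) T t
  simp only [kineticIntegral, hd, norm_neg]
  exact setLIntegral_comp_sub T fun x => ENNReal.ofReal (‖deriv u x‖ ^ 2)

/-! ### Paths of finite cost -/

/-- There is a path from `p` to `q` in the ball of radius `R` that meets the centres in `S` and
whose kinetic and potential integrals add up to at most `C`. -/
def Connects (α : ℝ) (m : Fin N → ℝ) (c : Fin N → ℂ) (h ν R : ℝ) (S : Finset (Fin N)) (p q : ℂ)
    (C : ENNReal) : Prop :=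
  ∃ T > 0, ∃ u : ℝ → ℂ, MemH1 0 T u ∧ u 0 = p ∧ u T = q ∧ (∀ t ∈ Set.Icc 0 T, ‖u t‖ ≤ R) ∧
    (∀ k ∈ S, ∃ t ∈ Set.Icc 0 T, u t = c k) ∧
    kineticIntegral 0 T u + potentialIntegral α m c h ν 0 T u ≤ C

namespace Connects

variable {S S' : Finset (Fin N)} {p q r : ℂ} {C C' : ENNReal}

theorem symm (H : Connects α m c h ν R S p q C) : Connects α m c h ν R S q p C := by
  obtain ⟨T, hT, u, h1, h2, h3, h4, h5, h6⟩ := H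
  refine ⟨T, hT, fun t => u (T - t), h1.reverse, by simpa using h3, by simpa using h2,
    fun t ht => h4 _ ⟨by linarith [ht.2], by linarith [ht.1]⟩, fun k hk => ?_, ?_⟩
  · obtain ⟨t, ht, hkt⟩ := h5 k hk
    exact ⟨T - t, ⟨by linarith [ht.2], by linarith [ht.1]⟩, by simpa using hkt⟩
  · rw [kineticIntegral_reverse]
    refine le_trans (le_of_eq ?_) h6
    congr 1
    exact setLIntegral_comp_sub T fun x => extendedPotential α m c h ν (u x)

theorem trans (H : Connects α m c h ν R S p q C) (H' : Connects α m c h ν R S' q r C') :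
    Connects α m c h ν R (S ∪ S') p r (C + C') := by
  obtain ⟨T, hT, u, h1, h2, h3, h4, h5, h6⟩ := H
  obtain ⟨T', hT', v, h1', h2', h3', h4', h5', h6'⟩ := H'
  set w : ℝ → ℂ := fun t => if t ≤ T then u t else v (1 * t + -T) with hw
  have hw1 : ∀ t ∈ Set.Icc 0 T, w t = u t := fun t ht => by simp [hw, ht.2]
  have hw2 : ∀ t ∈ Set.Icc T (T + T'), w t = v (1 * t + -T) := fun t ht => by
    rcases ht.1.eq_or_lt with rfl | h
    · simp [hw, h3, h2']
    · simp [hw, not_le.2 h]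
  have hTT : T ≤ T + T' := by linarith
  have hv : MemH1 T (T + T') (fun t => v (1 * t + -T)) :=
    (h1'.comp_affine one_pos hTT (by linarith) (by linarith)).1
  refine ⟨T + T', by linarith, w, (h1.congr hT.le hw1).trans (hv.congr hTT hw2) hT.le hTT, ?_, ?_,
    ?_, ?_, ?_⟩
  · rw [hw1 0 ⟨le_rfl, hT.le⟩, h2]
  · rw [hw2 _ ⟨hTT, le_rfl⟩, ← h3']; congr 1; ring
  · intro t ht
    rcases le_total t T with h | h
    · rw [hw1 t ⟨ht.1, h⟩]; exact h4 t ⟨ht.1, h⟩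
    · rw [hw2 t ⟨h, ht.2⟩]; exact h4' _ ⟨by linarith, by linarith [ht.2]⟩
  · intro k hk
    rcases Finset.mem_union.1 hk with hk | hk
    · obtain ⟨t, ht, hkt⟩ := h5 k hk
      exact ⟨t, ⟨ht.1, ht.2.trans hTT⟩, by rw [hw1 t ht, hkt]⟩
    · obtain ⟨t, ht, hkt⟩ := h5' k hk
      refine ⟨t + T, ⟨by linarith [ht.1], by linarith [ht.2]⟩, ?_⟩
      rw [hw2 _ ⟨by linarith [ht.1], by linarith [ht.2]⟩, ← hkt]; congr 1; ring
  · have e1 : kineticIntegral T (T + T') w = kineticIntegral 0 T' v := by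
      rw [kineticIntegral_congr hw2, kineticIntegral_comp_affine one_pos]
      simp
    have e2 : potentialIntegral α m c h ν T (T + T') w = potentialIntegral α m c h ν 0 T' v := by
      rw [potentialIntegral_congr hw2, potentialIntegral_comp_affine one_pos]
      simp
    calc kineticIntegral 0 (T + T') w + potentialIntegral α m c h ν 0 (T + T') w
        ≤ (kineticIntegral 0 T w + kineticIntegral T (T + T') w) +
          (potentialIntegral α m c h ν 0 T w + potentialIntegral α m c h ν T (T + T') w) :=
          add_le_add (setLIntegral_Icc_add_le hT.le hTT) (setLIntegral_Icc_add_le hT.le hTT)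
      _ = (kineticIntegral 0 T u + potentialIntegral α m c h ν 0 T u) +
          (kineticIntegral 0 T' v + potentialIntegral α m c h ν 0 T' v) := by
          rw [e1, e2, kineticIntegral_congr hw1, potentialIntegral_congr hw1]
          ring
      _ ≤ _ := add_le_add h6 h6'

/-- The cost in `Connects` is a sum, hence subadditive under concatenation. Passing to `[0, 1]`
multiplies one integral by `T` and the other by `T⁻¹`, so the product, which the action contains, is
unchanged. -/
theorem exists_unit (H : Connects α m c h ν R S p q C) (hC : C ≠ ⊤) :
    ∃ u : ℝ → ℂ, MemH1 0 1 u ∧ u 0 = p ∧ u 1 = q ∧ (∀ t ∈ Set.Icc (0 : ℝ) 1, ‖u t‖ ≤ R) ∧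
    (∀ k ∈ S, ∃ t ∈ Set.Icc (0 : ℝ) 1, u t = c k) ∧ potentialIntegral α m c h ν 0 1 u ≠ ⊤ ∧
    Real.sqrt (kin 0 1 u) * Real.sqrt (potentialIntegral α m c h ν 0 1 u).toReal ≤ C.toReal := by
  obtain ⟨T, hT, u, h1, h2, h3, h4, h5, h6⟩ := H
  have hv := (h1.comp_affine (c := 0) (d := 1) (q := 0) hT zero_le_one (by simp) (by simp)).1
  have hK : kineticIntegral 0 T u ≤ C := le_self_add.trans h6
  have hP : potentialIntegral α m c h ν 0 T u ≤ C := le_add_self.trans h6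
  have hK' := kineticIntegral_comp_affine (u := u) hT 0 0 1
  have hP' := potentialIntegral_comp_affine (u := u) (α := α) (m := m) (c := c) (h := h) (ν := ν)
    hT 0 0 1
  simp only [mul_zero, mul_one, add_zero] at hK' hP' hv
  refine ⟨fun t => u (T * t), hv, by simpa using h2, by simpa using h3,
    fun t ht => h4 _ ⟨by nlinarith [ht.1], by nlinarith [ht.2]⟩, fun k hk => ?_, ?_, ?_⟩
  · obtain ⟨t, ht, hkt⟩ := h5 k hk
    refine ⟨t / T, ⟨by have := ht.1; positivity, (div_le_one hT).2 ht.2⟩, ?_⟩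
    rw [← hkt]; field_simp
  · rw [hP']
    exact ENNReal.mul_ne_top (by simp) (ne_top_of_le_ne_top hC hP)
  · have e1 : kin 0 1 (fun t => u (T * t)) = T * (kineticIntegral 0 T u).toReal := by
      have := hv.kineticIntegral_eq zero_le_one
      rw [hK'] at this
      rw [← ENNReal.toReal_ofReal (kin_nonneg zero_le_one), ← this, ENNReal.toReal_mul,
        ENNReal.toReal_ofReal hT.le]
    rw [e1, hP', ENNReal.toReal_mul, ENNReal.toReal_ofReal (by positivity), ← Real.sqrt_mul
      (by positivity)]
    have h7 := ENNReal.toReal_mono hC hK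
    have h8 := ENNReal.toReal_mono hC hP
    set x := (kineticIntegral 0 T u).toReal with hx
    set y := (potentialIntegral α m c h ν 0 T u).toReal with hy
    have hx0 : 0 ≤ x := ENNReal.toReal_nonneg
    have hy0 : 0 ≤ y := ENNReal.toReal_nonneg
    rw [show T * x * (T⁻¹ * y) = x * y by field_simp]
    refine Real.sqrt_le_iff.2 ⟨ENNReal.toReal_nonneg, ?_⟩
    rw [pow_two]
    exact mul_le_mul h7 h8 hy0 ENNReal.toReal_nonneg

end Connects

/-! ### Power-law spirals -/

/-- `z + (r₀ + r₁ t^γ) e^{i (θ₀ + θ₁ t)}`. -/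
def spiral (γ : ℝ) (z : ℂ) (r₀ r₁ θ₀ θ₁ : ℝ) : ℝ → ℂ := fun t =>
  z + ((r₀ + r₁ * t ^ γ : ℝ) : ℂ) * Complex.exp ((θ₀ + θ₁ * t : ℝ) * Complex.I)

theorem norm_spiral_sub {γ r₀ r₁ : ℝ} (z : ℂ) (θ₀ θ₁ : ℝ) (hr₀ : 0 ≤ r₀) (hr₁ : 0 ≤ r₁) {t : ℝ}
    (ht : 0 ≤ t) : ‖spiral γ z r₀ r₁ θ₀ θ₁ t - z‖ = r₀ + r₁ * t ^ γ := by
  rw [spiral, add_sub_cancel_left, norm_mul, Complex.norm_exp_ofReal_mul_I, mul_one,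
    Complex.norm_real, Real.norm_of_nonneg (by positivity)]

/-- The radial speed is of order `t^{γ-1}`, square integrable at `0` exactly because `γ > 1/2`. -/
theorem memH1_spiral {γ : ℝ} (hγ : 1 / 2 < γ) (z : ℂ) {r₀ r₁ : ℝ} (θ₀ θ₁ : ℝ) (hr₀ : 0 ≤ r₀)
    (hr₁ : 0 ≤ r₁) : MemH1 0 1 (spiral γ z r₀ r₁ θ₀ θ₁) ∧
      kineticIntegral 0 1 (spiral γ z r₀ r₁ θ₀ θ₁) ≤ ENNReal.ofReal
        (r₁ ^ 2 * γ ^ 2 / (2 * γ - 1) + (r₀ + r₁) ^ 2 * θ₁ ^ 2) := by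
  set g : ℝ → ℂ := fun t => ((r₁ * (γ * t ^ (γ - 1)) : ℝ) +
    (r₀ + r₁ * t ^ γ : ℝ) * (θ₁ : ℝ) * Complex.I) * Complex.exp ((θ₀ + θ₁ * t : ℝ) * Complex.I)
    with hg
  have hpow : ∀ t : ℝ, 0 < t → HasDerivAt (fun t => r₀ + r₁ * t ^ γ) (r₁ * (γ * t ^ (γ - 1))) t :=
    fun t ht => ((Real.hasDerivAt_rpow_const (Or.inl ht.ne')).const_mul r₁).const_add r₀
  have hexp : ∀ t : ℝ, HasDerivAt (fun t : ℝ => Complex.exp ((θ₀ + θ₁ * t : ℝ) * Complex.I))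
      (Complex.exp ((θ₀ + θ₁ * t : ℝ) * Complex.I) * (θ₁ * Complex.I)) t := by
    intro t
    have h1 : HasDerivAt (fun t : ℝ => θ₀ + θ₁ * t) θ₁ t := by
      simpa using ((hasDerivAt_id t).const_mul θ₁).const_add θ₀
    exact (h1.ofReal_comp.mul_const Complex.I).cexp
  have hd : ∀ t : ℝ, 0 < t → HasDerivAt (spiral γ z r₀ r₁ θ₀ θ₁) (g t) t := by
    intro t ht
    refine (((hpow t ht).ofReal_comp.mul (hexp t)).const_add z).congr_deriv ?_
    simp only [hg]
    ring
  have hnorm : ∀ t : ℝ, ‖g t‖ ^ 2 = r₁ ^ 2 * γ ^ 2 * (t ^ (γ - 1)) ^ 2 +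
      (r₀ + r₁ * t ^ γ) ^ 2 * θ₁ ^ 2 := by
    intro t
    rw [hg]
    beta_reduce
    rw [norm_mul, Complex.norm_exp_ofReal_mul_I, mul_one, ← Complex.normSq_eq_norm_sq,
      ← Complex.ofReal_mul, Complex.normSq_add_mul_I]
    ring
  have hbound : ∀ t ∈ Set.Ioc (0 : ℝ) 1, ‖g t‖ ^ 2 ≤ r₁ ^ 2 * γ ^ 2 * t ^ (2 * γ - 2) +
      (r₀ + r₁) ^ 2 * θ₁ ^ 2 := by
    intro t ht
    rw [hnorm]
    have h1 : (t ^ (γ - 1)) ^ 2 = t ^ (2 * γ - 2) := by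
      rw [← Real.rpow_mul_natCast ht.1.le]; congr 1; push_cast; ring
    have h2 : t ^ γ ≤ 1 := Real.rpow_le_one ht.1.le ht.2 (by linarith)
    have h3 : 0 ≤ t ^ γ := Real.rpow_nonneg ht.1.le _
    rw [h1]
    gcongr
    nlinarith
  have hint : IntervalIntegrable (fun t : ℝ => r₁ ^ 2 * γ ^ 2 * t ^ (2 * γ - 2) +
      (r₀ + r₁) ^ 2 * θ₁ ^ 2) volume 0 1 :=
    ((intervalIntegral.intervalIntegrable_rpow' (by linarith)).const_mul _).add (by simp)
  have hint' : IntegrableOn (fun t : ℝ => r₁ ^ 2 * γ ^ 2 * t ^ (2 * γ - 2) +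
      (r₀ + r₁) ^ 2 * θ₁ ^ 2) (Set.Icc 0 1) :=
    (intervalIntegrable_iff_integrableOn_Icc_of_le zero_le_one).1 hint
  have hval : ∫ t in (0 : ℝ)..1, (r₁ ^ 2 * γ ^ 2 * t ^ (2 * γ - 2) + (r₀ + r₁) ^ 2 * θ₁ ^ 2) =
      r₁ ^ 2 * γ ^ 2 / (2 * γ - 1) + (r₀ + r₁) ^ 2 * θ₁ ^ 2 := by
    rw [intervalIntegral.integral_add ((intervalIntegral.intervalIntegrable_rpow'
      (by linarith)).const_mul _) (by simp), intervalIntegral.integral_const_mul, integral_rpow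
      (Or.inl (by linarith)), Real.one_rpow, Real.zero_rpow (by linarith)]
    simp only [intervalIntegral.integral_const, sub_zero, smul_eq_mul, one_mul]
    rw [show 2 * γ - 2 + 1 = 2 * γ - 1 by ring]
    ring
  have hmeas : Measurable g := by
    rw [hg]; fun_prop
  have hae : ∀ᵐ t, t ∈ Set.Icc (0 : ℝ) 1 → t ∈ Set.Ioc (0 : ℝ) 1 := by
    filter_upwards [ae_ne 0] with t h1 h2
    exact ⟨lt_of_le_of_ne h2.1 h1.symm, h2.2⟩
  have hgL : MemLp g 2 (volume.restrict (Set.Icc 0 1)) := by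
    rw [memLp_two_iff_integrable_sq_norm hmeas.aestronglyMeasurable]
    refine hint'.mono' (by fun_prop) ((ae_restrict_iff' measurableSet_Icc).2 ?_)
    filter_upwards [hae] with t h1 h2
    rw [Real.norm_of_nonneg (by positivity)]
    exact hbound t (h1 h2)
  have hint3 : ∀ t ∈ Set.Icc (0 : ℝ) 1, spiral γ z r₀ r₁ θ₀ θ₁ t =
      spiral γ z r₀ r₁ θ₀ θ₁ 0 + ∫ s in (0 : ℝ)..t, g s := by
    intro t ht
    have hcont : Continuous (spiral γ z r₀ r₁ θ₀ θ₁) := by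
      unfold spiral
      have : Continuous fun t : ℝ => t ^ γ := Real.continuous_rpow_const (by linarith)
      fun_prop
    rw [intervalIntegral.integral_eq_sub_of_hasDeriv_right_of_le ht.1 hcont.continuousOn
      (fun s hs => (hd s hs.1).hasDerivWithinAt)
      ((hgL.mono_measure (Measure.restrict_mono (Set.Icc_subset_Icc le_rfl ht.2)
        le_rfl)).intervalIntegrable_two ht.1)]
    ring
  refine ⟨memH1_of_integral zero_le_one hgL hint3, ?_⟩
  rw [← hval, ← setIntegral_Icc_eq zero_le_one, ofReal_integral_eq_lintegral_ofReal hint'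
    ((ae_restrict_iff' measurableSet_Icc).2 (Eventually.of_forall fun t ht => by
      have := ht.1; positivity))]
  refine lintegral_mono_ae ((ae_restrict_iff' measurableSet_Icc).2 ?_)
  filter_upwards [hae] with t h1 h2
  rw [(hd t (h1 h2).1).deriv]
  exact ENNReal.ofReal_le_ofReal (hbound t (h1 h2))

theorem potentialIntegral_le_of_power {β A B : ℝ} (hβ : β < 1) (hA : 0 ≤ A) (hB : 0 ≤ B)
    (hu : ∀ t ∈ Set.Ioc (0 : ℝ) 1, (∀ k, u t ≠ c k) ∧
      effectivePotential α m c ν (u t) + h ≤ A * t ^ (-β) + B) :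
    potentialIntegral α m c h ν 0 1 u ≤ ENNReal.ofReal (A / (1 - β) + B) := by
  have hint : IntervalIntegrable (fun t : ℝ => A * t ^ (-β) + B) volume 0 1 :=
    ((intervalIntegral.intervalIntegrable_rpow' (by linarith)).const_mul _).add (by simp)
  have hval : ∫ t in (0 : ℝ)..1, (A * t ^ (-β) + B) = A / (1 - β) + B := by
    rw [intervalIntegral.integral_add ((intervalIntegral.intervalIntegrable_rpow'
      (by linarith)).const_mul _) (by simp), intervalIntegral.integral_const_mul, integral_rpow
      (Or.inl (by linarith)), Real.one_rpow, Real.zero_rpow (by linarith)]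
    simp only [intervalIntegral.integral_const, sub_zero, smul_eq_mul, one_mul]
    rw [show -β + 1 = 1 - β by ring]
    ring
  rw [← hval, ← setIntegral_Icc_eq zero_le_one, ofReal_integral_eq_lintegral_ofReal
    ((intervalIntegrable_iff_integrableOn_Icc_of_le zero_le_one).1 hint)
    ((ae_restrict_iff' measurableSet_Icc).2 (Eventually.of_forall fun t ht => by
      have := ht.1; positivity))]
  refine lintegral_mono_ae ((ae_restrict_iff' measurableSet_Icc).2 ?_)
  filter_upwards [ae_ne 0] with t h1 h2
  have h3 := hu t ⟨lt_of_le_of_ne h2.1 h1.symm, h2.2⟩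
  rw [extendedPotential_of_ne h3.1]
  exact ENNReal.ofReal_le_ofReal h3.2

end

section

variable {N : ℕ} {α : ℝ} {m : Fin N → ℝ} {c : Fin N → ℂ} {h ν R : ℝ} {a b : ℝ} {u v : ℝ → ℂ}

/-! ### A path of bounded cost through all centres -/

/-- The hub is sought on the vertical segment with real part `5/2`. For each ordered pair of
centres, at most one height puts the hub on the line through them, and finitely many heights can be
avoided. -/
theorem exists_hub {d : Fin N → ℂ} (hd : Function.Injective d) (hd1 : ∀ k, ‖d k‖ ≤ 1) :
    ∃ q : ℂ, 2 ≤ ‖q‖ ∧ ‖q‖ ≤ 3 ∧ ∀ j k, j ≠ k → ∀ s : ℝ, d k + s * (q - d k) ≠ d j := by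
  let q : ℝ → ℂ := fun x => ⟨5 / 2, x⟩
  have hbad : ∀ j k, j ≠ k → {x : ℝ | ∃ s : ℝ, d k + s * (q x - d k) = d j}.Subsingleton := by
    rintro j k hjk x ⟨s, hs⟩ x' ⟨s', hs'⟩
    have hre : (d k).re ≤ 1 := (Complex.re_le_norm _).trans (hd1 k)
    have e1 := congrArg Complex.re hs
    have e2 := congrArg Complex.im hs
    have e1' := congrArg Complex.re hs'
    have e2' := congrArg Complex.im hs'
    simp [q] at e1 e2 e1' e2'
    have hss : s = s' := by
      have h1 : (s - s') * (5 / 2 - (d k).re) = 0 := by linarith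
      rcases mul_eq_zero.1 h1 with h | h <;> linarith
    subst hss
    have hs0 : s ≠ 0 := by
      rintro rfl
      simp at hs
      exact hjk (hd hs).symm
    have h2 : s * (x - x') = 0 := by linarith
    rcases mul_eq_zero.1 h2 with h | h
    · exact absurd h hs0
    · linarith
  have hfin : (⋃ j, ⋃ k, ⋃ (_ : j ≠ k), {x : ℝ | ∃ s : ℝ, d k + s * (q x - d k) = d j}).Finite :=
    Set.finite_iUnion fun j => Set.finite_iUnion fun k => Set.finite_iUnion fun hjk =>
      (hbad j k hjk).finite
  obtain ⟨x, hx, hxb⟩ := (Set.Ioo_infinite (zero_lt_one (α := ℝ))).exists_notMem_finite hfin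
  have hnq : ‖q x‖ ^ 2 = 25 / 4 + x ^ 2 := by
    rw [← Complex.normSq_eq_norm_sq, Complex.normSq_apply]; simp [q]; ring
  refine ⟨q x, ?_, ?_, fun j k hjk s hs => hxb ?_⟩
  · exact (abs_le_of_sq_le_sq' (by rw [hnq]; nlinarith [sq_nonneg x]) (norm_nonneg _)).2
  · exact (abs_le_of_sq_le_sq' (by rw [hnq]; nlinarith [hx.1, hx.2]) (by norm_num)).2
  · simp only [Set.mem_iUnion]
    exact ⟨j, k, hjk, s, hs⟩

/-- The straight segment from the centre to the hub, with distance to the centre proportional to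
`t^γ`. Near the centre the potential is of order `t^{-αγ}`, which is integrable; the other centres
stay at a positive distance. -/
theorem connects_centre_hub {γ : ℝ} (hα : 0 < α) (hγ : 1 / 2 < γ) (hγα : α * γ < 1)
    (hm : ∀ k, 0 < m k) {d : Fin N → ℂ} (hd1 : ∀ k, ‖d k‖ ≤ 1) {q : ℂ} (hq2 : 2 ≤ ‖q‖)
    (hq3 : ‖q‖ ≤ 3) (hq : ∀ j k, j ≠ k → ∀ s : ℝ, d k + s * (q - d k) ≠ d j) (k : Fin N) :
    ∃ C : ENNReal, C ≠ ⊤ ∧ Connects α m d 0 0 3 {k} (d k) q C := by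
  have hqk : q - d k ≠ 0 := by
    intro h
    rw [sub_eq_zero] at h
    have := hd1 k
    rw [← h] at this
    linarith
  have hρ : 0 < ‖q - d k‖ := norm_pos_iff.2 hqk
  set ρ := ‖q - d k‖
  set f := spiral γ (d k) 0 ρ (q - d k).arg 0 with hf
  have hfv : ∀ t, f t = d k + (t ^ γ : ℝ) * (q - d k) := by
    intro t
    simp only [hf, spiral, zero_mul, add_zero, zero_add]
    push_cast
    rw [mul_right_comm, Complex.norm_mul_exp_arg_mul_I, mul_comm]
  have hfn : ∀ t, 0 ≤ t → ‖f t - d k‖ = ρ * t ^ γ := fun t ht => by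
    rw [hf, norm_spiral_sub _ _ _ le_rfl hρ.le ht, zero_add]
  have hne : ∀ t, 0 < t → ∀ j, f t ≠ d j := by
    intro t ht j
    by_cases hjk : j = k
    · rw [hjk, ← sub_ne_zero, ← norm_pos_iff, hfn t ht.le]
      have := Real.rpow_pos_of_pos ht γ
      positivity
    · rw [hfv]; exact hq j k hjk _
  obtain ⟨hH, hK⟩ := memH1_spiral hγ (d k) (q - d k).arg 0 le_rfl hρ.le
  have hcont : ContinuousOn (fun t => ∑ j ∈ Finset.univ.erase k, m j / (α * ‖f t - d j‖ ^ α))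
      (Set.Icc 0 1) := by
    refine continuousOn_finsetSum _ fun j hj => ?_
    have hjk := Finset.ne_of_mem_erase hj
    have hpos : ∀ t ∈ Set.Icc (0 : ℝ) 1, 0 < ‖f t - d j‖ := fun t ht => by
      rw [norm_pos_iff, sub_ne_zero, hfv]; exact hq j k hjk _
    refine continuousOn_const.div (continuousOn_const.mul (ContinuousOn.rpow_const
      ((hH.continuousOn zero_le_one).sub continuousOn_const).norm fun t ht =>
        Or.inl (hpos t ht).ne')) fun t ht => ?_
    have := Real.rpow_pos_of_pos (hpos t ht) α
    positivity
  obtain ⟨B, hB⟩ := isCompact_Icc.exists_bound_of_continuousOn hcont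
  have hB0 : 0 ≤ B := (norm_nonneg _).trans (hB 0 (by simp))
  have hmk := hm k
  have hP := potentialIntegral_le_of_power (α := α) (m := m) (c := d) (ν := 0) (h := 0) (u := f)
    (A := m k / (α * ρ ^ α)) (B := B) hγα (by positivity) hB0 (fun t ht => ⟨hne t ht.1, by
      rw [effectivePotential, ← Finset.sum_erase_add _ _ (Finset.mem_univ k), hfn t ht.1.le]
      have h1 := (le_abs_self _).trans (hB t ⟨ht.1.le, ht.2⟩)
      have h2 : m k / (α * (ρ * t ^ γ) ^ α) = m k / (α * ρ ^ α) * t ^ (-(α * γ)) := by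
        rw [Real.mul_rpow hρ.le (Real.rpow_nonneg ht.1.le _), ← Real.rpow_mul ht.1.le,
          Real.rpow_neg ht.1.le, mul_comm γ α]
        have := Real.rpow_pos_of_pos ht.1 (α * γ)
        have := Real.rpow_pos_of_pos hρ α
        field_simp
      have h3 : (0 : ℝ) ^ 2 / 2 * ‖f t‖ ^ 2 = 0 := by simp
      rw [h2, h3]
      linarith⟩)
  refine ⟨_, ?_, 1, one_pos, f, hH, ?_, ?_, fun t ht => ?_, fun j hj => ?_, add_le_add hK hP⟩
  · simp
  · rw [hfv, Real.zero_rpow (by linarith)]; simp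
  · rw [hfv, Real.one_rpow]; simp
  · have h1 : t ^ γ ≤ 1 := Real.rpow_le_one ht.1 ht.2 (by linarith)
    have h0 : 0 ≤ t ^ γ := Real.rpow_nonneg ht.1 _
    have h2 : f t = ((1 - t ^ γ : ℝ) : ℂ) * d k + (t ^ γ : ℝ) * q := by
      rw [hfv]; push_cast; ring
    rw [h2]
    refine (norm_add_le _ _).trans ?_
    rw [norm_mul, norm_mul, Complex.norm_real, Complex.norm_real, Real.norm_of_nonneg h0,
      Real.norm_of_nonneg (by linarith)]
    nlinarith [hd1 k]
  · rw [Finset.mem_singleton.1 hj]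
    refine ⟨0, by simp, ?_⟩
    rw [hfv, Real.zero_rpow (by linarith)]; simp

/-- One round trip from the hub for each centre, by induction on the set of centres to be met. -/
theorem connects_hub_hub {γ : ℝ} (hα : 0 < α) (hγ : 1 / 2 < γ) (hγα : α * γ < 1)
    (hm : ∀ k, 0 < m k) {d : Fin N → ℂ} (hd1 : ∀ k, ‖d k‖ ≤ 1) {q : ℂ} (hq2 : 2 ≤ ‖q‖)
    (hq3 : ‖q‖ ≤ 3) (hq : ∀ j k, j ≠ k → ∀ s : ℝ, d k + s * (q - d k) ≠ d j) (S : Finset (Fin N)) :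
    ∃ C : ENNReal, C ≠ ⊤ ∧ Connects α m d 0 0 3 S q q C := by
  classical
  induction S using Finset.induction_on with
  | empty =>
    have hne : ∀ k, q ≠ d k := fun k h => by
      have := hd1 k
      rw [← h] at this
      linarith
    refine ⟨_, ?_, 1, one_pos, fun _ => q, memH1_const zero_le_one q, rfl, rfl, fun _ _ => hq3,
      by simp, le_rfl⟩
    simp only [kineticIntegral, potentialIntegral, extendedPotential_of_ne hne]
    simp
  | insert k S _ ih =>
    obtain ⟨C, hC, H⟩ := ih
    obtain ⟨C', hC', H'⟩ := connects_centre_hub hα hγ hγα hm hd1 hq2 hq3 hq k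
    refine ⟨C' + C' + C, by simp [hC, hC'], ?_⟩
    have := (H'.symm.trans H').trans H
    rwa [Finset.union_self, ← Finset.insert_eq] at this

/-- Homogeneity of degree `-α`; the centrifugal term is at most `1` and is absorbed by the energy
`-1`. -/
theorem extendedPotential_scale_le (hα : 0 < α) {d : Fin N → ℂ} {ε : ℝ}
    (hε : 0 < ε) {y : ℂ} (hy : ‖y‖ ≤ 3) (hν : ν ^ 2 * ε ^ 2 * 9 ≤ 2) :
    extendedPotential α m (fun k => ε * d k) (-1) ν (ε * y) ≤
      ENNReal.ofReal (ε ^ (-α)) * extendedPotential α m d 0 0 y := by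
  have hεα : 0 < ε ^ (-α) := Real.rpow_pos_of_pos hε _
  by_cases hk : ∃ k, y = d k
  · rw [show extendedPotential α m d 0 0 y = ⊤ from if_pos hk, ENNReal.mul_top (by simpa using hεα)]
    exact le_top
  · push Not at hk
    have hε0 : (ε : ℂ) ≠ 0 := by exact_mod_cast hε.ne'
    rw [extendedPotential_of_ne hk, extendedPotential_of_ne (fun k h => hk k
      (mul_left_cancel₀ hε0 h)), ← ENNReal.ofReal_mul hεα.le]
    refine ENNReal.ofReal_le_ofReal ?_
    unfold effectivePotential
    have h1 : ν ^ 2 / 2 * ‖(ε : ℂ) * y‖ ^ 2 ≤ 1 := by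
      rw [norm_mul, Complex.norm_real, Real.norm_of_nonneg hε.le, mul_pow]
      have := pow_le_pow_left₀ (norm_nonneg y) hy 2
      have h0 : 0 ≤ ν ^ 2 * ε ^ 2 := by positivity
      nlinarith
    have h2 : ∑ k, m k / (α * ‖(ε : ℂ) * y - ε * d k‖ ^ α) =
        ε ^ (-α) * ∑ k, m k / (α * ‖y - d k‖ ^ α) := by
      rw [Finset.mul_sum]
      refine Finset.sum_congr rfl fun k _ => ?_
      have hpos : 0 < ‖y - d k‖ := norm_pos_iff.2 (sub_ne_zero.2 (hk k))
      rw [← mul_sub, norm_mul, Complex.norm_real, Real.norm_of_nonneg hε.le,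
        Real.mul_rpow hε.le hpos.le, Real.rpow_neg hε.le]
      have := Real.rpow_pos_of_pos hε α
      have := Real.rpow_pos_of_pos hpos α
      field_simp
    have h3 : (0 : ℝ) ^ 2 / 2 * ‖y‖ ^ 2 = 0 := by simp
    rw [h2, h3, zero_add, add_zero]
    linarith

/-- Scaling space by `ε` and time by `ε^{1 + α/2}` multiplies the kinetic cost by `ε^{1 - α/2} ≤ 1`
and the potential cost by at most this factor. The bound is therefore independent of `ε`. -/
theorem Connects.scale (hα : 0 < α) (hα₂ : α < 2) {d : Fin N → ℂ}
    {S : Finset (Fin N)} {p q : ℂ} {C : ENNReal} (H : Connects α m d 0 0 3 S p q C) {ε : ℝ}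
    (hε : 0 < ε) (hε1 : ε ≤ 1) (hεR : 3 * ε ≤ R) (hν : ν ^ 2 * ε ^ 2 * 9 ≤ 2) :
    Connects α m (fun k => ε * d k) (-1) ν R S (ε * p) (ε * q) C := by
  obtain ⟨T, hT, u, h1, h2, h3, h4, h5, h6⟩ := H
  set τ := ε ^ (1 + α / 2) with hτ
  have hτ0 : 0 < τ := Real.rpow_pos_of_pos hε _
  have hτT : 0 ≤ τ * T := by positivity
  have hv := (h1.comp_affine (c := 0) (d := τ * T) (p := τ⁻¹) (q := 0) (by positivity) hτT (by simp)
    (by field_simp; simp)).1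
  have hvε := (hv.const_smul hτT ε).1
  have hexp : ε ^ (1 - α / 2) ≤ 1 := Real.rpow_le_one hε.le hε1 (by linarith)
  have hK : kineticIntegral 0 (τ * T) (fun t => (ε : ℂ) * u (τ⁻¹ * t + 0)) ≤
      kineticIntegral 0 T u := by
    have e1 : kineticIntegral 0 (τ * T) (fun t => (ε : ℂ) * u (τ⁻¹ * t + 0)) =
        ENNReal.ofReal (ε ^ 2) * kineticIntegral 0 (τ * T) (fun t => u (τ⁻¹ * t + 0)) := by
      simp only [kineticIntegral, deriv_const_mul_field, norm_mul, Complex.norm_real,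
        Real.norm_of_nonneg hε.le, mul_pow]
      simp_rw [ENNReal.ofReal_mul (sq_nonneg ε)]
      rw [lintegral_const_mul' _ _ (by simp)]
    rw [e1, kineticIntegral_comp_affine (by positivity), ← mul_assoc, ← ENNReal.ofReal_mul
      (by positivity), show τ⁻¹ * 0 + 0 = 0 by simp, show τ⁻¹ * (τ * T) + 0 = T by field_simp; simp]
    refine mul_le_of_le_one_left' (ENNReal.ofReal_le_one.2 ?_)
    refine le_trans (le_of_eq ?_) hexp
    rw [hτ, ← Real.rpow_neg hε.le, ← Real.rpow_natCast, ← Real.rpow_add hε]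
    congr 1; push_cast; ring
  have hP : potentialIntegral α m (fun k => ε * d k) (-1) ν 0 (τ * T)
      (fun t => (ε : ℂ) * u (τ⁻¹ * t + 0)) ≤ potentialIntegral α m d 0 0 0 T u := by
    have e1 : potentialIntegral α m (fun k => ε * d k) (-1) ν 0 (τ * T)
        (fun t => (ε : ℂ) * u (τ⁻¹ * t + 0)) ≤ ENNReal.ofReal (ε ^ (-α)) *
          potentialIntegral α m d 0 0 0 (τ * T) (fun t => u (τ⁻¹ * t + 0)) := by
      rw [potentialIntegral, potentialIntegral, ← lintegral_const_mul' _ _ (by simp)]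
      refine setLIntegral_mono' measurableSet_Icc fun t ht => ?_
      refine extendedPotential_scale_le hα hε (h4 _ ⟨?_, ?_⟩) hν
      · have := ht.1; positivity
      · rw [add_zero, inv_mul_le_iff₀ hτ0]; exact ht.2
    refine e1.trans ?_
    rw [potentialIntegral_comp_affine (by positivity), ← mul_assoc, ← ENNReal.ofReal_mul
      (by positivity), show τ⁻¹ * 0 + 0 = 0 by simp, show τ⁻¹ * (τ * T) + 0 = T by field_simp; simp]
    refine mul_le_of_le_one_left' (ENNReal.ofReal_le_one.2 ?_)
    refine le_trans (le_of_eq ?_) hexp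
    rw [inv_inv, hτ, ← Real.rpow_add hε]
    congr 1; ring
  refine ⟨τ * T, by positivity, _, hvε, by simp [h2], by simp [hτ0.ne', h3], fun t ht => ?_,
    fun k hk => ?_, (add_le_add hK hP).trans h6⟩
  · rw [norm_mul, Complex.norm_real, Real.norm_of_nonneg hε.le]
    have := h4 (τ⁻¹ * t + 0) ⟨by have := ht.1; positivity, by
      rw [add_zero, inv_mul_le_iff₀ hτ0]; exact ht.2⟩
    nlinarith
  · obtain ⟨t, ht, hkt⟩ := h5 k hk
    refine ⟨τ * t, ⟨by have := ht.1; positivity, by nlinarith [ht.2]⟩, ?_⟩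
    rw [show τ⁻¹ * (τ * t) + 0 = t by field_simp; simp, hkt]

/-- A spiral from the scaled hub out to the boundary circle. Its distance to every centre is at
least `R / 4 * t^γ`, whatever `ε` is, so the cost does not depend on `ε`. -/
theorem connects_sphere {γ ε : ℝ} (hα : 0 < α) (hγ : 1 / 2 < γ) (hγα : α * γ < 1)
    (hm : ∀ k, 0 < m k) (hR : 0 < R) (hε : 0 < ε) (hεR : 6 * ε ≤ R) (hc : ∀ k, ‖c k‖ ≤ ε)
    (hν : |ν| * R ≤ 1) {p q : ℂ} (hp : ‖p‖ = R) (hq2 : 2 ≤ ‖q‖) (hq3 : ‖q‖ ≤ 3) :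
    Connects α m c (-1) ν R ∅ (ε * q) p (ENNReal.ofReal (R ^ 2 * γ ^ 2 / (2 * γ - 1) +
      R ^ 2 * (2 * Real.pi) ^ 2) +
      ENNReal.ofReal ((∑ k, m k) / (α * (R / 4) ^ α) / (1 - α * γ) + 0)) := by
  have hr₀ : 0 ≤ ε * ‖q‖ := by positivity
  have hr₁ : R / 2 ≤ R - ε * ‖q‖ := by nlinarith
  have hr₁' : R - ε * ‖q‖ ≤ R := by linarith
  obtain ⟨hH, hK⟩ := memH1_spiral hγ 0 q.arg (p.arg - q.arg) hr₀ (by linarith : 0 ≤ R - ε * ‖q‖)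
  set f := spiral γ 0 (ε * ‖q‖) (R - ε * ‖q‖) q.arg (p.arg - q.arg) with hf
  have hfn : ∀ t, 0 ≤ t → ‖f t‖ = ε * ‖q‖ + (R - ε * ‖q‖) * t ^ γ := fun t ht => by
    rw [← norm_spiral_sub 0 q.arg (p.arg - q.arg) hr₀ (by linarith : 0 ≤ R - ε * ‖q‖) ht, sub_zero]
  have hfR : ∀ t ∈ Set.Icc (0 : ℝ) 1, ‖f t‖ ≤ R := by
    intro t ht
    rw [hfn t ht.1]
    have h1 : t ^ γ ≤ 1 := Real.rpow_le_one ht.1 ht.2 (by linarith)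
    nlinarith
  have hdist : ∀ t, 0 ≤ t → ∀ k, R / 4 * t ^ γ ≤ ‖f t - c k‖ := by
    intro t ht k
    have h1 := norm_sub_norm_le (f t) (c k)
    have h2 := hc k
    have h3 : 0 ≤ t ^ γ := Real.rpow_nonneg ht _
    have h4 := hfn t ht
    have h5 : R / 2 * t ^ γ ≤ (R - ε * ‖q‖) * t ^ γ := mul_le_mul_of_nonneg_right hr₁ h3
    nlinarith
  refine ⟨1, one_pos, f, hH, ?_, ?_, hfR, by simp, add_le_add (hK.trans ?_) ?_⟩
  · simp only [hf, spiral]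
    rw [Real.zero_rpow (by linarith)]
    simp only [mul_zero, add_zero, zero_add]
    push_cast
    rw [mul_assoc, Complex.norm_mul_exp_arg_mul_I]
  · simp only [hf, spiral]
    rw [Real.one_rpow]
    simp only [mul_one, zero_add, add_sub_cancel]
    rw [← hp, Complex.norm_mul_exp_arg_mul_I]
  · refine ENNReal.ofReal_le_ofReal ?_
    rw [add_sub_cancel]
    have h1 : (p.arg - q.arg) ^ 2 ≤ (2 * Real.pi) ^ 2 := by
      have e1 := Complex.arg_mem_Ioc p
      have e2 := Complex.arg_mem_Ioc q
      rw [sq_le_sq, abs_of_nonneg (by positivity : (0 : ℝ) ≤ 2 * Real.pi), abs_le]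
      constructor <;> linarith [e1.1, e1.2, e2.1, e2.2]
    have h2 : 0 < 2 * γ - 1 := by linarith
    have h3 : 0 ≤ R - ε * ‖q‖ := by linarith
    gcongr
  · refine potentialIntegral_le_of_power hγα (div_nonneg (Finset.sum_nonneg fun k _ => (hm k).le)
      (by positivity)) le_rfl fun t ht => ⟨fun k hk => ?_, ?_⟩
    · have h1 := hdist t ht.1.le k
      rw [hk, sub_self, norm_zero] at h1
      have := Real.rpow_pos_of_pos ht.1 γ
      have : 0 < R / 4 * t ^ γ := by positivity
      linarith
    · have htγ := Real.rpow_pos_of_pos ht.1 γ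
      have h1 : ν ^ 2 / 2 * ‖f t‖ ^ 2 ≤ 1 := by
        have h2 : |ν| * ‖f t‖ ≤ 1 :=
          (mul_le_mul_of_nonneg_left (hfR t ⟨ht.1.le, ht.2⟩) (abs_nonneg _)).trans hν
        have h3 : (|ν| * ‖f t‖) ^ 2 ≤ 1 := pow_le_one₀ (by positivity) h2
        rw [mul_pow, sq_abs] at h3
        linarith
      have h2 : ∑ k, m k / (α * ‖f t - c k‖ ^ α) ≤
          (∑ k, m k) / (α * (R / 4) ^ α) * t ^ (-(α * γ)) := by
        rw [Finset.sum_div, Finset.sum_mul]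
        refine Finset.sum_le_sum fun k _ => ?_
        have h3 : m k / (α * (R / 4) ^ α) * t ^ (-(α * γ)) = m k / (α * (R / 4 * t ^ γ) ^ α) := by
          rw [Real.mul_rpow (by positivity) htγ.le, ← Real.rpow_mul ht.1.le,
            Real.rpow_neg ht.1.le, mul_comm γ α]
          have := Real.rpow_pos_of_pos ht.1 (α * γ)
          field_simp
        rw [h3]
        have := hm k
        have := Real.rpow_le_rpow (by positivity) (hdist t ht.1.le k) hα.le
        gcongr
      unfold effectivePotential
      linarith

/-- A path through all centres satisfies the condition of `topClass` for every `l`, so one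
construction serves all classes: boundary, hub, all centres, hub, boundary. -/
theorem exists_competitor [NeZero N] (hα : 1 ≤ α) (hα₂ : α < 2) (hm : ∀ k, 0 < m k)
    {d : Fin N → ℂ} (hd : Function.Injective d) (hd1 : ∀ k, ‖d k‖ ≤ 1) (hR : 0 < R) :
    ∃ C : ℝ, ∃ ε₀ > 0, ∀ ε : ℝ, 0 < ε → ε < ε₀ → ∀ ν : ℝ, |ν| * R ≤ 1 →
      ∀ p₁ p₂ : ℂ, ‖p₁‖ = R → ‖p₂‖ = R → ∀ l : Fin N → ZMod 2,
      ∃ u ∈ topBall (fun k => ε * d k) R p₁ p₂ l 0 1,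
        potentialIntegral α m (fun k => ε * d k) (-1) ν 0 1 u ≠ ⊤ ∧
        Real.sqrt (kin 0 1 u) *
          Real.sqrt (potentialIntegral α m (fun k => ε * d k) (-1) ν 0 1 u).toReal ≤ C := by
  have hα0 : 0 < α := by linarith
  obtain ⟨γ, hγ, hγα⟩ : ∃ γ : ℝ, 1 / 2 < γ ∧ α * γ < 1 := by
    -- The midpoint of the interval `(1/2, 1/α)`, which is not empty because `α < 2`.
    refine ⟨(1 / 2 + 1 / α) / 2, ?_, ?_⟩
    · have : 1 / 2 < 1 / α := one_div_lt_one_div_of_lt hα0 hα₂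
      linarith
    · field_simp
      linarith
  obtain ⟨q, hq2, hq3, hq⟩ := exists_hub hd hd1
  obtain ⟨C, hC, H⟩ := connects_hub_hub hα0 hγ hγα hm hd1 hq2 hq3 hq Finset.univ
  set C' := ENNReal.ofReal (R ^ 2 * γ ^ 2 / (2 * γ - 1) + R ^ 2 * (2 * Real.pi) ^ 2) +
      ENNReal.ofReal ((∑ k, m k) / (α * (R / 4) ^ α) / (1 - α * γ) + 0) with hC'
  refine ⟨(C' + C + C').toReal, min 1 (R / 6), by positivity, fun ε hε hε0 ν hν p₁ p₂ hp₁ hp₂ l =>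
    ?_⟩
  have hε1 : ε < 1 := hε0.trans_le (min_le_left _ _)
  have hεR : 6 * ε ≤ R := by linarith [hε0.trans_le (min_le_right _ _)]
  have hνε : ν ^ 2 * ε ^ 2 * 9 ≤ 2 := by
    have h1 : |ν| * (6 * ε) ≤ 1 := (mul_le_mul_of_nonneg_left hεR (abs_nonneg _)).trans hν
    have h2 : (|ν| * (6 * ε)) ^ 2 ≤ 1 := pow_le_one₀ (by positivity) h1
    rw [mul_pow, sq_abs] at h2
    nlinarith [sq_nonneg (ν * ε)]
  have hc : ∀ k, ‖(ε : ℂ) * d k‖ ≤ ε := fun k => by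
    rw [norm_mul, Complex.norm_real, Real.norm_of_nonneg hε.le]
    exact mul_le_of_le_one_right hε.le (hd1 k)
  have H1 := connects_sphere (c := fun k => ε * d k) hα0 hγ hγα hm hR hε hεR hc hν hp₁ hq2 hq3
  have H2 := connects_sphere (c := fun k => ε * d k) hα0 hγ hγα hm hR hε hεR hc hν hp₂ hq2 hq3
  have H3 := H.scale (R := R) hα0 hα₂ hε hε1.le (by linarith) hνε
  obtain ⟨u, h1, h2, h3, h4, h5, h6, h7⟩ := ((H1.symm.trans H3).trans H2).exists_unit
    (by simp [hC])
  exact ⟨u, ⟨⟨h1, h2, h3, fun j => Or.inl (h5 j (by simp))⟩, h4⟩, h6, h7⟩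

end

section

/-! ### Conservation of energy for minimizers -/

variable {N : ℕ} {α : ℝ} {m : Fin N → ℝ} {c : Fin N → ℂ} {h ν R : ℝ} {a b : ℝ} {u v : ℝ → ℂ}
  {p₁ p₂ : ℂ} {l : Fin N → ZMod 2}

/-- The density of `potentialIntegral` as a real number. -/
def potDensity (α : ℝ) (m : Fin N → ℝ) (c : Fin N → ℂ) (ν : ℝ) (u : ℝ → ℂ) (t : ℝ) : ℝ :=
  (extendedPotential α m c (-1) ν (u t)).toReal

/-- `u` minimizes the action among the paths of `topBall` with finite potential integral, and
`Φ_ν - 1` is bounded below by `1 / 2` on the ball. -/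
structure IsActionMinimizer (α : ℝ) (m : Fin N → ℝ) (c : Fin N → ℂ) (ν R : ℝ) (p₁ p₂ : ℂ)
    (l : Fin N → ZMod 2) (u : ℝ → ℂ) : Prop where
  mem : u ∈ topBall c R p₁ p₂ l 0 1
  finite : potentialIntegral α m c (-1) ν 0 1 u ≠ ⊤
  le : ∀ v ∈ topBall c R p₁ p₂ l 0 1, potentialIntegral α m c (-1) ν 0 1 v ≠ ⊤ →
    action α m c ν u ≤ action α m c ν v
  kin_pos : 0 < kin 0 1 u
  alpha_pos : 0 < α
  mass_pos : ∀ k, 0 < m k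
  pos : ∀ y, ‖y‖ ≤ R → (∀ k, y ≠ c k) → 1 / 2 ≤ effectivePotential α m c ν y + (-1)

theorem intervalIntegrable_potDensity (hα : 0 < α) (hm : ∀ k, 0 < m k) (hab : a ≤ b)
    (hu : ContinuousOn u (Set.Icc a b)) (hP : potentialIntegral α m c (-1) ν a b u ≠ ⊤) :
    IntervalIntegrable (potDensity α m c ν u) volume a b := by
  rw [intervalIntegrable_iff_integrableOn_Icc_of_le hab]
  exact integrable_toReal_of_lintegral_ne_top (aemeasurable_extendedPotential hα hm hu) hP

theorem toReal_potentialIntegral (hα : 0 < α) (hm : ∀ k, 0 < m k) (hab : a ≤ b)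
    (hu : ContinuousOn u (Set.Icc a b)) (hP : potentialIntegral α m c (-1) ν a b u ≠ ⊤) :
    (potentialIntegral α m c (-1) ν a b u).toReal = ∫ t in a..b, potDensity α m c ν u t := by
  have hme := aemeasurable_extendedPotential (c := c) (h := -1) (ν := ν) hα hm hu
  rw [← setIntegral_Icc_eq hab]
  exact (integral_toReal hme (ae_lt_top' hme hP)).symm

theorem potDensity_of_ne {t : ℝ} (h : ∀ k, u t ≠ c k)
    (hpos : 0 ≤ effectivePotential α m c ν (u t) + (-1)) :
    potDensity α m c ν u t = effectivePotential α m c ν (u t) + (-1) := by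
  rw [potDensity, extendedPotential_of_ne h, ENNReal.toReal_ofReal hpos]

theorem ae_ne_of_potentialIntegral_ne_top (hα : 0 < α) (hm : ∀ k, 0 < m k)
    (hu : ContinuousOn u (Set.Icc a b)) (hP : potentialIntegral α m c (-1) ν a b u ≠ ⊤) :
    ∀ᵐ t, t ∈ Set.Icc a b → ∀ k, u t ≠ c k := by
  have hme := aemeasurable_extendedPotential (c := c) (h := -1) (ν := ν) hα hm hu
  filter_upwards [(ae_restrict_iff' measurableSet_Icc).1 (ae_lt_top' hme hP)] with t ht hab k hk
  have := ht hab
  rw [extendedPotential, if_pos ⟨k, hk⟩] at this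
  exact lt_irrefl _ this

theorem potentialIntegral_mono {s t : ℝ} (has : a ≤ s) (htb : t ≤ b) :
    potentialIntegral α m c h ν s t u ≤ potentialIntegral α m c h ν a b u :=
  lintegral_mono_set (Set.Icc_subset_Icc has htb)

theorem potentialIntegral_ne_top_of_split {s : ℝ} (has : a ≤ s) (hsb : s ≤ b)
    (h1 : potentialIntegral α m c h ν a s u ≠ ⊤) (h2 : potentialIntegral α m c h ν s b u ≠ ⊤) :
    potentialIntegral α m c h ν a b u ≠ ⊤ :=
  ne_top_of_le_ne_top (ENNReal.add_ne_top.2 ⟨h1, h2⟩) (setLIntegral_Icc_add_le has hsb)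

namespace IsActionMinimizer

variable (H : IsActionMinimizer α m c ν R p₁ p₂ l u)

include H

theorem memH1 : MemH1 0 1 u := H.mem.1.1

theorem continuousOn : ContinuousOn u (Set.Icc 0 1) := H.memH1.continuousOn zero_le_one

theorem half_le_potDensity : ∀ᵐ t, t ∈ Set.Icc (0 : ℝ) 1 → (∀ k, u t ≠ c k) ∧
    potDensity α m c ν u t = effectivePotential α m c ν (u t) + (-1) ∧
    1 / 2 ≤ potDensity α m c ν u t := by
  filter_upwards [ae_ne_of_potentialIntegral_ne_top H.alpha_pos H.mass_pos H.continuousOn H.finite]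
    with t ht h
  have h1 := H.pos (u t) (H.mem.2 t h) (ht h)
  have h2 := potDensity_of_ne (α := α) (m := m) (c := c) (ν := ν) (ht h) (by linarith)
  exact ⟨ht h, h2, by rw [h2]; exact h1⟩

theorem half_le_toReal : 1 / 2 ≤ (potentialIntegral α m c (-1) ν 0 1 u).toReal := by
  rw [toReal_potentialIntegral H.alpha_pos H.mass_pos zero_le_one H.continuousOn H.finite]
  have h1 : ∫ _ in (0 : ℝ)..1, (1 / 2 : ℝ) = 1 / 2 := by simp
  rw [← h1]
  refine intervalIntegral.integral_mono_ae_restrict zero_le_one (by simp)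
    (intervalIntegrable_potDensity H.alpha_pos H.mass_pos zero_le_one H.continuousOn H.finite) ?_
  refine (ae_restrict_iff' measurableSet_Icc).2 ?_
  filter_upwards [H.half_le_potDensity] with t ht h using (ht h).2.2

theorem frequency_eq : frequency α m c (-1) ν u =
    Real.sqrt (2 * (potentialIntegral α m c (-1) ν 0 1 u).toReal / kin 0 1 u) := by
  rw [frequency, H.memH1.kineticIntegral_eq zero_le_one, ENNReal.toReal_ofReal H.kin_pos.le]
  congr 1
  have := H.kin_pos
  field_simp

theorem frequency_pos : 0 < frequency α m c (-1) ν u := by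
  rw [H.frequency_eq]
  have := H.kin_pos
  have := H.half_le_toReal
  exact Real.sqrt_pos.2 (by positivity)

theorem frequency_sq_mul : frequency α m c (-1) ν u ^ 2 * kin 0 1 u =
    2 * (potentialIntegral α m c (-1) ν 0 1 u).toReal := by
  have h1 := H.kin_pos
  have := H.half_le_toReal
  rw [H.frequency_eq, Real.sq_sqrt (by positivity)]
  field_simp

theorem frequency_mul_sqrt : frequency α m c (-1) ν u * Real.sqrt (kin 0 1 u) =
    Real.sqrt 2 * Real.sqrt (potentialIntegral α m c (-1) ν 0 1 u).toReal := by
  rw [← Real.sqrt_mul zero_le_two, ← H.frequency_sq_mul, Real.sqrt_mul (sq_nonneg _),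
    Real.sqrt_sq H.frequency_pos.le]

/-- The Lagrangian action at the frequency of the minimizer is minimal as well. -/
theorem lagrangian_le (hv : v ∈ topBall c R p₁ p₂ l 0 1)
    (hP : potentialIntegral α m c (-1) ν 0 1 v ≠ ⊤) :
    let ω := frequency α m c (-1) ν u
    ω / 2 * kin 0 1 u + (potentialIntegral α m c (-1) ν 0 1 u).toReal / ω + ν * area 0 1 u ≤
      ω / 2 * kin 0 1 v + (potentialIntegral α m c (-1) ν 0 1 v).toReal / ω + ν * area 0 1 v := by
  intro ω
  have hω : 0 < ω := H.frequency_pos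
  have h1 := H.le v hv hP
  have h2 : ω * Real.sqrt (kin 0 1 u) = _ := H.frequency_mul_sqrt
  have h3 : ω ^ 2 * kin 0 1 u = _ := H.frequency_sq_mul
  unfold action at h1
  set K := kin 0 1 u
  set P := (potentialIntegral α m c (-1) ν 0 1 u).toReal
  set K' := kin 0 1 v
  set P' := (potentialIntegral α m c (-1) ν 0 1 v).toReal
  have e1 : Real.sqrt 2 * Real.sqrt K * Real.sqrt P = ω * K := by
    rw [mul_right_comm, ← h2, mul_assoc, Real.mul_self_sqrt H.kin_pos.le]
  have e2 : ω / 2 * K + P / ω = ω * K := by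
    field_simp
    linarith
  -- The arithmetic–geometric mean inequality; by the definition of `ω` it is an equality at `u`.
  have e3 : Real.sqrt 2 * Real.sqrt K' * Real.sqrt P' ≤ ω / 2 * K' + P' / ω := by
    have h4 : Real.sqrt K' ^ 2 = K' := Real.sq_sqrt (kin_nonneg zero_le_one)
    have h5 : Real.sqrt P' ^ 2 = P' := Real.sq_sqrt ENNReal.toReal_nonneg
    have h6 := Real.sq_sqrt (zero_le_two : (0 : ℝ) ≤ 2)
    rw [← sub_nonneg]
    have : ω / 2 * K' + P' / ω - Real.sqrt 2 * Real.sqrt K' * Real.sqrt P' =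
        (ω * Real.sqrt K' - Real.sqrt 2 * Real.sqrt P') ^ 2 / (2 * ω) := by
      rw [sub_sq, mul_pow, mul_pow, h4, h5, h6]
      field_simp
      ring
    rw [this]
    positivity
  rw [e2, ← e1]
  linarith

end IsActionMinimizer

theorem integral_eq_zero_of_forall {f : ℝ → ℝ} (hab : a ≤ b)
    (hf : IntervalIntegrable f volume a b) (h : ∀ s ∈ Set.Icc a b, ∫ t in a..s, f t = 0) :
    ∀ᵐ t, t ∈ Set.Icc a b → f t = 0 := by
  filter_upwards [hf.ae_hasDerivAt_integral, ae_ne a, ae_ne b] with t h2 ha hb ht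
  rw [Set.uIcc_of_le hab] at h2
  refine (h2 ht a (by simp [hab])).unique ((hasDerivAt_const t (0 : ℝ)).congr_of_eventuallyEq ?_)
  have : Set.Ioo a b ∈ 𝓝 t := Ioo_mem_nhds (lt_of_le_of_ne ht.1 ha.symm) (lt_of_le_of_ne ht.2 hb)
  filter_upwards [this] with s hs
  exact h s ⟨hs.1.le, hs.2.le⟩

/-- The piecewise affine change of time that maps `[0, s']` to `[0, s]` and `[s', 1]` to
`[s, 1]`. -/
def brokenTime (s s' : ℝ) : ℝ → ℝ := fun t =>
  if t ≤ s' then s / s' * t + 0 else (1 - s) / (1 - s') * t + (s - s') / (1 - s')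

section brokenTime

variable {s s' : ℝ}

theorem brokenTime_of_le {t : ℝ} (h : t ≤ s') : brokenTime s s' t = s / s' * t + 0 := if_pos h

theorem brokenTime_of_ge (hs : s' ∈ Set.Ioo (0 : ℝ) 1) {t : ℝ} (h : s' ≤ t) :
    brokenTime s s' t = (1 - s) / (1 - s') * t + (s - s') / (1 - s') := by
  have h0 : s' ≠ 0 := hs.1.ne'
  have h1 : 1 - s' ≠ 0 := by linarith [hs.2]
  rcases h.eq_or_lt with rfl | h
  · rw [brokenTime_of_le le_rfl]
    field_simp
    ring
  · exact if_neg h.not_ge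

/-- The three integrals of the reparametrized path: the kinetic and potential parts scale inversely
to each other on each piece, and the area does not depend on the parametrization. -/
theorem brokenTime_spec (hs : s ∈ Set.Ioo (0 : ℝ) 1) (hs' : s' ∈ Set.Ioo (0 : ℝ) 1)
    (hu : MemH1 0 1 u) (hP : potentialIntegral α m c (-1) ν 0 1 u ≠ ⊤) (hα : 0 < α)
    (hm : ∀ k, 0 < m k) :
    ContinuousOn (brokenTime s s') (Set.Icc 0 1) ∧
    Set.MapsTo (brokenTime s s') (Set.Icc 0 1) (Set.Icc 0 1) ∧
    brokenTime s s' 0 = 0 ∧ brokenTime s s' 1 = 1 ∧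
    MemH1 0 1 (fun t => u (brokenTime s s' t)) ∧
    potentialIntegral α m c (-1) ν 0 1 (fun t => u (brokenTime s s' t)) ≠ ⊤ ∧
    kin 0 1 (fun t => u (brokenTime s s' t)) =
      s / s' * kin 0 s u + (1 - s) / (1 - s') * kin s 1 u ∧
    (potentialIntegral α m c (-1) ν 0 1 (fun t => u (brokenTime s s' t))).toReal =
      s' / s * (∫ t in (0 : ℝ)..s, potDensity α m c ν u t) +
        (1 - s') / (1 - s) * ∫ t in s..1, potDensity α m c ν u t ∧
    area 0 1 (fun t => u (brokenTime s s' t)) = area 0 1 u := by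
  have hs0 := hs.1
  have hs1 : 0 < 1 - s := by linarith [hs.2]
  have hs0' := hs'.1
  have hs1' : 0 < 1 - s' := by linarith [hs'.2]
  set p := s / s' with hp
  set q := (1 - s) / (1 - s') with hq
  set r := (s - s') / (1 - s') with hr
  have hp0 : 0 < p := by positivity
  have hq0 : 0 < q := by positivity
  have e0 : p * 0 + 0 = 0 := by simp
  have e1 : p * s' + 0 = s := by rw [hp]; field_simp; simp
  have e2 : q * s' + r = s := by rw [hq, hr]; field_simp; ring
  have e3 : q * 1 + r = 1 := by rw [hq, hr]; field_simp; ring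
  set φ := brokenTime s s' with hφ
  have hφ1 : ∀ t ∈ Set.Icc 0 s', φ t = p * t + 0 := fun t ht => brokenTime_of_le ht.2
  have hφ2 : ∀ t ∈ Set.Icc s' 1, φ t = q * t + r := fun t ht => brokenTime_of_ge hs' ht.1
  have hmaps : Set.MapsTo φ (Set.Icc 0 1) (Set.Icc 0 1) := by
    intro t ht
    rcases le_total t s' with h | h
    · rw [hφ1 t ⟨ht.1, h⟩]
      have : p * t ≤ p * s' := mul_le_mul_of_nonneg_left h hp0.le
      have : 0 ≤ p * t := mul_nonneg hp0.le ht.1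
      constructor <;> linarith
    · rw [hφ2 t ⟨h, ht.2⟩]
      have : q * s' ≤ q * t := mul_le_mul_of_nonneg_left h hq0.le
      have : q * t ≤ q * 1 := mul_le_mul_of_nonneg_left ht.2 hq0.le
      constructor <;> linarith
  set w : ℝ → ℂ := fun t => u (φ t) with hw
  have hw1 : ∀ t ∈ Set.Icc 0 s', w t = u (p * t + 0) := fun t ht => by rw [hw]; simp only [hφ1 t ht]
  have hw2 : ∀ t ∈ Set.Icc s' 1, w t = u (q * t + r) := fun t ht => by rw [hw]; simp only [hφ2 t ht]
  obtain ⟨m1, d1⟩ := hu.comp_affine (c := 0) (d := s') (p := p) (q := 0) hp0 hs0'.le (by simp)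
    (by rw [e1]; linarith)
  obtain ⟨m2, d2⟩ := hu.comp_affine (c := s') (d := 1) (p := q) (q := r) hq0 hs'.2.le
    (by rw [e2]; linarith) (by rw [e3])
  have M1 : MemH1 0 s' w := m1.congr hs0'.le hw1
  have M2 : MemH1 s' 1 w := m2.congr hs'.2.le hw2
  have M : MemH1 0 1 w := M1.trans M2 hs0'.le hs'.2.le
  have P1 : potentialIntegral α m c (-1) ν 0 s' w ≠ ⊤ := by
    rw [potentialIntegral_congr hw1, potentialIntegral_comp_affine hp0, e0, e1]
    exact ENNReal.mul_ne_top ENNReal.ofReal_ne_top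
      (ne_top_of_le_ne_top hP (potentialIntegral_mono le_rfl hs.2.le))
  have P2 : potentialIntegral α m c (-1) ν s' 1 w ≠ ⊤ := by
    rw [potentialIntegral_congr hw2, potentialIntegral_comp_affine hq0, e2, e3]
    exact ENNReal.mul_ne_top ENNReal.ofReal_ne_top
      (ne_top_of_le_ne_top hP (potentialIntegral_mono hs.1.le le_rfl))
  have P := potentialIntegral_ne_top_of_split hs0'.le hs'.2.le P1 P2
  have D1 : ∀ᵐ t, t ∈ Set.Icc 0 s' → deriv w t = p * deriv u (p * t + 0) := by
    filter_upwards [ae_ne 0, ae_ne s'] with t h0 h1 ht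
    rw [MemH1.deriv_eq_of_eqOn (u := fun t => u (p * t + 0)) (s := 0) (t := s')
      (fun x hx => hw1 x ⟨hx.1.le, hx.2.le⟩)
      ⟨lt_of_le_of_ne ht.1 h0.symm, lt_of_le_of_ne ht.2 h1⟩, d1]
  have D2 : ∀ᵐ t, t ∈ Set.Icc s' 1 → deriv w t = q * deriv u (q * t + r) := by
    filter_upwards [ae_ne s', ae_ne 1] with t h0 h1 ht
    rw [MemH1.deriv_eq_of_eqOn (u := fun t => u (q * t + r)) (s := s') (t := 1)
      (fun x hx => hw2 x ⟨hx.1.le, hx.2.le⟩)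
      ⟨lt_of_le_of_ne ht.1 h0.symm, lt_of_le_of_ne ht.2 h1⟩, d2]
  have hcu := hu.continuousOn zero_le_one
  have hcw := M.continuousOn zero_le_one
  refine ⟨?_, hmaps, ?_, ?_, M, P, ?_, ?_, ?_⟩
  · have c1 : ContinuousOn φ (Set.Icc 0 s') :=
      (by fun_prop : ContinuousOn (fun t => p * t + 0) (Set.Icc 0 s')).congr hφ1
    have c2 : ContinuousOn φ (Set.Icc s' 1) :=
      (by fun_prop : ContinuousOn (fun t => q * t + r) (Set.Icc s' 1)).congr hφ2
    rw [← Set.Icc_union_Icc_eq_Icc hs0'.le hs'.2.le]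
    exact c1.union_of_isClosed c2 isClosed_Icc isClosed_Icc
  · rw [hφ1 0 (by simp [hs0'.le]), e0]
  · rw [hφ2 1 (by simp [hs'.2.le]), e3]
  · have i1 := (M.mono le_rfl hs0'.le hs'.2.le).1.intervalIntegrable_sq hs0'.le
    have i2 := (M.mono hs0'.le hs'.2.le le_rfl).1.intervalIntegrable_sq hs'.2.le
    have k1 : ∫ t in (0 : ℝ)..s', ‖deriv w t‖ ^ 2 = p * kin 0 s u := by
      rw [integral_congr_Icc (g := fun t => p ^ 2 * ‖deriv u (p * t + 0)‖ ^ 2) hs0'.le (by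
        filter_upwards [D1] with t h ht
        rw [h ht, norm_mul, mul_pow, Complex.norm_real, Real.norm_of_nonneg hp0.le]),
        intervalIntegral.integral_const_mul,
        intervalIntegral.integral_comp_mul_add (fun t => ‖deriv u t‖ ^ 2) hp0.ne' 0, e0, e1, kin,
        smul_eq_mul]
      field_simp
    have k2 : ∫ t in s'..1, ‖deriv w t‖ ^ 2 = q * kin s 1 u := by
      rw [integral_congr_Icc (g := fun t => q ^ 2 * ‖deriv u (q * t + r)‖ ^ 2) hs'.2.le (by
        filter_upwards [D2] with t h ht
        rw [h ht, norm_mul, mul_pow, Complex.norm_real, Real.norm_of_nonneg hq0.le]),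
        intervalIntegral.integral_const_mul,
        intervalIntegral.integral_comp_mul_add (fun t => ‖deriv u t‖ ^ 2) hq0.ne' r, e2, e3, kin,
        smul_eq_mul]
      field_simp
    rw [kin, ← intervalIntegral.integral_add_adjacent_intervals i1 i2, k1, k2]
  · have i := intervalIntegrable_potDensity hα hm zero_le_one hcw P
    have i1 := i.mono_set (c := 0) (d := s') (by
      rw [Set.uIcc_of_le zero_le_one, Set.uIcc_of_le hs0'.le]
      exact Set.Icc_subset_Icc le_rfl hs'.2.le)
    have i2 := i.mono_set (c := s') (d := 1) (by
      rw [Set.uIcc_of_le zero_le_one, Set.uIcc_of_le hs'.2.le]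
      exact Set.Icc_subset_Icc hs0'.le le_rfl)
    have k1 : ∫ t in (0 : ℝ)..s', potDensity α m c ν w t =
        s' / s * ∫ t in (0 : ℝ)..s, potDensity α m c ν u t := by
      rw [integral_congr_Icc (g := fun t => potDensity α m c ν u (p * t + 0)) hs0'.le
        (Eventually.of_forall fun t ht => by simp only [potDensity, hw1 t ht]),
        intervalIntegral.integral_comp_mul_add (potDensity α m c ν u) hp0.ne' 0, e0, e1,
        smul_eq_mul, hp, inv_div]
    have k2 : ∫ t in s'..1, potDensity α m c ν w t =
        (1 - s') / (1 - s) * ∫ t in s..1, potDensity α m c ν u t := by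
      rw [integral_congr_Icc (g := fun t => potDensity α m c ν u (q * t + r)) hs'.2.le
        (Eventually.of_forall fun t ht => by simp only [potDensity, hw2 t ht]),
        intervalIntegral.integral_comp_mul_add (potDensity α m c ν u) hq0.ne' r, e2, e3,
        smul_eq_mul, hq, inv_div]
    rw [toReal_potentialIntegral hα hm zero_le_one hcw P,
      ← intervalIntegral.integral_add_adjacent_intervals i1 i2, k1, k2]
  · have i := (M.continuousOn_I_mul zero_le_one).memLp_two.intervalIntegrable_inner zero_le_one M.1
    have j := (hu.continuousOn_I_mul zero_le_one).memLp_two.intervalIntegrable_inner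
      zero_le_one hu.1
    have sub : ∀ {x y : ℝ}, 0 ≤ x → x ≤ y → y ≤ 1 → Set.uIcc x y ⊆ Set.uIcc (0 : ℝ) 1 := by
      intro x y hx hxy hy
      rw [Set.uIcc_of_le zero_le_one, Set.uIcc_of_le hxy]
      exact Set.Icc_subset_Icc hx hy
    have k1 : ∫ t in (0 : ℝ)..s', inner ℝ (Complex.I * w t) (deriv w t) =
        ∫ t in (0 : ℝ)..s, inner ℝ (Complex.I * u t) (deriv u t) := by
      rw [integral_congr_Icc (g := fun t => p * inner ℝ (Complex.I * u (p * t + 0))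
        (deriv u (p * t + 0))) hs0'.le (by
        filter_upwards [D1] with t h ht
        rw [h ht, hw1 t ht, ← Complex.real_smul, inner_smul_right]),
        intervalIntegral.integral_const_mul, intervalIntegral.integral_comp_mul_add
          (fun t => inner ℝ (Complex.I * u t) (deriv u t)) hp0.ne' 0, e0, e1, smul_eq_mul]
      field_simp
    have k2 : ∫ t in s'..1, inner ℝ (Complex.I * w t) (deriv w t) =
        ∫ t in s..1, inner ℝ (Complex.I * u t) (deriv u t) := by
      rw [integral_congr_Icc (g := fun t => q * inner ℝ (Complex.I * u (q * t + r))
        (deriv u (q * t + r))) hs'.2.le (by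
        filter_upwards [D2] with t h ht
        rw [h ht, hw2 t ht, ← Complex.real_smul, inner_smul_right]),
        intervalIntegral.integral_const_mul, intervalIntegral.integral_comp_mul_add
          (fun t => inner ℝ (Complex.I * u t) (deriv u t)) hq0.ne' r, e2, e3, smul_eq_mul]
      field_simp
    rw [area, area, ← intervalIntegral.integral_add_adjacent_intervals
      (i.mono_set (sub le_rfl hs0'.le hs'.2.le)) (i.mono_set (sub hs0'.le hs'.2.le le_rfl)), k1, k2,
      intervalIntegral.integral_add_adjacent_intervals
      (j.mono_set (sub le_rfl hs0.le hs.2.le)) (j.mono_set (sub hs0.le hs.2.le le_rfl))]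

end brokenTime

/-- The image of the path is kept and the break point moved. Stationarity of the Lagrangian action
at `s' = s`, with the balance of the total integrals, gives the balance on `[0, s]` for every `s`,
and differentiation in `s` gives the pointwise identity. -/
theorem IsActionMinimizer.energy (H : IsActionMinimizer α m c ν R p₁ p₂ l u) :
    ∀ᵐ t, t ∈ Set.Icc (0 : ℝ) 1 →
      frequency α m c (-1) ν u ^ 2 * ‖deriv u t‖ ^ 2 =
        2 * (effectivePotential α m c ν (u t) + (-1)) := by
  set ω := frequency α m c (-1) ν u with hω
  have hω0 : 0 < ω := H.frequency_pos
  have iK := H.memH1.1.intervalIntegrable_sq zero_le_one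
  have iP := intervalIntegrable_potDensity H.alpha_pos H.mass_pos zero_le_one H.continuousOn H.finite
  have iF := (iK.const_mul (ω ^ 2)).sub (iP.const_mul 2)
  have sub : ∀ {x y : ℝ}, 0 ≤ x → x ≤ y → y ≤ 1 → Set.uIcc x y ⊆ Set.uIcc (0 : ℝ) 1 := by
    intro x y hx hxy hy
    rw [Set.uIcc_of_le zero_le_one, Set.uIcc_of_le hxy]
    exact Set.Icc_subset_Icc hx hy
  have htot : ω ^ 2 * kin 0 1 u = 2 * ∫ t in (0 : ℝ)..1, potDensity α m c ν u t := by
    rw [← toReal_potentialIntegral H.alpha_pos H.mass_pos zero_le_one H.continuousOn H.finite]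
    exact H.frequency_sq_mul
  have key : ∀ s ∈ Set.Ioo (0 : ℝ) 1,
      ω ^ 2 * kin 0 s u = 2 * ∫ t in (0 : ℝ)..s, potDensity α m c ν u t := by
    intro s hs
    have hs0 := hs.1
    have hs1 : 0 < 1 - s := by linarith [hs.2]
    set K₁ := kin 0 s u with hK₁
    set K₂ := kin s 1 u with hK₂
    set P₁ := ∫ t in (0 : ℝ)..s, potDensity α m c ν u t
    set P₂ := ∫ t in s..1, potDensity α m c ν u t
    have hK : K₁ + K₂ = kin 0 1 u := intervalIntegral.integral_add_adjacent_intervals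
      (iK.mono_set (sub le_rfl hs0.le hs.2.le)) (iK.mono_set (sub hs0.le hs.2.le le_rfl))
    have hP : P₁ + P₂ = ∫ t in (0 : ℝ)..1, potDensity α m c ν u t :=
      intervalIntegral.integral_add_adjacent_intervals
      (iP.mono_set (sub le_rfl hs0.le hs.2.le)) (iP.mono_set (sub hs0.le hs.2.le le_rfl))
    let f : ℝ → ℝ := fun x => ω / 2 * (s / x * K₁ + (1 - s) / (1 - x) * K₂) +
      (x / s * P₁ + (1 - x) / (1 - s) * P₂) / ω
    have hmin : IsLocalMin f s := by
      filter_upwards [Ioo_mem_nhds hs.1 hs.2] with x hx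
      obtain ⟨h1, h2, h3, h4, h5, h6, h7, h8, h9⟩ :=
        brokenTime_spec hs hx H.memH1 H.finite H.alpha_pos H.mass_pos
      have h10 := H.lagrangian_le (v := fun t => u (brokenTime s x t))
        ⟨comp_mem_topClass zero_le_one H.mem.1 h1 h2 h3 h4 h5, fun t ht => H.mem.2 _ (h2 ht)⟩ h6
      simp only [h7, h8, h9] at h10
      rw [toReal_potentialIntegral H.alpha_pos H.mass_pos zero_le_one H.continuousOn H.finite,
        ← hP, ← hK] at h10
      have e1 : f s = ω / 2 * (K₁ + K₂) + (P₁ + P₂) / ω := by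
        simp only [f]
        rw [div_self hs0.ne', div_self hs1.ne', one_mul, one_mul, one_mul, one_mul]
      rw [e1]
      exact le_of_add_le_add_right h10
    have hder : HasDerivAt f (ω / 2 * (-(s / s ^ 2) * K₁ + (1 - s) / (1 - s) ^ 2 * K₂) +
        (1 / s * P₁ + -1 / (1 - s) * P₂) / ω) s := by
      have d1 : HasDerivAt (fun x : ℝ => s / x) (-(s / s ^ 2)) s := by
        have := (hasDerivAt_const s s).fun_div (hasDerivAt_id s) hs0.ne'
        simpa [neg_div] using this
      have d2 : HasDerivAt (fun x : ℝ => (1 - s) / (1 - x)) ((1 - s) / (1 - s) ^ 2) s := by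
        have := (hasDerivAt_const s (1 - s)).fun_div ((hasDerivAt_id s).const_sub 1) hs1.ne'
        simpa using this
      have d3 : HasDerivAt (fun x : ℝ => x / s) (1 / s) s := (hasDerivAt_id s).div_const s
      have d4 : HasDerivAt (fun x : ℝ => (1 - x) / (1 - s)) (-1 / (1 - s)) s :=
        ((hasDerivAt_id s).const_sub 1).div_const (1 - s)
      exact (((d1.mul_const K₁).fun_add (d2.mul_const K₂)).const_mul (ω / 2)).fun_add
        (((d3.mul_const P₁).fun_add (d4.mul_const P₂)).div_const ω)
    have hzero := hmin.hasDerivAt_eq_zero hder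
    have e1 : ω ^ 2 * (K₁ + K₂) = 2 * (P₁ + P₂) := by rw [hK, hP, htot]
    have e2 : (1 - s) * (ω ^ 2 * K₁ - 2 * P₁) = s * (ω ^ 2 * K₂ - 2 * P₂) := by
      field_simp at hzero
      linear_combination -hzero
    linear_combination e2 + s * e1
  have hF : ∀ s ∈ Set.Icc (0 : ℝ) 1,
      ∫ t in (0 : ℝ)..s, (ω ^ 2 * ‖deriv u t‖ ^ 2 - 2 * potDensity α m c ν u t) = 0 := by
    intro s hs
    rw [intervalIntegral.integral_sub
      ((iK.const_mul _).mono_set (sub le_rfl hs.1 hs.2))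
      ((iP.const_mul _).mono_set (sub le_rfl hs.1 hs.2)), intervalIntegral.integral_const_mul,
      intervalIntegral.integral_const_mul, sub_eq_zero]
    rcases hs.1.eq_or_lt with h | h
    · simp [← h]
    rcases hs.2.eq_or_lt with h' | h'
    · rw [h']; exact htot
    · exact key s ⟨h, h'⟩
  filter_upwards [integral_eq_zero_of_forall zero_le_one iF hF, H.half_le_potDensity] with t h1 h2 ht
  rw [← (h2 ht).2.1]
  linarith [h1 ht]

end

section

/-! ### The first variation -/

variable {N : ℕ} {α : ℝ} {m : Fin N → ℝ} {c : Fin N → ℂ} {h ν R : ℝ} {a b : ℝ} {u v : ℝ → ℂ}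
  {p₁ p₂ : ℂ} {l : Fin N → ZMod 2}

theorem MemH1.memLp_mul_deriv (hu : MemH1 a b u) {f : ℝ → ℂ} (hf : ContinuousOn f (Set.Icc a b)) :
    MemLp (fun t => f t * deriv u t) 2 (volume.restrict (Set.Icc a b)) := by
  obtain ⟨B, hB⟩ := isCompact_Icc.exists_bound_of_continuousOn hf
  refine hu.1.of_le_mul (c := B) ((hf.aestronglyMeasurable measurableSet_Icc).mul hu.1.1) ?_
  refine (ae_restrict_iff' measurableSet_Icc).2 (Eventually.of_forall fun t ht => ?_)
  rw [norm_mul]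
  exact mul_le_mul_of_nonneg_right (hB t ht) (norm_nonneg _)

theorem MemH1.mul (hu : MemH1 a b u) (hv : MemH1 a b v) (hab : a ≤ b) :
    MemH1 a b (fun t => u t * v t) ∧ ∀ᵐ t, t ∈ Set.Icc a b →
      HasDerivAt (fun t => u t * v t) (v t * deriv u t + u t * deriv v t) t := by
  have hd : ∀ᵐ t, t ∈ Set.Icc a b →
      HasDerivAt (fun t => u t * v t) (v t * deriv u t + u t * deriv v t) t := by
    filter_upwards [hu.ae_hasDerivAt hab, hv.ae_hasDerivAt hab] with t h1 h2 ht
    have := (h1 ht).fun_mul (h2 ht)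
    rwa [mul_comm (deriv u t)] at this
  exact ⟨memH1_of_hasDerivAt hab ((hu.absolutelyContinuous hab).fun_smul (hv.absolutelyContinuous hab))
    ((hu.memLp_mul_deriv (hv.continuousOn hab)).add (hv.memLp_mul_deriv (hu.continuousOn hab))) hd, hd⟩

theorem MemH1.conj (hu : MemH1 a b u) (hab : a ≤ b) :
    MemH1 a b (fun t => (starRingEnd ℂ) (u t)) := by
  have hd : ∀ t, deriv (fun t => (starRingEnd ℂ) (u t)) t = (starRingEnd ℂ) (deriv u t) :=
    fun t => deriv.star
  refine ⟨?_, fun t ht => ?_⟩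
  · rw [funext hd]
    exact hu.1.congr_norm (Complex.continuous_conj.comp_aestronglyMeasurable hu.1.1)
      (Eventually.of_forall fun t => (RCLike.norm_conj _).symm)
  · simp_rw [hd]
    have h1 : IntervalIntegrable (deriv u) volume a t := (hu.intervalIntegrable hab).mono_set (by
      rw [Set.uIcc_of_le hab, Set.uIcc_of_le ht.1]; exact Set.Icc_subset_Icc le_rfl ht.2)
    have h2 := (Complex.conjCLE : ℂ →L[ℝ] ℂ).intervalIntegral_comp_comm h1
    simp only [ContinuousLinearEquiv.coe_coe, Complex.conjCLE_apply] at h2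
    rw [h2, ← map_add, ← hu.2 t ht]

/-- The inner product is the real part of `conj (u t) * v t`, so the product rule for `H¹` paths
gives integration by parts. -/
theorem MemH1.integral_inner (hu : MemH1 a b u) (hv : MemH1 a b v) (hab : a ≤ b) :
    ∫ t in a..b, (inner ℝ (deriv u t) (v t) + inner ℝ (u t) (deriv v t)) =
      inner ℝ (u b) (v b) - inner ℝ (u a) (v a) := by
  obtain ⟨h1, h2⟩ := hv.mul (hu.conj hab) hab
  have h3 := h1.sub_eq_integral le_rfl hab le_rfl
  have h4 := congrArg Complex.reCLM h3
  rw [← Complex.reCLM.intervalIntegral_comp_comm (h1.intervalIntegrable hab)] at h4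
  simp only [Complex.reCLM_apply, Complex.sub_re] at h4
  simp only [Complex.inner]
  refine Eq.trans (integral_congr_Icc hab ?_) h4.symm
  filter_upwards [h2] with t ht hab
  have hd : deriv (fun t => (starRingEnd ℂ) (u t)) t = (starRingEnd ℂ) (deriv u t) := deriv.star
  rw [(ht hab).deriv, hd, Complex.add_re, mul_comm (deriv v t), add_comm]

theorem inner_I_mul_left (x y : ℂ) : inner ℝ (Complex.I * x) y = -inner ℝ x (Complex.I * y) := by
  simp [Complex.inner]
  ring

theorem inner_I_mul_comm (x y : ℂ) : inner ℝ (Complex.I * x) y = -inner ℝ (Complex.I * y) x := by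
  rw [inner_I_mul_left, real_inner_comm]

/-- The derivative of the area in a direction `v` that vanishes at the ends. -/
theorem MemH1.integral_inner_I_mul (hu : MemH1 a b u) (hv : MemH1 a b v) (hab : a ≤ b)
    (ha : v a = 0) (hb : v b = 0) :
    ∫ t in a..b, inner ℝ (Complex.I * u t) (deriv v t) =
      ∫ t in a..b, inner ℝ (Complex.I * v t) (deriv u t) := by
  have hI : MemH1 a b (fun t => Complex.I * u t) := ((memH1_const hab Complex.I).mul hu hab).1
  have hd : ∀ t, deriv (fun t => Complex.I * u t) t = Complex.I * deriv u t := fun t => by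
    rw [deriv_const_mul_field]
  have h1 := hI.integral_inner hv hab
  rw [ha, hb, inner_zero_right, inner_zero_right, sub_zero] at h1
  have i1 : IntervalIntegrable (fun t => inner ℝ (deriv (fun t => Complex.I * u t) t) (v t)) volume
      a b := hI.1.intervalIntegrable_inner hab (hv.continuousOn hab).memLp_two
  have i2 : IntervalIntegrable (fun t => inner ℝ (Complex.I * u t) (deriv v t)) volume a b :=
    (hI.continuousOn hab).memLp_two.intervalIntegrable_inner hab hv.1
  rw [intervalIntegral.integral_add i1 i2, add_comm, add_eq_zero_iff_eq_neg] at h1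
  rw [h1, ← intervalIntegral.integral_neg]
  refine intervalIntegral.integral_congr fun t _ => ?_
  simp only [hd]
  rw [inner_I_mul_comm, neg_neg]

/-- The difference of densities vanishes off `[s, t]`. Stated for differences, this needs no
integrability and serves kinetic, area and potential densities alike. -/
theorem integral_splice_sub {s t : ℝ} {w : ℝ → ℂ} (has : a ≤ s) (hst : s ≤ t) (htb : t ≤ b)
    (hs : w s = u s) (ht : w t = u t) (L : ℂ → ℂ → ℝ) :
    ∫ x in a..b, (L (splice s t u w x) (deriv (splice s t u w) x) - L (u x) (deriv u x)) =
      ∫ x in s..t, (L (w x) (deriv w x) - L (u x) (deriv u x)) := by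
  rw [integral_congr_Icc (g := (Set.Icc s t).indicator
    fun x => L (w x) (deriv w x) - L (u x) (deriv u x)) (has.trans (hst.trans htb)) (by
      filter_upwards [deriv_splice hs ht] with x hx _
      rw [hx]
      by_cases h : x ∈ Set.Icc s t
      · rw [splice_of_mem h, if_pos h, Set.indicator_of_mem h]
      · rw [splice_of_notMem (fun h' => h ⟨h'.1.le, h'.2.le⟩) hs ht, if_neg h,
          Set.indicator_of_notMem h, sub_self]),
    ← setIntegral_Icc_eq (has.trans (hst.trans htb)), setIntegral_indicator measurableSet_Icc,
    Set.inter_eq_right.2 (Set.Icc_subset_Icc has htb), setIntegral_Icc_eq hst]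

/-- A closed thickening of the compact arc gives one compact set, free of centres, that contains all
small variations. -/
theorem exists_neighbourhood_avoiding (hu : ContinuousOn u (Set.Icc a b))
    (hne : ∀ t ∈ Set.Icc a b, ∀ k, u t ≠ c k) :
    ∃ δ > 0, ∃ K : Set ℂ, IsCompact K ∧ (∀ y ∈ K, ∀ k, y ≠ c k) ∧
      ∀ t ∈ Set.Icc a b, ∀ y, ‖y - u t‖ < δ → y ∈ K := by
  have hK : IsCompact (u '' Set.Icc a b) := isCompact_Icc.image_of_continuousOn hu
  have hsub : u '' Set.Icc a b ⊆ (Set.range c)ᶜ := by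
    rintro _ ⟨t, ht, rfl⟩ ⟨k, hk⟩
    exact hne t ht k hk.symm
  obtain ⟨δ, hδ, h⟩ := hK.exists_cthickening_subset_open
    (Set.finite_range c).isClosed.isOpen_compl hsub
  refine ⟨δ, hδ, _, hK.cthickening, fun y hy k hk => h hy ⟨k, hk.symm⟩, fun t ht y hy => ?_⟩
  refine Metric.mem_cthickening_of_dist_le y (u t) δ _ ⟨t, ht, rfl⟩ ?_
  rw [dist_eq_norm]
  exact hy.le

theorem hasDerivAt_integral_effectivePotential (hα : 0 < α) (hab : a ≤ b)
    (hu : ContinuousOn u (Set.Icc a b)) (hne : ∀ t ∈ Set.Icc a b, ∀ k, u t ≠ c k) {φ : ℝ → ℂ}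
    (hφ : ContinuousOn φ (Set.Icc a b)) :
    HasDerivAt (fun s : ℝ => ∫ t in a..b, effectivePotential α m c ν (u t + s * φ t))
      (∫ t in a..b, inner ℝ (potentialGradient α m c ν (u t)) (φ t)) 0 := by
  obtain ⟨δ, hδ, K, hK, hKc, hKδ⟩ := exists_neighbourhood_avoiding hu hne
  obtain ⟨B, hB⟩ := hK.exists_bound_of_continuousOn (f := potentialGradient α m c ν)
    fun y hy => (continuousAt_potentialGradient (hKc y hy)).continuousWithinAt
  obtain ⟨D, hD⟩ := isCompact_Icc.exists_bound_of_continuousOn hφ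
  have hmem : ∀ s ∈ Metric.ball (0 : ℝ) (δ / (|D| + 1)), ∀ t ∈ Set.Icc a b,
      u t + s * φ t ∈ K := by
    intro s hs t ht
    refine hKδ t ht _ ?_
    rw [add_sub_cancel_left, norm_mul, Complex.norm_real]
    rw [mem_ball_zero_iff, lt_div_iff₀ (by positivity)] at hs
    have h1 : ‖φ t‖ ≤ |D| + 1 := (hD t ht).trans ((le_abs_self D).trans (by linarith))
    exact (mul_le_mul_of_nonneg_left h1 (norm_nonneg s)).trans_lt hs
  have hcont : ∀ s ∈ Metric.ball (0 : ℝ) (δ / (|D| + 1)),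
      ContinuousOn (fun t => effectivePotential α m c ν (u t + s * φ t)) (Set.Icc a b) :=
    fun s hs t ht => (continuousAt_effectivePotential hα.ne'
      (hKc _ (hmem s hs t ht))).comp_continuousWithinAt
        (f := fun t => u t + s * φ t) ((hu.add (continuousOn_const.mul hφ)) t ht)
  have hball : Metric.ball (0 : ℝ) (δ / (|D| + 1)) ∈ 𝓝 (0 : ℝ) := Metric.ball_mem_nhds _ (by positivity)
  have hsub : Set.uIoc a b ⊆ Set.Icc a b := by
    rw [Set.uIoc_of_le hab]; exact Set.Ioc_subset_Icc_self
  have h0 : (0 : ℝ) ∈ Metric.ball (0 : ℝ) (δ / (|D| + 1)) := mem_of_mem_nhds hball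
  have hgrad : ContinuousOn (fun t => inner ℝ (potentialGradient α m c ν (u t + (0 : ℝ) * φ t)) (φ t))
      (Set.Icc a b) := by
    refine ContinuousOn.inner (fun t ht => ?_) hφ
    exact (continuousAt_potentialGradient (hKc _ (hmem 0 h0 t ht))).comp_continuousWithinAt
      (f := fun t => u t + (0 : ℝ) * φ t) ((hu.add (continuousOn_const.mul hφ)) t ht)
  have := (intervalIntegral.hasDerivAt_integral_of_dominated_loc_of_deriv_le (μ := volume)
    (F := fun (s t : ℝ) => effectivePotential α m c ν (u t + s * φ t)) (x₀ := 0)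
    (F' := fun (s t : ℝ) => inner ℝ (potentialGradient α m c ν (u t + s * φ t)) (φ t))
    (bound := fun _ => B * D) (a := a) (b := b) hball ?_ ?_ ?_ ?_ (by simp) ?_).2
  · simpa using this
  · filter_upwards [hball] with s hs
    exact ((hcont s hs).mono hsub).aestronglyMeasurable measurableSet_uIoc
  · refine ContinuousOn.intervalIntegrable ?_
    rw [Set.uIcc_of_le hab]
    exact hcont 0 h0
  · exact (hgrad.mono hsub).aestronglyMeasurable measurableSet_uIoc
  · refine Eventually.of_forall fun t ht s hs => ?_
    refine (norm_inner_le_norm _ _).trans ?_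
    have h1 := hB _ (hmem s hs t (hsub ht))
    exact mul_le_mul h1 (hD t (hsub ht)) (norm_nonneg _) ((norm_nonneg _).trans h1)
  · refine Eventually.of_forall fun t ht s hs => ?_
    have h1 := (hasGradientAt_effectivePotential (α := α) (m := m) (ν := ν) hα.ne'
      (hKc _ (hmem s hs t (hsub ht)))).hasFDerivAt
    have h2 : HasDerivAt (fun s : ℝ => u t + s * φ t) (φ t) s := by
      simpa using ((Complex.ofRealCLM.hasDerivAt (x := s)).mul_const (φ t)).const_add (u t)
    exact h1.comp_hasDerivAt s h2

theorem nonneg_of_hasDerivAt {f : ℝ → ℝ} {f' s₀ : ℝ} (hf : HasDerivAt f f' 0) (hs₀ : 0 < s₀)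
    (h : ∀ s ∈ Set.Ioo 0 s₀, f 0 ≤ f s) : 0 ≤ f' := by
  have h1 := (hasDerivAt_iff_tendsto_slope.1 hf).mono_left
    (nhdsWithin_mono 0 (fun x (hx : x ∈ Set.Ioi 0) => (ne_of_gt hx : x ≠ 0)))
  refine ge_of_tendsto h1 ?_
  filter_upwards [Ioo_mem_nhdsGT hs₀] with s hs
  rw [slope_def_field, sub_zero]
  exact div_nonneg (sub_nonneg.2 (h s hs)) hs.1.le

/-- The variation of `u` by `s φ` on `[a, b]`. -/
def variation (a b : ℝ) (u φ : ℝ → ℂ) (s : ℝ) : ℝ → ℂ := splice a b u (fun t => u t + s * φ t)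

section variation

variable {φ : ℝ → ℂ}

theorem variation_facts (hu : MemH1 0 1 u) (ha : 0 ≤ a) (hab : a ≤ b) (hb : b ≤ 1)
    (hφ : MemH1 a b φ) (hφa : φ a = 0) (hφb : φ b = 0) (s : ℝ) :
    MemH1 0 1 (variation a b u φ s) ∧
    (∀ t ∈ Set.Icc a b, variation a b u φ s t = u t + s * φ t) ∧
    (∀ t, t ∉ Set.Ioo a b → variation a b u φ s t = u t) ∧
    kin 0 1 (variation a b u φ s) = kin 0 1 u +
      s * (2 * ∫ t in a..b, inner ℝ (deriv u t) (deriv φ t)) + s ^ 2 * kin a b φ ∧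
    area 0 1 (variation a b u φ s) = area 0 1 u +
      s * (2 * ∫ t in a..b, inner ℝ (Complex.I * φ t) (deriv u t)) + s ^ 2 * area a b φ := by
  have hua := hu.mono ha hab hb
  obtain ⟨h1, h1d⟩ := hφ.const_smul hab s
  obtain ⟨h2, h2d⟩ := hua.add h1 hab
  have hwa : u a + s * φ a = u a := by simp [hφa]
  have hwb : u b + s * φ b = u b := by simp [hφb]
  have hM := memH1_splice ha hab hb hu h2 hwa hwb
  have hd : ∀ᵐ t, t ∈ Set.Icc a b →
      deriv (fun t => u t + s * φ t) t = deriv u t + s * deriv φ t := by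
    filter_upwards [h1d, h2d] with t h3 h4 ht
    rw [(h4 ht).deriv, (h3 ht).deriv]
  have kK := integral_splice_sub (u := u) (w := fun t => u t + s * φ t) ha hab hb hwa hwb
    (fun _ y => ‖y‖ ^ 2)
  have kA := integral_splice_sub (u := u) (w := fun t => u t + s * φ t) ha hab hb hwa hwb
    (fun x y => inner ℝ (Complex.I * x) y)
  have cu := (hua.continuousOn_I_mul hab).memLp_two
  have cφ := (hφ.continuousOn_I_mul hab).memLp_two
  refine ⟨hM, fun t ht => splice_of_mem ht, fun t ht => splice_of_notMem ht hwa hwb, ?_, ?_⟩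
  · rw [intervalIntegral.integral_sub (hM.1.intervalIntegrable_sq zero_le_one)
      (hu.1.intervalIntegrable_sq zero_le_one)] at kK
    have e : ∫ t in a..b, (‖deriv (fun t => u t + s * φ t) t‖ ^ 2 - ‖deriv u t‖ ^ 2) =
        s * (2 * ∫ t in a..b, inner ℝ (deriv u t) (deriv φ t)) + s ^ 2 * kin a b φ := by
      rw [kin, ← intervalIntegral.integral_const_mul, ← intervalIntegral.integral_const_mul,
        ← intervalIntegral.integral_const_mul, ← intervalIntegral.integral_add
        (((hua.1.intervalIntegrable_inner hab hφ.1).const_mul _).const_mul _)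
        ((hφ.1.intervalIntegrable_sq hab).const_mul _)]
      refine integral_congr_Icc hab ?_
      filter_upwards [hd] with t ht hab
      rw [ht hab, norm_add_sq_real, ← Complex.real_smul, inner_smul_right, norm_smul, mul_pow,
        Real.norm_eq_abs, sq_abs]
      ring
    rw [e] at kK
    unfold kin variation
    unfold kin at kK
    linarith
  · rw [intervalIntegral.integral_sub
      ((hM.continuousOn_I_mul zero_le_one).memLp_two.intervalIntegrable_inner zero_le_one hM.1)
      ((hu.continuousOn_I_mul zero_le_one).memLp_two.intervalIntegrable_inner zero_le_one hu.1)]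
      at kA
    have i1 := cu.intervalIntegrable_inner hab hφ.1
    have i2 := cφ.intervalIntegrable_inner hab hua.1
    have i3 := cφ.intervalIntegrable_inner hab hφ.1
    have e : ∫ t in a..b, (inner ℝ (Complex.I * (u t + s * φ t)) (deriv (fun t => u t + s * φ t) t) -
        inner ℝ (Complex.I * u t) (deriv u t)) =
        s * (2 * ∫ t in a..b, inner ℝ (Complex.I * φ t) (deriv u t)) + s ^ 2 * area a b φ := by
      have e1 := hua.integral_inner_I_mul hφ hab hφa hφb
      have e2 : s * (2 * ∫ t in a..b, inner ℝ (Complex.I * φ t) (deriv u t)) =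
          s * (∫ t in a..b, inner ℝ (Complex.I * u t) (deriv φ t)) +
          s * ∫ t in a..b, inner ℝ (Complex.I * φ t) (deriv u t) := by rw [e1]; ring
      rw [e2, area, ← intervalIntegral.integral_const_mul, ← intervalIntegral.integral_const_mul,
        ← intervalIntegral.integral_const_mul, ← intervalIntegral.integral_add (i1.const_mul _)
        (i2.const_mul _), ← intervalIntegral.integral_add ((i1.const_mul _).add (i2.const_mul _))
        (i3.const_mul _)]
      refine integral_congr_Icc hab ?_
      filter_upwards [hd] with t ht hab
      rw [ht hab, ← Complex.real_smul, ← Complex.real_smul, mul_add, mul_smul_comm, inner_add_left,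
        inner_add_right, inner_add_right, inner_smul_left, inner_smul_right, inner_smul_left,
        inner_smul_right]
      simp only [RCLike.conj_to_real]
      ring
    rw [e] at kA
    unfold area variation
    unfold area at kA
    linarith

end variation

namespace IsActionMinimizer

variable {φ : ℝ → ℂ}

/-- The varied arc stays nearer to `u` than any centre is, so it creates no collision and changes no
winding number. The collisions of `u` lie off the arc and are kept. -/
theorem variation_mem (H : IsActionMinimizer α m c ν R p₁ p₂ l u) (hp : ‖p₁‖ = ‖p₂‖) (ha : 0 ≤ a)
    (hab : a ≤ b) (hb : b ≤ 1) (hne : ∀ t ∈ Set.Icc a b, ∀ k, u t ≠ c k) (hφ : MemH1 a b φ)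
    (hφa : φ a = 0) (hφb : φ b = 0) {s₀ : ℝ} (hs₀ : 0 < s₀)
    (hball : ∀ s ∈ Set.Ioo 0 s₀, ∀ t ∈ Set.Icc a b, ‖u t + (s : ℂ) * φ t‖ ≤ R) :
    ∃ s₁ > 0, ∀ s ∈ Set.Ioo 0 s₁, variation a b u φ s ∈ topBall c R p₁ p₂ l 0 1 ∧
      potentialIntegral α m c (-1) ν 0 1 (variation a b u φ s) ≠ ⊤ ∧
      (potentialIntegral α m c (-1) ν 0 1 (variation a b u φ s)).toReal =
        (potentialIntegral α m c (-1) ν 0 1 u).toReal +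
        ((∫ t in a..b, effectivePotential α m c ν (u t + s * φ t)) -
          ∫ t in a..b, effectivePotential α m c ν (u t)) := by
  have hu := H.memH1
  have hua := hu.mono ha hab hb
  have hcu := hua.continuousOn hab
  have hcφ := hφ.continuousOn hab
  obtain ⟨δ, hδ, K, hK, hKc, hKδ⟩ := exists_neighbourhood_avoiding hcu hne
  obtain ⟨D, hD⟩ := isCompact_Icc.exists_bound_of_continuousOn hcφ
  refine ⟨min s₀ (δ / (|D| + 1)), by positivity, fun s hs => ?_⟩
  have hsD : ∀ t ∈ Set.Icc a b, ‖(s : ℂ) * φ t‖ < δ := by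
    intro t ht
    rw [norm_mul, Complex.norm_real, Real.norm_of_nonneg hs.1.le]
    have h1 : ‖φ t‖ ≤ |D| + 1 := (hD t ht).trans ((le_abs_self D).trans (by linarith))
    have h2 := (lt_div_iff₀ (by positivity)).1 (hs.2.trans_le (min_le_right _ _))
    exact (mul_le_mul_of_nonneg_left h1 hs.1.le).trans_lt h2
  have hmem : ∀ t ∈ Set.Icc a b, u t + s * φ t ∈ K := fun t ht =>
    hKδ t ht _ (by rw [add_sub_cancel_left]; exact hsD t ht)
  have hfar : ∀ t ∈ Set.Icc a b, ∀ k, δ ≤ ‖u t - c k‖ := by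
    intro t ht k
    by_contra hlt
    rw [not_le, norm_sub_rev] at hlt
    exact hKc _ (hKδ t ht _ hlt) k rfl
  obtain ⟨hM, hin, hout, -, -⟩ := variation_facts hu ha hab hb hφ hφa hφb s
  set v := variation a b u φ s with hv
  have hvR : ∀ t ∈ Set.Icc a b, ‖v t‖ ≤ R := fun t ht => by
    rw [hin t ht]; exact hball s ⟨hs.1, hs.2.trans_le (min_le_left _ _)⟩ t ht
  have hcv := hM.continuousOn zero_le_one
  have hv0 : v 0 = u 0 := hout 0 (fun h => by linarith [h.1])
  have hv1 : v 1 = u 1 := hout 1 (fun h => by linarith [h.2])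
  have hcw : ContinuousOn (fun t => effectivePotential α m c ν (v t)) (Set.Icc a b) := by
    intro t ht
    have : v t ∈ K := by rw [hin t ht]; exact hmem t ht
    exact (continuousAt_effectivePotential H.alpha_pos.ne' (hKc _ this)).comp_continuousWithinAt
      ((hcv t ⟨ha.trans ht.1, ht.2.trans hb⟩).mono (Set.Icc_subset_Icc ha hb))
  have hcw' : ContinuousOn (fun t => effectivePotential α m c ν (u t)) (Set.Icc a b) := fun t ht =>
    (continuousAt_effectivePotential H.alpha_pos.ne' (hne t ht)).comp_continuousWithinAt (hcu t ht)
  have hvne : ∀ t ∈ Set.Icc a b, ∀ k, v t ≠ c k := fun t ht =>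
    hKc _ (by rw [hin t ht]; exact hmem t ht)
  have e1 : ∀ t ∈ Set.Icc 0 a, v t = u t := fun t ht => hout t fun h => by linarith [h.1, ht.2]
  have e2 : ∀ t ∈ Set.Icc b 1, v t = u t := fun t ht => hout t fun h => by linarith [h.2, ht.1]
  have P1 : potentialIntegral α m c (-1) ν 0 a v ≠ ⊤ := by
    rw [potentialIntegral_congr e1]
    exact ne_top_of_le_ne_top H.finite (potentialIntegral_mono le_rfl (hab.trans hb))
  have P2 : potentialIntegral α m c (-1) ν b 1 v ≠ ⊤ := by
    rw [potentialIntegral_congr e2]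
    exact ne_top_of_le_ne_top H.finite (potentialIntegral_mono (ha.trans hab) le_rfl)
  have P3 : potentialIntegral α m c (-1) ν a b v ≠ ⊤ := by
    obtain ⟨B, hB⟩ := isCompact_Icc.exists_bound_of_continuousOn hcw
    refine ne_top_of_le_ne_top ?_ (setLIntegral_mono' (g := fun _ => ENNReal.ofReal (B + (-1)))
      measurableSet_Icc fun t ht => ?_)
    · simp [ENNReal.mul_eq_top]
    · rw [extendedPotential_of_ne (hvne t ht)]
      have := (le_abs_self _).trans (hB t ht)
      exact ENNReal.ofReal_le_ofReal (by linarith)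
  have P : potentialIntegral α m c (-1) ν 0 1 v ≠ ⊤ :=
    potentialIntegral_ne_top_of_split ha (hab.trans hb) P1
      (potentialIntegral_ne_top_of_split hab hb P3 P2)
  refine ⟨⟨⟨hM, by rw [hv0]; exact H.mem.1.2.1, by rw [hv1]; exact H.mem.1.2.2.1, fun j => ?_⟩,
    fun t ht => ?_⟩, P, ?_⟩
  · rcases H.mem.1.2.2.2 j with ⟨t, ht, htj⟩ | ⟨n, hn, hnl⟩
    · refine Or.inl ⟨t, ht, ?_⟩
      rw [hout t fun h => hne t ⟨h.1.le, h.2.le⟩ j htj, htj]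
    · by_cases hhit : ∃ t ∈ Set.Icc (0 : ℝ) 1, u t = c j
      · obtain ⟨t, ht, htj⟩ := hhit
        refine Or.inl ⟨t, ht, ?_⟩
        rw [hout t fun h => hne t ⟨h.1.le, h.2.le⟩ j htj, htj]
      · push Not at hhit
        refine Or.inr ⟨n, hasWindingNumber_closedUp_of_near zero_le_one H.continuousOn hcv hv1
          (closedUp_closes' hp H.mem.1.2.1 H.mem.1.2.2.1) ?_ (fun t ht => ?_) hn, hnl⟩
        · rw [closedUp_closes' hp (hv0.trans H.mem.1.2.1) (hv1.trans H.mem.1.2.2.1)]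
        · by_cases htab : t ∈ Set.Icc a b
          · rw [hin t htab, add_sub_cancel_left]
            exact (hsD t htab).trans_le (hfar t htab j)
          · rw [hout t fun h => htab ⟨h.1.le, h.2.le⟩, sub_self, norm_zero, norm_pos_iff, sub_ne_zero]
            exact hhit t ht
  · by_cases htab : t ∈ Set.Icc a b
    · exact hvR t htab
    · rw [hout t fun h => htab ⟨h.1.le, h.2.le⟩]
      exact H.mem.2 t ht
  · have i1 := intervalIntegrable_potDensity H.alpha_pos H.mass_pos zero_le_one hcv P
    have i2 := intervalIntegrable_potDensity H.alpha_pos H.mass_pos zero_le_one H.continuousOn H.finite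
    rw [toReal_potentialIntegral H.alpha_pos H.mass_pos zero_le_one hcv P,
      toReal_potentialIntegral H.alpha_pos H.mass_pos zero_le_one H.continuousOn H.finite,
      ← sub_eq_iff_eq_add', ← intervalIntegral.integral_sub i1 i2]
    have k := integral_splice_sub (u := u) (w := fun t => u t + s * φ t) ha hab hb
      (by simp [hφa]) (by simp [hφb]) (fun x _ => (extendedPotential α m c (-1) ν x).toReal)
    refine k.trans ?_
    rw [← intervalIntegral.integral_sub]
    · refine integral_congr_Icc hab (Eventually.of_forall fun t ht => ?_)
      have q1 := H.pos (v t) (hvR t ht) (hvne t ht)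
      have q2 := H.pos (u t) (H.mem.2 t ⟨ha.trans ht.1, ht.2.trans hb⟩) (hne t ht)
      have r1 := potDensity_of_ne (hvne t ht) (by linarith)
      have r2 := potDensity_of_ne (hne t ht) (by linarith)
      unfold potDensity at r1 r2
      rw [hin t ht] at r1
      rw [r1, r2]
      ring
    · refine ContinuousOn.intervalIntegrable ?_
      rw [Set.uIcc_of_le hab]
      exact hcw.congr fun t ht => by simp only [hin t ht]
    · refine ContinuousOn.intervalIntegrable ?_
      rw [Set.uIcc_of_le hab]
      exact hcw'

/-- Only positive `s` is allowed, since `u` may touch the boundary circle; hence an inequality. The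
Lagrangian form avoids differentiating the square roots of the action. -/
theorem first_variation (H : IsActionMinimizer α m c ν R p₁ p₂ l u) (hp : ‖p₁‖ = ‖p₂‖) (ha : 0 ≤ a)
    (hab : a ≤ b) (hb : b ≤ 1) (hne : ∀ t ∈ Set.Icc a b, ∀ k, u t ≠ c k) (hφ : MemH1 a b φ)
    (hφa : φ a = 0) (hφb : φ b = 0) {s₀ : ℝ} (hs₀ : 0 < s₀)
    (hball : ∀ s ∈ Set.Ioo 0 s₀, ∀ t ∈ Set.Icc a b, ‖u t + (s : ℂ) * φ t‖ ≤ R) :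
    let ω := frequency α m c (-1) ν u
    0 ≤ ω * (∫ t in a..b, inner ℝ (deriv u t) (deriv φ t)) +
      (∫ t in a..b, inner ℝ (potentialGradient α m c ν (u t)) (φ t)) / ω +
      2 * ν * ∫ t in a..b, inner ℝ (Complex.I * φ t) (deriv u t) := by
  intro ω
  obtain ⟨s₁, hs₁, hmem⟩ := H.variation_mem hp ha hab hb hne hφ hφa hφb hs₀ hball
  set A := ∫ t in a..b, inner ℝ (deriv u t) (deriv φ t)
  set G := ∫ t in a..b, inner ℝ (potentialGradient α m c ν (u t)) (φ t)
  set C := ∫ t in a..b, inner ℝ (Complex.I * φ t) (deriv u t)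
  let V : ℝ → ℝ := fun s => ∫ t in a..b, effectivePotential α m c ν (u t + s * φ t)
  let f : ℝ → ℝ := fun s => ω / 2 * (s * (2 * A) + s ^ 2 * kin a b φ) + V s / ω +
    ν * (s * (2 * C) + s ^ 2 * area a b φ)
  have hV : HasDerivAt V G 0 := hasDerivAt_integral_effectivePotential H.alpha_pos hab
    ((H.memH1.mono ha hab hb).continuousOn hab) hne (hφ.continuousOn hab)
  have hq : ∀ x y : ℝ, HasDerivAt (fun s : ℝ => s * x + s ^ 2 * y) x 0 := fun x y => by
    simpa using ((hasDerivAt_id (0 : ℝ)).mul_const x).fun_add (((hasDerivAt_id (0 : ℝ)).pow 2).mul_const y)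
  have hf : HasDerivAt f (ω / 2 * (2 * A) + G / ω + ν * (2 * C)) 0 :=
    (((hq _ _).const_mul _).fun_add (hV.div_const ω)).fun_add ((hq _ _).const_mul _)
  have h1 := nonneg_of_hasDerivAt hf hs₁ fun s hs => by
    obtain ⟨h1, h2, h3⟩ := hmem s hs
    obtain ⟨-, -, -, h4, h5⟩ := variation_facts H.memH1 ha hab hb hφ hφa hφb s
    have h6 := H.lagrangian_le h1 h2
    have hV0 : V 0 = ∫ t in a..b, effectivePotential α m c ν (u t) := by simp [V]
    rw [h3, h4, h5, ← hV0] at h6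
    change ω / 2 * kin 0 1 u + (potentialIntegral α m c (-1) ν 0 1 u).toReal / ω + ν * area 0 1 u ≤
      ω / 2 * (kin 0 1 u + s * (2 * A) + s ^ 2 * kin a b φ) +
      ((potentialIntegral α m c (-1) ν 0 1 u).toReal + (V s - V 0)) / ω +
      ν * (area 0 1 u + s * (2 * C) + s ^ 2 * area a b φ) at h6
    have h7 : f 0 = V 0 / ω := by simp [f]
    rw [h7]
    simp only [f]
    rw [add_div, sub_div] at h6
    linarith
  linarith

end IsActionMinimizer

end

section

/-! ### Contractions towards a point: collisions and contacts with the boundary -/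

variable {N : ℕ} {α : ℝ} {m : Fin N → ℝ} {c : Fin N → ℂ} {h ν R : ℝ} {a b : ℝ} {u v : ℝ → ℂ}
  {p₁ p₂ : ℂ} {l : Fin N → ZMod 2}

/-- The piecewise affine function with values `0, 1, 0` at `a, t₀, b`. -/
def tent (a t₀ b : ℝ) : ℝ → ℝ := fun t =>
  if t ≤ t₀ then 1 / (t₀ - a) * t + -a / (t₀ - a) else -1 / (b - t₀) * t + b / (b - t₀)

section tent

variable {t₀ t : ℝ}

theorem tent_of_le (ht : t ≤ t₀) : tent a t₀ b t = 1 / (t₀ - a) * t + -a / (t₀ - a) := if_pos ht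

theorem tent_of_ge (ha : a < t₀) (hb : t₀ < b) (ht : t₀ ≤ t) :
    tent a t₀ b t = -1 / (b - t₀) * t + b / (b - t₀) := by
  have h1 : t₀ - a ≠ 0 := by linarith
  have h2 : b - t₀ ≠ 0 := by linarith
  rcases ht.eq_or_lt with rfl | ht
  · rw [tent_of_le le_rfl]
    field_simp
    ring
  · exact if_neg ht.not_ge

theorem tent_mem (ha : a < t₀) (hb : t₀ < b) (ht : t ∈ Set.Icc a b) :
    tent a t₀ b t ∈ Set.Icc (0 : ℝ) 1 := by
  have h1 : 0 < t₀ - a := by linarith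
  have h2 : 0 < b - t₀ := by linarith
  rcases le_total t t₀ with h | h
  · rw [tent_of_le h, show 1 / (t₀ - a) * t + -a / (t₀ - a) = (t - a) / (t₀ - a) by ring]
    exact ⟨div_nonneg (by linarith [ht.1]) h1.le, (div_le_one h1).2 (by linarith)⟩
  · rw [tent_of_ge ha hb h, show -1 / (b - t₀) * t + b / (b - t₀) = (b - t) / (b - t₀) by ring]
    exact ⟨div_nonneg (by linarith [ht.2]) h2.le, (div_le_one h2).2 (by linarith)⟩

end tent

theorem memH1_affine (hab : a ≤ b) (p q : ℝ) : MemH1 a b (fun t => ((p * t + q : ℝ) : ℂ)) :=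
  memH1_of_continuous_deriv (f' := fun _ => (p : ℂ)) hab (fun t => by
    have := ((hasDerivAt_id t).const_mul p).add_const q
    simpa using this.ofReal_comp) continuous_const

theorem MemH1.sub_const (hu : MemH1 a b u) (hab : a ≤ b) (z : ℂ) : MemH1 a b (fun t => u t - z) := by
  simpa only [sub_eq_add_neg] using (hu.add (memH1_const hab (-z)) hab).1

theorem MemH1.integral_inner_sub (hu : MemH1 a b u) (hab : a ≤ b) (z : ℂ) :
    ∫ t in a..b, inner ℝ (deriv u t) (u t - z) = ‖u b - z‖ ^ 2 / 2 - ‖u a - z‖ ^ 2 / 2 := by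
  have hz := hu.sub_const hab z
  have h1 := hz.integral_inner hz hab
  simp only [deriv_sub_const, real_inner_self_eq_norm_sq] at h1
  have h2 : ∫ t in a..b, (inner ℝ (deriv u t) (u t - z) + inner ℝ (u t - z) (deriv u t)) =
      2 * ∫ t in a..b, inner ℝ (deriv u t) (u t - z) := by
    rw [← intervalIntegral.integral_const_mul]
    refine intervalIntegral.integral_congr fun t _ => ?_
    rw [real_inner_comm (deriv u t) (u t - z)]
    ring
  rw [h2] at h1
  linarith

namespace IsActionMinimizer

/-- The variation is `-η (u - z)` with `η` the tent. Up to conservation of energy, the terms with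
factor `η` form the Lagrange–Jacobi expression for `|y - z|² / 2`, bounded below by `-κ`. The terms
with `η'` integrate exactly on each half, where `η'` is constant, and give the difference quotients.
-/
theorem tent_inequality (H : IsActionMinimizer α m c ν R p₁ p₂ l u) (hp : ‖p₁‖ = ‖p₂‖) {t₀ κ : ℝ}
    {z : ℂ} (hz : ‖z‖ ≤ R) (ha : 0 ≤ a) (hat : a < t₀) (htb : t₀ < b) (hb : b ≤ 1)
    (hne : ∀ t ∈ Set.Icc a b, ∀ k, u t ≠ c k) (hκ : 0 ≤ κ)
    (hG : ∀ t ∈ Set.Icc a b, ∀ v : ℂ, ‖v‖ ^ 2 = 2 * (effectivePotential α m c ν (u t) + (-1)) →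
      -κ ≤ 2 * (effectivePotential α m c ν (u t) + (-1)) +
        inner ℝ (potentialGradient α m c ν (u t)) (u t - z) +
        2 * ν * inner ℝ (Complex.I * (u t - z)) v) :
    frequency α m c (-1) ν u ^ 2 *
      ((‖u t₀ - z‖ ^ 2 / 2 - ‖u a - z‖ ^ 2 / 2) / (t₀ - a) +
        (‖u t₀ - z‖ ^ 2 / 2 - ‖u b - z‖ ^ 2 / 2) / (b - t₀)) ≤ κ * (b - a) := by
  set ω := frequency α m c (-1) ν u with hω
  have hω0 : 0 < ω := H.frequency_pos
  have hab : a ≤ b := (hat.trans htb).le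
  have hu := H.memH1.mono ha hab hb
  have hu1 := hu.mono le_rfl hat.le htb.le
  have hu2 := hu.mono hat.le htb.le le_rfl
  let φ : ℝ → ℂ := fun t => ((-tent a t₀ b t : ℝ) : ℂ) * (u t - z)
  have half : ∀ {s t p q : ℝ}, a ≤ s → s < t → t ≤ b →
      (∀ r ∈ Set.Icc s t, tent a t₀ b r = p * r + q) → MemH1 s t φ ∧
      ∀ᵐ r, r ∈ Set.Icc s t → deriv φ r = -((p : ℂ) * (u r - z) + tent a t₀ b r * deriv u r) := by
    intro s t p q has hst htb hη
    have hust := hu.mono has hst.le htb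
    obtain ⟨h1, h2⟩ := (memH1_affine hst.le (-p) (-q)).mul (hust.sub_const hst.le z) hst.le
    have heq : ∀ r ∈ Set.Icc s t, φ r = ((-p * r + -q : ℝ) : ℂ) * (u r - z) := fun r hr => by
      simp only [φ]
      rw [hη r hr]
      congr 2
      ring
    refine ⟨h1.congr hst.le heq, ?_⟩
    filter_upwards [h2, ae_ne s, ae_ne t] with r h3 hs ht hr
    rw [MemH1.deriv_eq_of_eqOn (fun x hx => heq x ⟨hx.1.le, hx.2.le⟩)
      ⟨lt_of_le_of_ne hr.1 hs.symm, lt_of_le_of_ne hr.2 ht⟩, (h3 hr).deriv, deriv_sub_const]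
    have : deriv (fun r : ℝ => ((-p * r + -q : ℝ) : ℂ)) r = (-p : ℝ) := by
      have := ((hasDerivAt_id r).const_mul (-p)).add_const (-q)
      simpa using this.ofReal_comp.deriv
    rw [this, hη r hr]
    push_cast
    ring
  obtain ⟨m1, d1⟩ := half le_rfl hat htb.le (fun r hr => tent_of_le hr.2)
  obtain ⟨m2, d2⟩ := half hat.le htb le_rfl (fun r hr => tent_of_ge hat htb hr.1)
  have hφ : MemH1 a b φ := m1.trans m2 hat.le htb.le
  have h1 : t₀ - a ≠ 0 := by linarith
  have h2 : b - t₀ ≠ 0 := by linarith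
  have hφa : φ a = 0 := by
    simp only [φ]
    rw [tent_of_le hat.le, show 1 / (t₀ - a) * a + -a / (t₀ - a) = 0 by ring]
    simp
  have hφb : φ b = 0 := by
    simp only [φ]
    rw [tent_of_ge hat htb htb.le, show -1 / (b - t₀) * b + b / (b - t₀) = 0 by ring]
    simp
  -- The varied path is a convex combination of `u t` and `z`, hence stays in the ball even where
  -- `u` touches its boundary.
  have hvar := H.first_variation hp ha hab hb hne hφ hφa hφb one_pos (by
    intro s hs t ht
    obtain ⟨h3, h4⟩ := tent_mem hat htb ht
    have h5 : 0 ≤ s * tent a t₀ b t := mul_nonneg hs.1.le h3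
    have h6 : s * tent a t₀ b t ≤ 1 := mul_le_one₀ hs.2.le h3 h4
    have h7 : u t + (s : ℂ) * φ t = ((1 - s * tent a t₀ b t : ℝ) : ℂ) * u t +
        ((s * tent a t₀ b t : ℝ) : ℂ) * z := by
      simp only [φ]
      push_cast
      ring
    rw [h7]
    refine (norm_add_le _ _).trans ?_
    rw [norm_mul, norm_mul, Complex.norm_real, Complex.norm_real, Real.norm_of_nonneg h5,
      Real.norm_of_nonneg (by linarith)]
    have := H.mem.2 t ⟨ha.trans ht.1, ht.2.trans hb⟩
    nlinarith [norm_nonneg (u t)])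
  simp only [← hω] at hvar
  have hgrad : ContinuousOn (fun t => potentialGradient α m c ν (u t)) (Set.Icc a b) := fun t ht =>
    (continuousAt_potentialGradient (hne t ht)).comp_continuousWithinAt (hu.continuousOn hab t ht)
  have i1 := hu.1.intervalIntegrable_inner hab hφ.1
  have i2 := hgrad.memLp_two.intervalIntegrable_inner hab (hφ.continuousOn hab).memLp_two
  have i3 := (hφ.continuousOn_I_mul hab).memLp_two.intervalIntegrable_inner hab hu.1
  let E : ℝ → ℝ := fun t => ω * inner ℝ (deriv u t) (deriv φ t) +
    inner ℝ (potentialGradient α m c ν (u t)) (φ t) / ω +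
    2 * ν * inner ℝ (Complex.I * φ t) (deriv u t)
  have iE : IntervalIntegrable E volume a b := ((i1.const_mul ω).add (i2.div_const ω)).add
    (i3.const_mul (2 * ν))
  have hE : 0 ≤ ∫ t in a..b, E t := by
    refine hvar.trans_eq ?_
    rw [← intervalIntegral.integral_const_mul, ← intervalIntegral.integral_const_mul,
      ← intervalIntegral.integral_div, ← intervalIntegral.integral_add (i1.const_mul ω)
      (i2.div_const ω), ← intervalIntegral.integral_add ((i1.const_mul ω).add (i2.div_const ω))
      (i3.const_mul (2 * ν))]
  have hbound : ∀ {s t p : ℝ}, a ≤ s → s < t → t ≤ b →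
      (∀ᵐ r, r ∈ Set.Icc s t → deriv φ r = -((p : ℂ) * (u r - z) + tent a t₀ b r * deriv u r)) →
      IntervalIntegrable E volume s t ∧ ∫ r in s..t, E r ≤
        -(ω * p * (‖u t - z‖ ^ 2 / 2 - ‖u s - z‖ ^ 2 / 2)) + κ / ω * (t - s) := by
    intro s t p has hst htb' hd
    have hust := hu.mono has hst.le htb'
    have iEs : IntervalIntegrable E volume s t := iE.mono_set (by
      rw [Set.uIcc_of_le hst.le, Set.uIcc_of_le hab]; exact Set.Icc_subset_Icc has htb')
    have i4 : IntervalIntegrable (fun r => inner ℝ (deriv u r) (u r - z)) volume s t :=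
      hust.1.intervalIntegrable_inner hst.le ((hust.sub_const hst.le z).continuousOn hst.le).memLp_two
    refine ⟨iEs, ?_⟩
    have e1 : ∫ r in s..t, (-(ω * p) * inner ℝ (deriv u r) (u r - z) + κ / ω) =
        -(ω * p * (‖u t - z‖ ^ 2 / 2 - ‖u s - z‖ ^ 2 / 2)) + κ / ω * (t - s) := by
      rw [intervalIntegral.integral_add (i4.const_mul _) (by simp),
        intervalIntegral.integral_const_mul, hust.integral_inner_sub hst.le,
        intervalIntegral.integral_const, smul_eq_mul]
      ring
    rw [← e1]
    refine intervalIntegral.integral_mono_ae_restrict hst.le iEs ((i4.const_mul _).add (by simp)) ?_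
    refine (ae_restrict_iff' measurableSet_Icc).2 ?_
    filter_upwards [hd, H.energy] with r hdr hen hr
    have hrab : r ∈ Set.Icc a b := ⟨has.trans hr.1, hr.2.trans htb'⟩
    have hen' := hen ⟨ha.trans hrab.1, hrab.2.trans hb⟩
    -- The velocity in physical time is `ω` times the derivative of `u`, and energy conservation
    -- makes it admissible in the hypothesis.
    have hg := hG r hrab (ω * deriv u r) (by
      rw [norm_mul, Complex.norm_real, mul_pow, Real.norm_eq_abs, sq_abs]; exact hen')
    have ht01 := tent_mem hat htb hrab
    set η := tent a t₀ b r
    rw [← hen', ← Complex.real_smul, inner_smul_right] at hg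
    have key : E r = -(ω * p) * inner ℝ (deriv u r) (u r - z) - η / ω *
        (ω ^ 2 * ‖deriv u r‖ ^ 2 + inner ℝ (potentialGradient α m c ν (u r)) (u r - z) +
        2 * ν * (ω * inner ℝ (Complex.I * (u r - z)) (deriv u r))) := by
      simp only [E]
      rw [hdr hr]
      simp only [φ]
      rw [mul_left_comm Complex.I, ← Complex.real_smul, ← Complex.real_smul, ← Complex.real_smul,
        ← Complex.real_smul, inner_neg_right, inner_add_right, inner_smul_right, inner_smul_right,
        inner_smul_right, inner_smul_left, real_inner_self_eq_norm_sq]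
      simp only [RCLike.conj_to_real]
      field_simp
      ring
    rw [key]
    have h7 : η / ω * -κ ≤ η / ω * (ω ^ 2 * ‖deriv u r‖ ^ 2 +
        inner ℝ (potentialGradient α m c ν (u r)) (u r - z) +
        2 * ν * (ω * inner ℝ (Complex.I * (u r - z)) (deriv u r))) :=
      mul_le_mul_of_nonneg_left hg (div_nonneg ht01.1 hω0.le)
    have h8 : η / ω * κ ≤ κ / ω := by
      rw [div_mul_eq_mul_div]
      exact div_le_div_of_nonneg_right (mul_le_of_le_one_left hκ ht01.2) hω0.le
    linarith
  obtain ⟨j1, b1⟩ := hbound le_rfl hat htb.le d1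
  obtain ⟨j2, b2⟩ := hbound hat.le htb le_rfl d2
  rw [← intervalIntegral.integral_add_adjacent_intervals j1 j2] at hE
  have h9 := hE.trans (add_le_add b1 b2)
  have h10 := mul_le_mul_of_nonneg_left h9 hω0.le
  have e2 : ω * (-(ω * (1 / (t₀ - a)) * (‖u t₀ - z‖ ^ 2 / 2 - ‖u a - z‖ ^ 2 / 2)) +
      κ / ω * (t₀ - a) + (-(ω * (-1 / (b - t₀)) * (‖u b - z‖ ^ 2 / 2 - ‖u t₀ - z‖ ^ 2 / 2)) +
      κ / ω * (b - t₀))) = κ * (b - a) - ω ^ 2 *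
      ((‖u t₀ - z‖ ^ 2 / 2 - ‖u a - z‖ ^ 2 / 2) / (t₀ - a) +
        (‖u t₀ - z‖ ^ 2 / 2 - ‖u b - z‖ ^ 2 / 2) / (b - t₀)) := by
    field_simp
    ring
  rw [mul_zero, e2] at h10
  linarith

end IsActionMinimizer

/-! ### No contact with the boundary circle and no accumulation of collisions. -/

theorem exists_last_hit {f : ℝ → ℝ} {s t r : ℝ} (hst : s ≤ t) (hf : ContinuousOn f (Set.Icc s t))
    (hs : f s ≤ r) (ht : r < f t) :
    ∃ x ∈ Set.Ico s t, f x ≤ r ∧ ∀ y ∈ Set.Icc x t, r ≤ f y := by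
  have hS : IsCompact (Set.Icc s t ∩ f ⁻¹' Set.Iic r) := isCompact_Icc.of_isClosed_subset
    (hf.preimage_isClosed_of_isClosed isClosed_Icc isClosed_Iic) Set.inter_subset_left
  obtain ⟨x, ⟨hx, hxr⟩, hmax⟩ := hS.exists_isGreatest ⟨s, ⟨le_rfl, hst⟩, hs⟩
  have hxt : x < t := lt_of_le_of_ne hx.2 fun h => by
    rw [h] at hxr
    exact (lt_of_lt_of_le ht hxr).false
  have hgt : ∀ y ∈ Set.Ioc x t, r < f y := fun y hy => by
    by_contra hle
    exact (hmax ⟨⟨hx.1.trans hy.1.le, hy.2⟩, not_lt.1 hle⟩).not_gt hy.1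
  have hxge : r ≤ f x := by
    have h1 : Tendsto f (𝓝[>] x) (𝓝 (f x)) := by
      rw [← nhdsWithin_Ioo_eq_nhdsGT hxt]
      exact (hf x hx).mono fun y hy => ⟨hx.1.trans hy.1.le, hy.2.le⟩
    refine ge_of_tendsto h1 ?_
    filter_upwards [Ioo_mem_nhdsGT hxt] with y hy using (hgt y ⟨hy.1, hy.2.le⟩).le
  refine ⟨x, ⟨hx.1, hxt⟩, hxr, fun y hy => ?_⟩
  rcases hy.1.eq_or_lt with rfl | h
  · exact hxge
  · exact (hgt y ⟨h, hy.2⟩).le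

theorem exists_first_hit {f : ℝ → ℝ} {s t r : ℝ} (hst : s ≤ t) (hf : ContinuousOn f (Set.Icc s t))
    (hs : r < f s) (ht : f t ≤ r) :
    ∃ x ∈ Set.Ioc s t, f x ≤ r ∧ ∀ y ∈ Set.Icc s x, r ≤ f y := by
  obtain ⟨x, hx, hxr, hall⟩ := exists_last_hit (f := fun y => f (s + t - y)) hst
    (hf.comp (by fun_prop) fun y hy => ⟨by linarith [hy.2], by linarith [hy.1]⟩)
    (by simpa using ht) (by simpa using hs)
  refine ⟨s + t - x, ⟨by linarith [hx.2], by linarith [hx.1]⟩, hxr, fun y hy => ?_⟩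
  simpa using hall (s + t - y) ⟨by linarith [hy.2], by linarith [hy.1]⟩

namespace IsActionMinimizer

/-- At a contact both difference quotients are nonnegative. One of them is at least `R²/2 - (R/2)²/2
= 3/8 R²` if its endpoint has radius at most `R / 2`, since the time differences are at most `1`.
The arc from the nearest visit to that radius to a point just beyond the contact stays in the
annulus. -/
theorem norm_lt (H : IsActionMinimizer α m c ν R p₁ p₂ l u) (hp : ‖p₁‖ = ‖p₂‖) (hR : 0 < R)
    (hc : ∀ k, ‖c k‖ ≤ R / 8) {κ : ℝ} (hκ : 0 ≤ κ)
    (hG : ∀ y v : ℂ, R / 2 ≤ ‖y‖ → ‖y‖ ≤ R →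
      ‖v‖ ^ 2 = 2 * (effectivePotential α m c ν y + (-1)) →
      -κ ≤ 2 * (effectivePotential α m c ν y + (-1)) + inner ℝ (potentialGradient α m c ν y) y +
        2 * ν * inner ℝ (Complex.I * y) v)
    (hω : κ < frequency α m c (-1) ν u ^ 2 * (3 / 8 * R ^ 2))
    (hclose : ∃ t ∈ Set.Icc (0 : ℝ) 1, ‖u t‖ ≤ R / 2) :
    ∀ t ∈ Set.Ioo (0 : ℝ) 1, ‖u t‖ < R := by
  intro t₀ ht₀
  by_contra hlt
  have htR : ‖u t₀‖ = R := le_antisymm (H.mem.2 t₀ ⟨ht₀.1.le, ht₀.2.le⟩) (not_lt.1 hlt)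
  have hcont := H.continuousOn.norm
  have hω0 : 0 < frequency α m c (-1) ν u ^ 2 := pow_pos H.frequency_pos 2
  -- a contraction of an arc that starts or ends on the circle of radius `R / 2`
  have key : ∀ a b : ℝ, 0 ≤ a → a < t₀ → t₀ < b → b ≤ 1 → (∀ t ∈ Set.Icc a b, R / 2 ≤ ‖u t‖) →
      ‖u a‖ ≤ R / 2 ∨ ‖u b‖ ≤ R / 2 → False := by
    intro a b ha hat htb hb hge hab
    have h1 := H.tent_inequality hp (z := 0) (by simpa using hR.le) ha hat htb hb (fun t ht k hk => by
      have := hge t ht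
      rw [hk] at this
      linarith [hc k]) hκ (fun t ht v hv => by
      rw [sub_zero]
      exact hG _ v (hge t ht) (H.mem.2 t ⟨ha.trans ht.1, ht.2.trans hb⟩) hv)
    simp only [sub_zero, htR] at h1
    have hRa : ‖u a‖ ^ 2 ≤ R ^ 2 :=
      pow_le_pow_left₀ (norm_nonneg _) (H.mem.2 a ⟨ha, by linarith⟩) 2
    have hRb : ‖u b‖ ^ 2 ≤ R ^ 2 :=
      pow_le_pow_left₀ (norm_nonneg _) (H.mem.2 b ⟨by linarith, hb⟩) 2
    have hq : ∀ x d : ℝ, 0 < d → d ≤ 1 → 0 ≤ x → x ≤ x / d := fun x d hd hd1 hx => by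
      rw [le_div_iff₀ hd]; exact mul_le_of_le_one_right hx hd1
    have h2 := hq (R ^ 2 / 2 - ‖u a‖ ^ 2 / 2) (t₀ - a) (by linarith) (by linarith) (by linarith)
    have h3 := hq (R ^ 2 / 2 - ‖u b‖ ^ 2 / 2) (b - t₀) (by linarith) (by linarith) (by linarith)
    have h4 : 3 / 8 * R ^ 2 ≤ (R ^ 2 / 2 - ‖u a‖ ^ 2 / 2) / (t₀ - a) +
        (R ^ 2 / 2 - ‖u b‖ ^ 2 / 2) / (b - t₀) := by
      rcases hab with h | h
      · have := pow_le_pow_left₀ (norm_nonneg _) h 2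
        linarith
      · have := pow_le_pow_left₀ (norm_nonneg _) h 2
        linarith
    have h5 := mul_le_mul_of_nonneg_left h4 hω0.le
    have h6 : κ * (b - a) ≤ κ := mul_le_of_le_one_right hκ (by linarith)
    linarith
  have hnear : ∃ δ > 0, ∀ t, |t - t₀| < δ → R / 2 ≤ ‖u t‖ := by
    have h1 : ContinuousAt (fun t => ‖u t‖) t₀ :=
      hcont.continuousAt (Icc_mem_nhds ht₀.1 ht₀.2)
    have h2 : ∀ᶠ t in 𝓝 t₀, R / 2 < ‖u t‖ :=
      h1.eventually (lt_mem_nhds (by simp only [htR]; linarith))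
    obtain ⟨δ, hδ, h3⟩ := Metric.eventually_nhds_iff.1 h2
    exact ⟨δ, hδ, fun t ht => (h3 (by rwa [Real.dist_eq])).le⟩
  obtain ⟨δ, hδ, hnear⟩ := hnear
  obtain ⟨t₁, ht₁, ht₁R⟩ := hclose
  rcases lt_or_ge t₁ t₀ with hlt' | hge'
  · obtain ⟨a, ha, haR, hall⟩ := exists_last_hit hlt'.le
      (hcont.mono (Set.Icc_subset_Icc ht₁.1 ht₀.2.le)) ht₁R (by rw [htR]; linarith)
    refine key a (min 1 (t₀ + δ / 2)) (ht₁.1.trans ha.1) ha.2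
      (lt_min ht₀.2 (by linarith)) (min_le_left _ _) (fun t ht => ?_) (Or.inl haR)
    rcases le_total t t₀ with h | h
    · exact hall t ⟨ht.1, h⟩
    · refine hnear t ?_
      rw [abs_of_nonneg (by linarith)]
      linarith [ht.2.trans (min_le_right _ _)]
  · obtain ⟨b, hb, hbR, hall⟩ := exists_first_hit hge'
      (hcont.mono (Set.Icc_subset_Icc ht₀.1.le ht₁.2)) (by rw [htR]; linarith) ht₁R
    refine key (max 0 (t₀ - δ / 2)) b (le_max_left _ _) (max_lt ht₀.1 (by linarith)) hb.1
      (hb.2.trans ht₁.2) (fun t ht => ?_) (Or.inr hbR)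
    rcases le_total t t₀ with h | h
    · refine hnear t ?_
      rw [abs_of_nonpos (by linarith)]
      linarith [(le_max_right _ _).trans ht.1]
    · exact hall t ⟨h, ht.2⟩

theorem isCompact_collisions (H : IsActionMinimizer α m c ν R p₁ p₂ l u) :
    IsCompact {t ∈ Set.Icc (0 : ℝ) 1 | ∃ k, u t = c k} := by
  have h1 : {t ∈ Set.Icc (0 : ℝ) 1 | ∃ k, u t = c k} = Set.Icc 0 1 ∩ u ⁻¹' Set.range c := by
    ext t
    simp [eq_comm]
  rw [h1]
  exact isCompact_Icc.of_isClosed_subset (H.continuousOn.preimage_isClosed_of_isClosed isClosed_Icc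
    (Set.finite_range c).isClosed) Set.inter_subset_left

/-- A minimizer has no excursion from a centre to itself that remains close to the centre. -/
theorem finite_collisions (H : IsActionMinimizer α m c ν R p₁ p₂ l u) (hp : ‖p₁‖ = ‖p₂‖)
    (hα₂ : α < 2) (hinj : Function.Injective c) (hc : ∀ k, ‖c k‖ ≤ R) :
    {t ∈ Set.Icc (0 : ℝ) 1 | ∃ k, u t = c k}.Finite := by
  set Z := {t ∈ Set.Icc (0 : ℝ) 1 | ∃ k, u t = c k} with hZ
  by_contra hinf
  have hZc := H.isCompact_collisions
  obtain ⟨x, hxZ, hacc⟩ := Set.Infinite.exists_accPt_of_subset_isCompact hinf hZc subset_rfl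
  obtain ⟨hx01, k, hxk⟩ := hxZ
  have h1 : ∀ᶠ y in 𝓝 (c k), (∀ j, y = c j → j = k) ∧ (y ≠ c k → ∀ v : ℂ,
      ‖v‖ ^ 2 = 2 * (effectivePotential α m c ν y + (-1)) →
      0 < 2 * (effectivePotential α m c ν y + (-1)) +
        inner ℝ (potentialGradient α m c ν y) (y - c k) +
        2 * ν * inner ℝ (Complex.I * (y - c k)) v) := by
    refine Filter.Eventually.and (eventually_all.2 fun j => ?_)
      (eventually_nhdsWithin_iff.1 (exists_virial_pos H.alpha_pos hα₂ H.mass_pos hinj k))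
    by_cases hjk : j = k
    · exact Eventually.of_forall fun _ _ => hjk
    · filter_upwards [isOpen_ne.mem_nhds (hinj.ne (Ne.symm hjk))] with y hy hyj
      exact absurd hyj hy
  have h2 : ∀ᶠ t in 𝓝[Set.Icc 0 1] x, (∀ j, u t = c j → j = k) ∧ (u t ≠ c k → ∀ v : ℂ,
      ‖v‖ ^ 2 = 2 * (effectivePotential α m c ν (u t) + (-1)) →
      0 < 2 * (effectivePotential α m c ν (u t) + (-1)) +
        inner ℝ (potentialGradient α m c ν (u t)) (u t - c k) +
        2 * ν * inner ℝ (Complex.I * (u t - c k)) v) := by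
    exact (H.continuousOn x hx01).eventually (by rwa [hxk])
  rw [eventually_nhdsWithin_iff, Metric.eventually_nhds_iff] at h2
  obtain ⟨δ, hδ, h2⟩ := h2
  obtain ⟨x', ⟨hx'δ, hx'Z⟩, hne⟩ := accPt_iff_nhds.1 hacc _ (Metric.ball_mem_nhds x hδ)
  obtain ⟨s₁, s₂, hs, hs₁, hs₂, hI⟩ : ∃ s₁ s₂ : ℝ, s₁ < s₂ ∧ s₁ ∈ Z ∧ s₂ ∈ Z ∧
      ∀ t ∈ Set.Icc s₁ s₂, dist t x < δ := by
    have hball : ∀ y ∈ Metric.ball x δ, ∀ y' ∈ Metric.ball x δ, ∀ t ∈ Set.Icc y y', dist t x < δ := by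
      intro y hy y' hy' t ht
      rw [Real.ball_eq_Ioo] at hy hy'
      rw [Real.dist_eq, abs_lt]
      constructor <;> linarith [hy.1, hy'.2, ht.1, ht.2]
    have hxx := Metric.mem_ball_self (x := x) hδ
    rcases lt_or_gt_of_ne hne with h | h
    · exact ⟨x', x, h, hx'Z, ⟨hx01, k, hxk⟩, hball _ hx'δ _ hxx⟩
    · exact ⟨x, x', h, ⟨hx01, k, hxk⟩, hx'Z, hball _ hxx _ hx'δ⟩
  have hs01 : ∀ t ∈ Set.Icc s₁ s₂, t ∈ Set.Icc (0 : ℝ) 1 := fun t ht =>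
    ⟨hs₁.1.1.trans ht.1, ht.2.trans hs₂.1.2⟩
  have hZk : ∀ t ∈ Set.Icc s₁ s₂, t ∈ Z → u t = c k := by
    rintro t ht ⟨-, j, hj⟩
    rw [hj, (h2 (hI t ht) (hs01 t ht)).1 j hj]
  -- The potential integral is finite, so collisions form a null set and cannot fill an interval.
  obtain ⟨t₀, ht₀, ht₀Z⟩ : ∃ t₀ ∈ Set.Ioo s₁ s₂, t₀ ∉ Z := by
    by_contra! hall
    have h3 := ae_ne_of_potentialIntegral_ne_top H.alpha_pos H.mass_pos H.continuousOn H.finite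
    have h4 : volume (Set.Ioo s₁ s₂) = 0 := by
      refine measure_mono_null (fun t ht => ?_) h3
      intro hcon
      obtain ⟨j, hj⟩ := (hall t ht).2
      exact hcon (hall t ht).1 j hj
    rw [Real.volume_Ioo, ENNReal.ofReal_eq_zero] at h4
    linarith
  obtain ⟨a', ⟨ha'Z, ha'⟩, hamax⟩ := (hZc.inter_right (isClosed_Icc (a := s₁) (b := t₀))).exists_isGreatest
    ⟨s₁, hs₁, le_rfl, ht₀.1.le⟩
  obtain ⟨b', ⟨hb'Z, hb'⟩, hbmin⟩ := (hZc.inter_right (isClosed_Icc (a := t₀) (b := s₂))).exists_isLeast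
    ⟨s₂, hs₂, ht₀.2.le, le_rfl⟩
  have ha't : a' < t₀ := lt_of_le_of_ne ha'.2 fun h => ht₀Z (h ▸ ha'Z)
  have hb't : t₀ < b' := lt_of_le_of_ne hb'.1 fun h => ht₀Z (h ▸ hb'Z)
  have hfree : ∀ t ∈ Set.Ioo a' b', t ∉ Z := by
    intro t ht htZ
    rcases le_total t t₀ with h | h
    · exact (hamax ⟨htZ, ha'.1.trans ht.1.le, h⟩).not_gt ht.1
    · exact (hbmin ⟨htZ, h, ht.2.le.trans hb'.2⟩).not_gt ht.2
  have hua : u a' = c k := hZk a' ⟨ha'.1, ha'.2.trans ht₀.2.le⟩ ha'Z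
  have hub : u b' = c k := hZk b' ⟨ht₀.1.le.trans hb'.1, hb'.2⟩ hb'Z
  have hpos : 0 < ‖u t₀ - c k‖ := by
    rw [norm_pos_iff, sub_ne_zero]
    exact fun h => ht₀Z ⟨hs01 t₀ ⟨ht₀.1.le, ht₀.2.le⟩, k, h⟩
  have hρ : ContinuousOn (fun t => ‖u t - c k‖) (Set.Icc 0 1) :=
    (H.continuousOn.sub continuousOn_const).norm
  -- The variation must avoid the centres, so the ends are moved slightly inside the excursion,
  -- where the distance to `c k` is still below its value at `t₀`.
  obtain ⟨a, haI, hlta⟩ : ∃ a ∈ Set.Ioo a' t₀, ‖u a - c k‖ < ‖u t₀ - c k‖ := by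
    have h3 : Tendsto (fun t => ‖u t - c k‖) (𝓝[>] a') (𝓝 ‖u a' - c k‖) := by
      rw [← nhdsWithin_Ioo_eq_nhdsGT ha't]
      exact (hρ a' ha'Z.1).mono fun y hy => ⟨ha'Z.1.1.trans hy.1.le, by linarith [hy.2, ht₀.2, hs₂.1.2]⟩
    rw [hua, sub_self, norm_zero] at h3
    obtain ⟨a, h4, h5⟩ := ((h3.eventually (gt_mem_nhds hpos)).and (Ioo_mem_nhdsGT ha't)).exists
    exact ⟨a, h5, h4⟩
  obtain ⟨b, hbI, hltb⟩ : ∃ b ∈ Set.Ioo t₀ b', ‖u b - c k‖ < ‖u t₀ - c k‖ := by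
    have h3 : Tendsto (fun t => ‖u t - c k‖) (𝓝[<] b') (𝓝 ‖u b' - c k‖) := by
      rw [← nhdsWithin_Ioo_eq_nhdsLT hb't]
      exact (hρ b' hb'Z.1).mono fun y hy => ⟨by linarith [hy.1, ht₀.1, hs₁.1.1], hy.2.le.trans hb'Z.1.2⟩
    rw [hub, sub_self, norm_zero] at h3
    obtain ⟨b, h4, h5⟩ := ((h3.eventually (gt_mem_nhds hpos)).and (Ioo_mem_nhdsLT hb't)).exists
    exact ⟨b, h5, h4⟩
  have ha0 : 0 ≤ a := ha'Z.1.1.trans haI.1.le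
  have hb1 : b ≤ 1 := hbI.2.le.trans hb'Z.1.2
  have hsub : ∀ t ∈ Set.Icc a b, t ∈ Set.Ioo a' b' := fun t ht =>
    ⟨haI.1.trans_le ht.1, ht.2.trans_lt hbI.2⟩
  have hsub' : ∀ t ∈ Set.Icc a b, t ∈ Set.Icc s₁ s₂ := fun t ht =>
    ⟨ha'.1.trans (hsub t ht).1.le, (hsub t ht).2.le.trans hb'.2⟩
  have hne' : ∀ t ∈ Set.Icc a b, ∀ j, u t ≠ c j := fun t ht j hj =>
    hfree t (hsub t ht) ⟨hs01 t (hsub' t ht), j, hj⟩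
  -- With `κ = 0` the weighted sum of difference quotients is at most zero, while both are positive.
  have h3 := H.tent_inequality hp (hc k) ha0 haI.2 hbI.1 hb1 hne' le_rfl (fun t ht v hv => by
    rw [neg_zero]
    exact ((h2 (hI t (hsub' t ht)) (hs01 t (hsub' t ht))).2 (hne' t ht k) v hv).le)
  rw [zero_mul] at h3
  have hω := pow_pos H.frequency_pos 2
  have e1 := pow_lt_pow_left₀ hlta (norm_nonneg _) two_ne_zero
  have e2 := pow_lt_pow_left₀ hltb (norm_nonneg _) two_ne_zero
  have e3 : 0 < (‖u t₀ - c k‖ ^ 2 / 2 - ‖u a - c k‖ ^ 2 / 2) / (t₀ - a) :=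
    div_pos (by linarith) (by linarith [haI.2])
  have e4 : 0 < (‖u t₀ - c k‖ ^ 2 / 2 - ‖u b - c k‖ ^ 2 / 2) / (b - t₀) :=
    div_pos (by linarith) (by linarith [hbI.1])
  have e5 := mul_pos hω (add_pos e3 e4)
  linarith

end IsActionMinimizer

end

section

/-! ### Regularity of minimizers away from the centres -/

variable {N : ℕ} {α : ℝ} {m : Fin N → ℝ} {c : Fin N → ℂ} {h ν R : ℝ} {a b : ℝ} {u v : ℝ → ℂ}
  {p₁ p₂ : ℂ} {l : Fin N → ZMod 2}

theorem hasDerivAt_of_integral_of_continuousOn {f g : ℝ → ℂ} (hg : IntervalIntegrable g volume a b)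
    (hgc : ContinuousOn g (Set.Ioo a b)) (hf : ∀ t ∈ Set.Icc a b, f t = f a + ∫ s in a..t, g s) :
    ∀ t ∈ Set.Ioo a b, HasDerivAt f (g t) t := by
  intro t ht
  have hab : a ≤ b := (ht.1.trans ht.2).le
  have h1 : HasDerivAt (fun x => ∫ s in a..x, g s) (g t) t :=
    intervalIntegral.integral_hasDerivAt_right
      (hg.mono_set (by rw [Set.uIcc_of_le hab, Set.uIcc_of_le ht.1.le]
                       exact Set.Icc_subset_Icc le_rfl ht.2.le))
      (hgc.stronglyMeasurableAtFilter isOpen_Ioo t ht) (hgc.continuousAt (Ioo_mem_nhds ht.1 ht.2))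
  refine (h1.const_add (f a)).congr_of_eventuallyEq ?_
  filter_upwards [Ioo_mem_nhds ht.1 ht.2] with s hs
  exact hf s ⟨hs.1.le, hs.2.le⟩

theorem contDiffOn_two {f f' f'' : ℝ → ℂ} {s : Set ℝ} (hs : IsOpen s)
    (h1 : ∀ t ∈ s, HasDerivAt f (f' t) t) (h2 : ∀ t ∈ s, HasDerivAt f' (f'' t) t)
    (h3 : ContinuousOn f'' s) : ContDiffOn ℝ 2 f s := by
  have e1 : ContDiffOn ℝ 1 f' s := by
    rw [show (1 : WithTop ℕ∞) = 0 + 1 by simp, contDiffOn_succ_iff_deriv_of_isOpen hs]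
    refine ⟨fun t ht => (h2 t ht).differentiableAt.differentiableWithinAt, by simp, ?_⟩
    rw [contDiffOn_zero]
    exact h3.congr fun t ht => (h2 t ht).deriv
  rw [show (2 : WithTop ℕ∞) = 1 + 1 by norm_num, contDiffOn_succ_iff_deriv_of_isOpen hs]
  exact ⟨fun t ht => (h1 t ht).differentiableAt.differentiableWithinAt, by simp,
    e1.congr fun t ht => (h1 t ht).deriv⟩

/-- The lemma of du Bois-Reymond. -/
theorem ae_eq_const_of_integral_inner_eq_zero (hab : a < b) {f : ℝ → ℂ}
    (hf : MemLp f 2 (volume.restrict (Set.Icc a b)))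
    (hzero : ∀ φ : ℝ → ℂ, MemH1 a b φ → φ a = 0 → φ b = 0 →
      ∫ t in a..b, inner ℝ (f t) (deriv φ t) = 0) :
    ∃ z : ℂ, ∀ᵐ t, t ∈ Set.Icc a b → f t = z := by
  -- The mean of `f` is the constant for which the primitive of `f - z` vanishes at both ends; that
  -- primitive is the test path.
  set z : ℂ := ((b - a)⁻¹ : ℝ) • ∫ t in a..b, f t with hz
  have hba : b - a ≠ 0 := by linarith
  have hfi := hf.intervalIntegrable_two hab.le
  have hg : MemLp (fun t => f t - z) 2 (volume.restrict (Set.Icc a b)) :=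
    hf.sub (memLp_const z)
  have hgi := hg.intervalIntegrable_two hab.le
  let φ : ℝ → ℂ := fun t => ∫ s in a..t, (f s - z)
  have hφ0 : φ a = 0 := by simp [φ]
  have hφint : ∀ t ∈ Set.Icc a b, φ t = φ a + ∫ s in a..t, (f s - z) := fun t _ => by
    rw [hφ0, zero_add]
  have hφ : MemH1 a b φ := memH1_of_integral hab.le hg hφint
  have hint : ∫ s in a..b, (f s - z) = 0 := by
    rw [intervalIntegral.integral_sub hfi (by simp), intervalIntegral.integral_const, hz, smul_smul,
      mul_inv_cancel₀ hba, one_smul, sub_self]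
  have h1 := hzero φ hφ hφ0 hint
  have hd : ∀ᵐ t, t ∈ Set.Icc a b → deriv φ t = f t - z := by
    filter_upwards [hasDerivAt_of_integral hab.le hgi hφint] with t ht hab
    exact (ht hab).deriv
  have h2 : ∫ t in a..b, ‖f t - z‖ ^ 2 = 0 := by
    have h3 : ∫ t in a..b, inner ℝ z (f t - z) = 0 := by
      have := (innerSL ℝ z).intervalIntegral_comp_comm hgi
      simp only [innerSL_apply_apply] at this
      rw [this, hint, inner_zero_right]
    rw [integral_congr_Icc (g := fun t => inner ℝ (f t - z) (f t - z) + inner ℝ z (f t - z)) hab.le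
      (by
        filter_upwards [hd] with t ht hab
        rw [ht hab, ← inner_add_left, sub_add_cancel]), intervalIntegral.integral_add
      (hg.intervalIntegrable_inner hab.le hg)
      ((memLp_const z).intervalIntegrable_inner hab.le hg), h3, add_zero] at h1
    simpa only [real_inner_self_eq_norm_sq] using h1
  refine ⟨z, ?_⟩
  have hi := hg.intervalIntegrable_sq hab.le
  rw [← setIntegral_Icc_eq hab.le, setIntegral_eq_zero_iff_of_nonneg_ae
    (Eventually.of_forall fun t => by positivity)
    ((intervalIntegrable_iff_integrableOn_Icc_of_le hab.le).1 hi)] at h2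
  filter_upwards [(ae_restrict_iff' measurableSet_Icc).1 h2] with t ht hab
  have := ht hab
  simpa [sub_eq_zero] using this

namespace IsActionMinimizer

/-- On a compact arc inside the open ball small variations of either sign are admissible, so the
one-sided inequality becomes an equality. -/
theorem euler_lagrange (H : IsActionMinimizer α m c ν R p₁ p₂ l u) (hp : ‖p₁‖ = ‖p₂‖) (ha : 0 ≤ a)
    (hab : a ≤ b) (hb : b ≤ 1) (hne : ∀ t ∈ Set.Icc a b, ∀ k, u t ≠ c k)
    (hlt : ∀ t ∈ Set.Icc a b, ‖u t‖ < R) {φ : ℝ → ℂ} (hφ : MemH1 a b φ)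
    (hφa : φ a = 0) (hφb : φ b = 0) :
    let ω := frequency α m c (-1) ν u
    ω * (∫ t in a..b, inner ℝ (deriv u t) (deriv φ t)) +
      (∫ t in a..b, inner ℝ (potentialGradient α m c ν (u t)) (φ t)) / ω +
      2 * ν * (∫ t in a..b, inner ℝ (Complex.I * φ t) (deriv u t)) = 0 := by
  intro ω
  obtain ⟨x, hx, hmax⟩ := isCompact_Icc.exists_isMaxOn ⟨a, le_rfl, hab⟩
    ((H.memH1.mono ha hab hb).continuousOn hab).norm
  have hgap : 0 < R - ‖u x‖ := by linarith [hlt x hx]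
  have main : ∀ ψ : ℝ → ℂ, MemH1 a b ψ → ψ a = 0 → ψ b = 0 →
      0 ≤ ω * (∫ t in a..b, inner ℝ (deriv u t) (deriv ψ t)) +
      (∫ t in a..b, inner ℝ (potentialGradient α m c ν (u t)) (ψ t)) / ω +
      2 * ν * (∫ t in a..b, inner ℝ (Complex.I * ψ t) (deriv u t)) := by
    intro ψ hψ hψa hψb
    obtain ⟨D, hD⟩ := isCompact_Icc.exists_bound_of_continuousOn (hψ.continuousOn hab)
    refine H.first_variation hp ha hab hb hne hψ hψa hψb (s₀ := (R - ‖u x‖) / (|D| + 1))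
      (by positivity) fun s hs t ht => ?_
    have h1 : ‖ψ t‖ ≤ |D| + 1 := (hD t ht).trans ((le_abs_self D).trans (by linarith))
    have h2 := (lt_div_iff₀ (by positivity)).1 hs.2
    have h3 := mul_le_mul_of_nonneg_left h1 hs.1.le
    have h4 : ‖u t‖ ≤ ‖u x‖ := hmax ht
    refine (norm_add_le _ _).trans ?_
    rw [norm_mul, Complex.norm_real, Real.norm_of_nonneg hs.1.le]
    linarith
  refine le_antisymm ?_ (main φ hφ hφa hφb)
  have hneg := main (fun t => -φ t) (by
    simpa using (hφ.const_smul hab (-1)).1) (by simp [hφa]) (by simp [hφb])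
  simp only [deriv.fun_neg, inner_neg_right, mul_neg, inner_neg_left, intervalIntegral.integral_neg,
    neg_div] at hneg
  linarith

/-- By du Bois-Reymond, `ω u'` equals a primitive of the force plus a constant almost everywhere. So
`u'` has a continuous representative, then the force is continuous, and then `u` is of class `C²`.
-/
theorem regular (H : IsActionMinimizer α m c ν R p₁ p₂ l u) (hp : ‖p₁‖ = ‖p₂‖)
    (hlt : ∀ t ∈ Set.Ioo (0 : ℝ) 1, ‖u t‖ < R) {t₀ : ℝ} (ht₀ : t₀ ∈ Set.Ioo (0 : ℝ) 1)
    (hne₀ : ∀ k, u t₀ ≠ c k) :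
    let ω := frequency α m c (-1) ν u
    ContDiffAt ℝ 2 u t₀ ∧
    ω ^ 2 * deriv (deriv u) t₀ + 2 * ν * Complex.I * (ω * deriv u t₀) =
      potentialGradient α m c ν (u t₀) ∧
    ω ^ 2 * ‖deriv u t₀‖ ^ 2 = 2 * (effectivePotential α m c ν (u t₀) + (-1)) := by
  intro ω
  have hω : 0 < ω := H.frequency_pos
  have hωc : (ω : ℂ) ≠ 0 := by exact_mod_cast hω.ne'
  obtain ⟨δ, hδ, hball⟩ : ∃ δ > 0, ∀ t, |t - t₀| ≤ δ → t ∈ Set.Ioo (0 : ℝ) 1 ∧ ∀ k, u t ≠ c k := by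
    have h1 : ContinuousAt u t₀ := H.continuousOn.continuousAt (Icc_mem_nhds ht₀.1 ht₀.2)
    have h2 : ∀ᶠ t in 𝓝 t₀, ∀ k, u t ≠ c k := eventually_all.2 fun k =>
      h1.eventually (isOpen_ne.mem_nhds (hne₀ k))
    obtain ⟨δ, hδ, h3⟩ := Metric.eventually_nhds_iff.1 (h2.and (Ioo_mem_nhds ht₀.1 ht₀.2))
    refine ⟨δ / 2, by positivity, fun t ht => ?_⟩
    obtain ⟨h4, h5⟩ := h3 (show dist t t₀ < δ by rw [Real.dist_eq]; linarith)
    exact ⟨h5, h4⟩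
  set a := t₀ - δ with ha
  set b := t₀ + δ with hb
  have hab : a < b := by rw [ha, hb]; linarith
  have hIcc : ∀ t ∈ Set.Icc a b, t ∈ Set.Ioo (0 : ℝ) 1 ∧ ∀ k, u t ≠ c k := fun t ht =>
    hball t (abs_le.2 ⟨by linarith [ht.1], by linarith [ht.2]⟩)
  have ha0 : 0 ≤ a := (hIcc a ⟨le_rfl, hab.le⟩).1.1.le
  have hb1 : b ≤ 1 := (hIcc b ⟨hab.le, le_rfl⟩).1.2.le
  have hu := H.memH1.mono ha0 hab.le hb1
  have hcu := hu.continuousOn hab.le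
  have hne : ∀ t ∈ Set.Icc a b, ∀ k, u t ≠ c k := fun t ht => (hIcc t ht).2
  have hgrad : ContinuousOn (fun t => potentialGradient α m c ν (u t)) (Set.Icc a b) := fun t ht =>
    (continuousAt_potentialGradient (hne t ht)).comp_continuousWithinAt (hcu t ht)
  -- `F` is the force in the rescaled time, with the area term of the first variation rewritten as
  -- the Coriolis force.
  let F : ℝ → ℂ := fun t => ((ω⁻¹ : ℝ) : ℂ) * potentialGradient α m c ν (u t) -
    2 * ν * Complex.I * deriv u t
  have hF : MemLp F 2 (volume.restrict (Set.Icc a b)) :=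
    (hgrad.memLp_two.const_mul _).sub (hu.1.const_mul _)
  have hFi := hF.intervalIntegrable_two hab.le
  let f : ℝ → ℂ := fun t => ∫ s in a..t, F s
  have hf0 : f a = 0 := by simp [f]
  have hfint : ∀ t ∈ Set.Icc a b, f t = f a + ∫ s in a..t, F s := fun t _ => by rw [hf0, zero_add]
  have hf : MemH1 a b f := memH1_of_integral hab.le hF hfint
  have hcf := hf.continuousOn hab.le
  obtain ⟨z, hz⟩ := ae_eq_const_of_integral_inner_eq_zero (f := fun t => ω * deriv u t - f t) hab
    ((hu.1.const_mul _).sub hcf.memLp_two) fun φ hφ hφa hφb => by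
    have h1 := H.euler_lagrange hp ha0 hab.le hb1 hne (fun t ht => hlt t (hIcc t ht).1) hφ hφa hφb
    have h2 := hf.integral_inner hφ hab.le
    rw [hφa, hφb, inner_zero_right, inner_zero_right, sub_zero] at h2
    have cφ := (hφ.continuousOn hab.le).memLp_two
    have i1 := hu.1.intervalIntegrable_inner hab.le hφ.1
    have i2 := hgrad.memLp_two.intervalIntegrable_inner hab.le cφ
    have i3 := (hφ.continuousOn_I_mul hab.le).memLp_two.intervalIntegrable_inner hab.le hu.1
    have i4 := hf.1.intervalIntegrable_inner hab.le cφ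
    have i5 := hcf.memLp_two.intervalIntegrable_inner hab.le hφ.1
    rw [← h1, ← sub_zero (_ + _), ← h2, ← intervalIntegral.integral_const_mul,
      ← intervalIntegral.integral_const_mul, ← intervalIntegral.integral_div,
      ← intervalIntegral.integral_add (i1.const_mul ω) (i2.div_const ω),
      ← intervalIntegral.integral_add ((i1.const_mul ω).add (i2.div_const ω))
      (i3.const_mul (2 * ν)), ← intervalIntegral.integral_sub (((i1.const_mul ω).add
      (i2.div_const ω)).add (i3.const_mul (2 * ν))) (i4.add i5)]
    refine integral_congr_Icc hab.le ?_
    filter_upwards [hasDerivAt_of_integral hab.le hFi hfint] with t ht htab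
    rw [(ht htab).deriv]
    simp only [F]
    rw [show 2 * (ν : ℂ) * Complex.I * deriv u t = ((2 * ν : ℝ) : ℂ) * (Complex.I * deriv u t) by
      push_cast; ring, ← Complex.real_smul, ← Complex.real_smul, ← Complex.real_smul,
      inner_sub_left, inner_sub_left, inner_smul_left, inner_smul_left, inner_smul_left,
      inner_I_mul_comm (φ t)]
    simp only [RCLike.conj_to_real]
    field_simp
    ring
  let w : ℝ → ℂ := fun t => ((ω⁻¹ : ℝ) : ℂ) * (f t + z)
  have hcw : ContinuousOn w (Set.Icc a b) := continuousOn_const.mul (hcf.add continuousOn_const)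
  have huw : ∀ᵐ t, t ∈ Set.Icc a b → deriv u t = w t := by
    filter_upwards [hz] with t ht hab
    simp only [w]
    rw [← ht hab]
    push_cast
    field_simp
    ring
  have hderu : ∀ t ∈ Set.Ioo a b, HasDerivAt u (w t) t := by
    refine hasDerivAt_of_integral_of_continuousOn (hcw.memLp_two.intervalIntegrable_two hab.le)
      (hcw.mono Set.Ioo_subset_Icc_self) fun t ht => ?_
    rw [hu.2 t ht]
    congr 1
    refine integral_congr_Icc ht.1 ?_
    filter_upwards [huw] with s hs hst using hs ⟨hst.1, hst.2.trans ht.2⟩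
  have hFeq : ∀ t ∈ Set.Ioo a b, F t = ((ω⁻¹ : ℝ) : ℂ) * potentialGradient α m c ν (u t) -
      2 * ν * Complex.I * w t := fun t ht => by
    simp only [F]
    rw [(hderu t ht).deriv]
  have hcF : ContinuousOn F (Set.Ioo a b) := by
    refine ContinuousOn.congr ?_ hFeq
    exact ((continuousOn_const.mul hgrad).sub (continuousOn_const.mul hcw)).mono
      Set.Ioo_subset_Icc_self
  have hderw : ∀ t ∈ Set.Ioo a b, HasDerivAt w (((ω⁻¹ : ℝ) : ℂ) * F t) t := fun t ht =>
    ((hasDerivAt_of_integral_of_continuousOn hFi hcF hfint t ht).add_const z).const_mul _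
  have ht₀ab : t₀ ∈ Set.Ioo a b := ⟨by linarith, by linarith⟩
  have hmem : Set.Ioo a b ∈ 𝓝 t₀ := Ioo_mem_nhds ht₀ab.1 ht₀ab.2
  have hdd : deriv (deriv u) t₀ = ((ω⁻¹ : ℝ) : ℂ) * F t₀ := by
    have : deriv u =ᶠ[𝓝 t₀] w := by
      filter_upwards [hmem] with t ht using (hderu t ht).deriv
    rw [this.deriv_eq, (hderw t₀ ht₀ab).deriv]
  refine ⟨(contDiffOn_two isOpen_Ioo hderu hderw (continuousOn_const.mul hcF)).contDiffAt hmem,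
    ?_, ?_⟩
  · rw [hdd, hFeq t₀ ht₀ab, (hderu t₀ ht₀ab).deriv]
    push_cast
    field_simp
    ring
  -- The energy identity holds almost everywhere, and both sides are now continuous.
  · have h1 : Set.EqOn (fun t => ω ^ 2 * ‖w t‖ ^ 2)
        (fun t => 2 * (effectivePotential α m c ν (u t) + (-1))) (Set.Ioo a b) := by
      refine MeasureTheory.Measure.eqOn_open_of_ae_eq (μ := volume) ?_ isOpen_Ioo
        (continuousOn_const.mul ((hcw.mono Set.Ioo_subset_Icc_self).norm.pow 2)) ?_
      · refine (ae_restrict_iff' measurableSet_Ioo).2 ?_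
        filter_upwards [H.energy] with t ht htab
        rw [← (hderu t htab).deriv]
        exact ht ⟨ha0.trans htab.1.le, htab.2.le.trans hb1⟩
      · refine continuousOn_const.mul (ContinuousOn.add (fun t ht => ?_) continuousOn_const)
        have ht' := Set.Ioo_subset_Icc_self ht
        exact (continuousAt_effectivePotential H.alpha_pos.ne' (hne t ht')).comp_continuousWithinAt
          ((hcu.mono Set.Ioo_subset_Icc_self) t ht)
    rw [(hderu t₀ ht₀ab).deriv]
    exact h1 ht₀ab

end IsActionMinimizer

end

section

/-! ### Weak solutions from minimizers -/

variable {N : ℕ} {α : ℝ} {m : Fin N → ℝ} {c : Fin N → ℂ} {ν R : ℝ} {u v : ℝ → ℂ}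
  {p₁ p₂ : ℂ} {l : Fin N → ZMod 2}

/-- The minimizer is global in `K`, so the radius `1` is arbitrary; paths of infinite potential
integral have value `⊤`. -/
theorem IsActionMinimizer.isLocalMinimizer (H : IsActionMinimizer α m c ν R p₁ p₂ l u)
    {K : Set (ℝ → ℂ)} (huK : u ∈ K)
    (hK : ∀ v ∈ K, MemH1 0 1 v ∧ 0 < kin 0 1 v ∧
      (potentialIntegral α m c (-1) ν 0 1 v ≠ ⊤ → action α m c ν u ≤ action α m c ν v)) :
    IsLocalMinimizer 0 1 (maupertuis α m c (-1) ν 0 1) K u := by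
  refine ⟨huK, 1, one_pos, fun v hv _ => ?_⟩
  obtain ⟨h1, h2, h3⟩ := hK v hv
  by_cases hP : potentialIntegral α m c (-1) ν 0 1 v = ⊤
  · rw [maupertuis_eq_top h1 zero_le_one h2 hP]
    exact le_top
  · rw [maupertuis_eq H.memH1 zero_le_one H.finite, maupertuis_eq h1 zero_le_one hP]
    exact EReal.coe_le_coe_iff.2 (h3 hP)

theorem IsActionMinimizer.isWeakSolution (H : IsActionMinimizer α m c ν R p₁ p₂ l u)
    (hp : ‖p₁‖ = ‖p₂‖) (hα₂ : α < 2) (hinj : Function.Injective c) (hc : ∀ k, ‖c k‖ ≤ R)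
    (hlt : ∀ t ∈ Set.Ioo (0 : ℝ) 1, ‖u t‖ < R) {K : Set (ℝ → ℂ)}
    (hK : IsLocalMinimizer 0 1 (maupertuis α m c (-1) ν 0 1) K u) :
    IsWeakSolutionFrom α m c (-1) ν R p₁ p₂ K u (1 / frequency α m c (-1) ν u)
      (fun t => u (frequency α m c (-1) ν u * t)) := by
  set ω := frequency α m c (-1) ν u with hω
  have hω0 : 0 < ω := H.frequency_pos
  have hPpos : 0 < potentialIntegral α m c (-1) ν 0 1 u := by
    have := H.half_le_toReal
    exact (ENNReal.toReal_pos_iff.1 (by linarith)).1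
  have hK' : kineticIntegral 0 1 u = ENNReal.ofReal (kin 0 1 u) :=
    H.memH1.kineticIntegral_eq zero_le_one
  have hIoo : ∀ t ∈ Set.Ioo 0 (1 / ω), ω * t ∈ Set.Ioo (0 : ℝ) 1 := fun t ht =>
    ⟨mul_pos hω0 ht.1, by have := (lt_div_iff₀ hω0).1 ht.2; linarith⟩
  have hIcc : ∀ t ∈ Set.Icc 0 (1 / ω), ω * t ∈ Set.Icc (0 : ℝ) 1 := fun t ht =>
    ⟨mul_nonneg hω0.le ht.1, by have := (le_div_iff₀ hω0).1 ht.2; linarith⟩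
  have hd1 : deriv (fun t => u (ω * t)) = fun t => (ω : ℂ) * deriv u (ω * t) := by
    funext t
    rw [deriv_comp_mul_left, Complex.real_smul]
  have hd2 : ∀ t, deriv (deriv (fun t => u (ω * t))) t = (ω : ℂ) ^ 2 * deriv (deriv u) (ω * t) := by
    intro t
    rw [hd1, deriv_const_mul_field, deriv_comp_mul_left, Complex.real_smul]
    ring
  refine ⟨hK, ?_, ?_, hPpos, lt_top_iff_ne_top.2 H.finite, by positivity, rfl, fun t _ => rfl,
    ⟨?_, ?_, fun t ht => hlt _ (hIoo t ht), ?_, ?_, fun t ht hne => ?_, fun t ht hne => ?_,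
      fun t ht hne => ?_⟩⟩
  · rw [hK']
    exact ENNReal.ofReal_pos.2 H.kin_pos
  · rw [hK']
    exact ENNReal.ofReal_lt_top
  · simpa using H.mem.1.2.1
  · rw [mul_one_div_cancel hω0.ne']
    exact H.mem.1.2.2.1
  · exact H.continuousOn.comp (by fun_prop) hIcc
  · refine ((H.finite_collisions hp hα₂ hinj hc).preimage
      (f := fun t => ω * t) (mul_right_injective₀ hω0.ne').injOn).subset ?_
    exact fun t ht => ⟨hIcc t ht.1, ht.2⟩
  · exact (H.regular hp hlt (hIoo t ht) hne).1.comp t (by fun_prop)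
  · obtain ⟨-, h2, -⟩ := H.regular hp hlt (hIoo t ht) hne
    rw [hd2, hd1, (hasGradientAt_effectivePotential H.alpha_pos.ne' hne).gradient]
    exact h2
  · obtain ⟨-, -, h3⟩ := H.regular hp hlt (hIoo t ht) hne
    rw [hd1, norm_mul, Complex.norm_real, mul_pow, Real.norm_eq_abs, sq_abs]
    linarith

theorem IsActionMinimizer.mem_ballClass (H : IsActionMinimizer α m c ν R p₁ p₂ l u)
    (hp₁ : ‖p₁‖ = R) (hp₂ : ‖p₂‖ = R) (hα₂ : α < 2) (hinj : Function.Injective c)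
    (hc : ∀ k, ‖c k‖ < R) {ω : ℝ} (hω : 0 < ω) :
    (fun t => u (ω * t)) ∈ ballClass c R p₁ p₂ l 0 (1 / ω) := by
  have hT : 0 < 1 / ω := by positivity
  have hIcc : ∀ t ∈ Set.Icc 0 (1 / ω), ω * t ∈ Set.Icc (0 : ℝ) 1 := fun t ht =>
    ⟨mul_nonneg hω.le ht.1, by have := (le_div_iff₀ hω).1 ht.2; linarith⟩
  have h1 : MemH1 0 (1 / ω) (fun t => u (ω * t)) := by
    simpa using (H.memH1.comp_affine (p := ω) (q := 0) hω hT.le (by simp)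
      (by rw [mul_one_div_cancel hω.ne']; simp)).1
  refine ⟨mem_weakClass_of_finite_collisions hT hinj hp₁ hp₂ hc
    (comp_mem_topClass hT.le H.mem.1 (by fun_prop) hIcc (by simp) (mul_one_div_cancel hω.ne') h1) ?_,
    fun t ht => H.mem.2 _ (hIcc t ht)⟩
  refine ((H.finite_collisions (hp₁.trans hp₂.symm) hα₂ hinj fun k => (hc k).le).preimage
      (f := fun t => ω * t) (mul_right_injective₀ hω.ne').injOn).subset ?_
  exact fun t ht => ⟨hIcc t ht.1, ht.2⟩

/-- All constants are fixed before `ε`, `ν`, `l` and the endpoints: the competitor bounds the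
action, the action bounds the frequency below, and this dictates how small the virial defect `κ`
must be. -/
theorem exists_interior_minimizer [NeZero N] (hα : 1 ≤ α) (hα₂ : α < 2) (hm : ∀ k, 0 < m k)
    {d : Fin N → ℂ} (hd : Function.Injective d) (hd1 : ∀ k, ‖d k‖ ≤ 1) :
    ∃ ε₄ > (0 : ℝ), ε₄ ≤ circularRadius α m / 8 ∧ ∃ ν₂ > (0 : ℝ),
      ∀ p₁ p₂ : ℂ, ‖p₁‖ = circularRadius α m → ‖p₂‖ = circularRadius α m →
      ∀ ε ∈ Set.Ioo 0 ε₄, ∀ ν ∈ Set.Ioo (-ν₂) ν₂, ∀ l : Fin N → ZMod 2, IsWindingVector l →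
      ∃ u, IsActionMinimizer α m (fun k => ε * d k) ν (circularRadius α m) p₁ p₂ l u ∧
        ∀ t ∈ Set.Ioo (0 : ℝ) 1, ‖u t‖ < circularRadius α m := by
  have hα0 : 0 < α := by linarith
  have hR : 0 < circularRadius α m := circularRadius_pos hα0 hα₂ hm
  obtain ⟨C₀, ε₀, hε₀, hcomp⟩ := exists_competitor hα hα₂ hm hd hd1 hR
  set C := max C₀ 1 with hC
  have hC1 : 1 ≤ C := le_max_right _ _
  obtain ⟨ε₁, hε₁, ν₁, hν₁, hvir⟩ := exists_virial_ge (N := N) hα hα₂ hm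
    -- Below it is shown that `ω² ≥ 1 / (36 C²)`; the factor `72` makes the inequality required by
    -- `norm_lt` strict.
    (κ := 3 / 8 * circularRadius α m ^ 2 / (72 * C ^ 2)) (by positivity)
  refine ⟨min (min ε₀ ε₁) (circularRadius α m / 8), by positivity, min_le_right _ _,
    min ν₁ (1 / (2 * circularRadius α m)), by positivity, ?_⟩
  intro p₁ p₂ hp₁ hp₂ ε hε ν hν l hl
  set R := circularRadius α m with hRdef
  have hε0 : 0 < ε := hε.1
  have hεε₀ : ε < ε₀ := hε.2.trans_le ((min_le_left _ _).trans (min_le_left _ _))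
  have hεε₁ : ε < ε₁ := hε.2.trans_le ((min_le_left _ _).trans (min_le_right _ _))
  have hεR : ε ≤ R / 8 := hε.2.le.trans (min_le_right _ _)
  have hνabs : |ν| < min ν₁ (1 / (2 * R)) := abs_lt.2 hν
  have hνν₁ : |ν| < ν₁ := hνabs.trans_le (min_le_left _ _)
  have hνR : |ν| * R ≤ 1 / 2 := by
    have := mul_le_mul_of_nonneg_right (hνabs.le.trans (min_le_right _ _)) hR.le
    refine this.trans_eq ?_
    field_simp
  have hcε : ∀ k, ‖(ε : ℂ) * d k‖ ≤ ε := fun k => by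
    rw [norm_mul, Complex.norm_real, Real.norm_of_nonneg hε0.le]
    exact mul_le_of_le_one_right hε0.le (hd1 k)
  have hcR : ∀ k, ‖(ε : ℂ) * d k‖ ≤ R / 8 := fun k => (hcε k).trans hεR
  obtain ⟨w, hw, hwP, hwC⟩ := hcomp ε hε0 hεε₀ ν (by linarith) p₁ p₂ hp₁ hp₂ l
  obtain ⟨u, hu, huP, hmin⟩ := exists_minimizer (c := fun k => (ε : ℂ) * d k) hα hα₂ hm hcR hνR
    hp₁ hp₂ hl ⟨w, hw, hwP⟩
  have hkin : 0 < kin 0 1 u :=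
    lt_of_lt_of_le (by positivity) (sq_half_le_kin hR hp₁ hp₂ hl hcR hu.1)
  have H : IsActionMinimizer α m (fun k => ε * d k) ν R p₁ p₂ l u :=
    ⟨hu, huP, hmin, hkin, hα0, hm, fun y hy hyc => half_le_effectivePotential hα hα₂ hm hcR hy hyc⟩
  refine ⟨u, H, ?_⟩
  have hact : action α m (fun k => (ε : ℂ) * d k) ν u ≤ 3 * C := by
    refine (hmin w hw hwP).trans ?_
    have h1 := (abs_le.1 (abs_mul_area_le hw.1.1 hw.2 hνR)).2
    have h2 : 1 ≤ Real.sqrt 2 *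
        Real.sqrt (potentialIntegral α m (fun k => (ε : ℂ) * d k) (-1) ν 0 1 w).toReal := by
      rw [← Real.sqrt_mul (by norm_num), Real.one_le_sqrt]
      have := (ENNReal.ofReal_le_iff_le_toReal hwP).1
        (half_le_potentialIntegral (ν := ν) hα hα₂ hm hcR hw.2)
      linarith
    have h3 := mul_le_mul_of_nonneg_left h2 (Real.sqrt_nonneg (kin 0 1 w))
    have h4 : Real.sqrt 2 ≤ 2 := Real.sqrt_le_iff.2 ⟨by norm_num, by norm_num⟩
    have h5 : Real.sqrt (kin 0 1 w) *
        Real.sqrt (potentialIntegral α m (fun k => (ε : ℂ) * d k) (-1) ν 0 1 w).toReal ≤ C :=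
      hwC.trans (le_max_left _ _)
    have h6 : Real.sqrt 2 * (Real.sqrt (kin 0 1 w) *
        Real.sqrt (potentialIntegral α m (fun k => (ε : ℂ) * d k) (-1) ν 0 1 w).toReal) ≤ 2 * C :=
      mul_le_mul h4 h5 (by positivity) (by norm_num)
    unfold action
    linarith
  have hS := (sqrt_kin_le_action hα hα₂ hm hcR hνR hu.1.1 hu.2 huP).2
  have hω0 := H.frequency_pos
  have hfs := H.frequency_mul_sqrt
  have hfk := H.frequency_sq_mul
  have hhalf := H.half_le_toReal
  have hclose := exists_norm_le_of_mem_topClass (r := R / 2) zero_le_one hp₁ hp₂ hl hcR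
    (by linarith) (by linarith) hu.1
  refine H.norm_lt (hp₁.trans hp₂.symm) hR hcR (κ := 3 / 8 * R ^ 2 / (72 * C ^ 2)) (by positivity)
    (fun y v h1 h2 h3 => hvir _ ε hε0.le hεε₁ hcε ν hνν₁ y v h1 h2 h3) ?_ hclose
  set ω := frequency α m (fun k => (ε : ℂ) * d k) (-1) ν u
  rw [mul_right_comm, ← hfs, mul_assoc, Real.mul_self_sqrt hkin.le] at hS
  -- The action bound gives `ω * kin ≤ 6C`, while `ω² * kin` is twice the potential integral, hence
  -- at least `1`.
  have h1 : 1 ≤ ω * (6 * C) := by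
    have h2 : ω * (ω * kin 0 1 u) ≤ ω * (6 * C) :=
      mul_le_mul_of_nonneg_left (by linarith) hω0.le
    have h3 : ω * (ω * kin 0 1 u) = ω ^ 2 * kin 0 1 u := by ring
    linarith
  have h2 : 1 ≤ ω ^ 2 * (36 * C ^ 2) := by
    have := one_le_pow₀ h1 (n := 2)
    calc (1 : ℝ) ≤ (ω * (6 * C)) ^ 2 := this
      _ = _ := by ring
  have h3 : 0 < 3 / 8 * R ^ 2 := by positivity
  rw [div_lt_iff₀ (by positivity)]
  nlinarith

theorem exists_induces (P : Finpartition (Finset.univ : Finset (Fin N))) (hP : P.parts.card = 2) :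
    ∃ l : Fin N → ZMod 2, IsWindingVector l ∧ Induces l P := by
  classical
  obtain ⟨A, B, hAB, hparts⟩ := Finset.card_eq_two.1 hP
  have hA : A ∈ P.parts := by simp [hparts]
  have hB : B ∈ P.parts := by simp [hparts]
  have hdisj : Disjoint A B := P.disjoint hA hB hAB
  have hsup : A ∪ B = Finset.univ := by
    have := P.sup_parts
    rwa [hparts, Finset.sup_insert, Finset.sup_singleton] at this
  obtain ⟨j, hj⟩ := P.nonempty_of_mem_parts hA
  obtain ⟨k, hk⟩ := P.nonempty_of_mem_parts hB
  have hkA : k ∉ A := fun h => Finset.disjoint_left.1 hdisj h hk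
  have hBA : ∀ x, x ∈ B ↔ x ∉ A := fun x => by
    refine ⟨fun h h' => Finset.disjoint_left.1 hdisj h' h, fun h => ?_⟩
    have : x ∈ A ∪ B := by rw [hsup]; exact Finset.mem_univ x
    exact (Finset.mem_union.1 this).resolve_left h
  refine ⟨fun x => if x ∈ A then 0 else 1, ⟨j, k, fun h => hkA (h ▸ hj), by simp [hj, hkA]⟩, ?_⟩
  rw [Induces, hparts]
  congr 1
  · ext x
    by_cases hx : x ∈ A <;> simp [hx]
  · congr 1
    ext x
    by_cases hx : x ∈ A <;> simp [hx, hBA]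

end

end RotatingCentres

end

theorem mainTheorem6 (N : ℕ) (hN : 3 ≤ N) (α : ℝ) (hα₁ : 1 ≤ α) (hα₂ : α < 2)
    (m : Fin N → ℝ) (hm : ∀ k, 0 < m k)
    (c : Fin N → ℂ) (hc : Function.Injective c) (hc₀ : ∑ k, (m k : ℂ) * c k = 0) :
    ∃ ε₄ > (0 : ℝ), ∃ ν₂ > (0 : ℝ),
      ∀ p₁ ∈ Metric.sphere (0 : ℂ) (RotatingCentres.circularRadius α m),
      ∀ p₂ ∈ Metric.sphere (0 : ℂ) (RotatingCentres.circularRadius α m),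
      ∀ ε ∈ Set.Ioo 0 ε₄, ∀ ν ∈ Set.Ioo (-ν₂) ν₂,
        (∀ l : Fin N → ZMod 2, RotatingCentres.IsWindingVector l →
          ∃ (u : ℝ → ℂ) (T : ℝ) (y : ℝ → ℂ),
            RotatingCentres.IsWeakSolutionFrom α m (RotatingCentres.scaledCentres c ε) (-1) ν
              (RotatingCentres.circularRadius α m) p₁ p₂
              (RotatingCentres.ballClass (RotatingCentres.scaledCentres c ε)
                (RotatingCentres.circularRadius α m) p₁ p₂ l 0 1) u T y ∧
            y ∈ RotatingCentres.ballClass (RotatingCentres.scaledCentres c ε)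
                (RotatingCentres.circularRadius α m) p₁ p₂ l 0 T) ∧
        (∀ P : Finpartition (Finset.univ : Finset (Fin N)), P.parts.card = 2 →
          ∃ (u : ℝ → ℂ) (T : ℝ) (y : ℝ → ℂ),
            RotatingCentres.IsWeakSolutionFrom α m (RotatingCentres.scaledCentres c ε) (-1) ν
              (RotatingCentres.circularRadius α m) p₁ p₂
              (RotatingCentres.partitionClass (RotatingCentres.scaledCentres c ε)
                (RotatingCentres.circularRadius α m) p₁ p₂ P 0 1) u T y ∧
            y ∈ RotatingCentres.partitionClass (RotatingCentres.scaledCentres c ε)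
                (RotatingCentres.circularRadius α m) p₁ p₂ P 0 T) := by
  open RotatingCentres in
  classical
  have : NeZero N := ⟨by lia⟩
  have hR : 0 < circularRadius α m := circularRadius_pos (by linarith) hα₂ hm
  set R := circularRadius α m with hRdef
  set D := ⨆ j, ‖c j‖ with hD
  have hle : ∀ k, ‖c k‖ ≤ D := fun k => le_ciSup (Set.finite_range fun j => ‖c j‖).bddAbove k
  have hD0 : 0 < D := by
    by_contra hle0
    have hz : ∀ k, c k = 0 := fun k => by
      rw [← norm_le_zero_iff]
      exact (hle k).trans (not_lt.1 hle0)
    have : (⟨0, by lia⟩ : Fin N) = ⟨1, by lia⟩ := hc (by rw [hz, hz])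
    simp at this
  have hD' : (D : ℂ) ≠ 0 := by exact_mod_cast hD0.ne'
  have hd : Function.Injective (fun k => (D : ℂ)⁻¹ * c k) := fun j k hjk =>
    hc (mul_left_cancel₀ (inv_ne_zero hD') hjk)
  have hd1 : ∀ k, ‖(D : ℂ)⁻¹ * c k‖ ≤ 1 := fun k => by
    rw [norm_mul, norm_inv, Complex.norm_real, Real.norm_of_nonneg hD0.le, inv_mul_le_iff₀ hD0,
      mul_one]
    exact hle k
  -- The configuration is normalized to maximal norm `1`, so that the constants are obtained once
  -- for all `ε`.
  have hscale : ∀ ε : ℝ, (fun k => (ε : ℂ) * ((D : ℂ)⁻¹ * c k)) = scaledCentres c ε := fun ε => by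
    funext k
    rw [scaledCentres]
    push_cast
    ring
  obtain ⟨ε₄, hε₄, hεR, ν₂, hν₂, hmin⟩ := exists_interior_minimizer hα₁ hα₂ hm hd hd1
  refine ⟨ε₄, hε₄, ν₂, hν₂, fun p₁ hp₁ p₂ hp₂ ε hε ν hν => ?_⟩
  rw [mem_sphere_zero_iff_norm] at hp₁ hp₂
  have hmin' := hmin p₁ p₂ hp₁ hp₂ ε hε ν hν
  have hp : ‖p₁‖ = ‖p₂‖ := hp₁.trans hp₂.symm
  have hε0 : (ε : ℂ) ≠ 0 := by exact_mod_cast hε.1.ne'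
  have hcinj : Function.Injective (scaledCentres c ε) := by
    rw [← hscale]
    exact fun j k hjk => hd (mul_left_cancel₀ hε0 hjk)
  have hc8 : ∀ k, ‖scaledCentres c ε k‖ ≤ R / 8 := fun k => by
    rw [← hscale, norm_mul, Complex.norm_real, Real.norm_of_nonneg hε.1.le]
    exact (mul_le_of_le_one_right hε.1.le (hd1 k)).trans (hε.2.le.trans hεR)
  have hcR : ∀ k, ‖scaledCentres c ε k‖ < R := fun k => by linarith [hc8 k]
  rw [hscale ε] at hmin'
  have hmem1 : ∀ l u, IsActionMinimizer α m (scaledCentres c ε) ν R p₁ p₂ l u →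
      u ∈ ballClass (scaledCentres c ε) R p₁ p₂ l 0 1 := fun l u H => by
    simpa using H.mem_ballClass hp₁ hp₂ hα₂ hcinj hcR one_pos
  have hcompare : ∀ l, IsWindingVector l → ∀ v ∈ ballClass (scaledCentres c ε) R p₁ p₂ l 0 1,
      v ∈ topBall (scaledCentres c ε) R p₁ p₂ l 0 1 ∧ 0 < kin 0 1 v := fun l hl v hv => by
    have h1 := ballClass_subset_topBall zero_le_one hp hv
    exact ⟨h1, lt_of_lt_of_le (by positivity) (sq_half_le_kin hR hp₁ hp₂ hl hc8 h1.1)⟩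
  refine ⟨fun l hl => ?_, fun P hP => ?_⟩
  · obtain ⟨u, H, hlt⟩ := hmin' l hl
    refine ⟨u, _, _, H.isWeakSolution hp hα₂ hcinj (fun k => (hcR k).le) hlt
      (H.isLocalMinimizer (hmem1 l u H) fun v hv => ?_),
      H.mem_ballClass hp₁ hp₂ hα₂ hcinj hcR H.frequency_pos⟩
    obtain ⟨h1, h2⟩ := hcompare l hl v hv
    exact ⟨h1.1.1, h2, H.le v h1⟩
  · choose! U HU hlt using hmin'
    obtain ⟨l₀, hl₀⟩ := exists_induces P hP
    -- Each minimizer was obtained within one class; the least action among the finitely many `l`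
    -- that induce `P` is minimal on their union.
    obtain ⟨l, hl, hbest⟩ := Finset.exists_min_image
      (Finset.univ.filter fun l : Fin N → ZMod 2 => IsWindingVector l ∧ Induces l P)
      (fun l => action α m (scaledCentres c ε) ν (U l)) ⟨l₀, by simpa using hl₀⟩
    obtain ⟨hlw, hlP⟩ := (Finset.mem_filter.1 hl).2
    have H := HU l hlw
    refine ⟨U l, _, _, H.isWeakSolution hp hα₂ hcinj (fun k => (hcR k).le) (hlt l hlw)
      (H.isLocalMinimizer ⟨l, hlw, hlP, hmem1 l _ H⟩ ?_),
      ⟨l, hlw, hlP, H.mem_ballClass hp₁ hp₂ hα₂ hcinj hcR H.frequency_pos⟩⟩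
    rintro v ⟨l', hl', hlP', hv⟩
    obtain ⟨h1, h2⟩ := hcompare l' hl' v hv
    exact ⟨h1.1.1, h2, fun hfin => (hbest l' (by simp [hl', hlP'])).trans
      ((HU l' hl').le v h1 hfin)⟩
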